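/- Let $k\subset K\subset K'$ be fields of characteristic $0$ with $K'/K$ finite, let $F=K'((t))$, $O=K'[[t]]$, and let $V_F$ be an $F$-vector space of finite dimension $n$. Vector fields $\theta\in\mathrm{Der}_k(K)$ are extended (uniquely) to $K'$, and to $F$ by $\theta(t)=0$. Let $\nabla$ be an absolute (i.e. relative to $k$) flat connection on $V_F$, given by commuting actions of $\nabla(\partial_t)$ and of the horizontal fields $\nabla(\theta)$, and let $V_O\subset V_F$ be an $O$-lattice with respect to which $\nabla$ is $m$-admissible, $m\ge 2$: $t^m\nabla(\partial_t)$ maps $V_O$ bijectively onto $V_O$, and $t^{m-1}\nabla(\theta)V_O\subset V_O$ for all horizontal $\theta$. Choose a $k$-structure $V_k$ of $V_F$ (the $k$-span of an $F$-basis) with $V_O=O\cdot V_k$; put $V_{K'}=K'\otimes_kV_k$, let $\nabla^0$ be the absolute connection with $\nabla^0(V_k)=0$, and write $\nabla-\nabla^0=\mathcal A=\mathcal A_t+\mathcal A_x$ with $\mathcal A_t=t^{-m}g\,dt$ vertical and $\mathcal A_x=t^{-m+1}\eta$ horizontal. Let $g_0$ be the constant term of $g$. Let $\nu=ut^{\ell}dt$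 with $\ell\in\mathbb Z$, $u\in O^\times$, and let $u_0$ be the constant term of $u$. Let $\tau_\nu=\nu^{-1}$ be the corresponding vertical vector field. The $\varepsilon$-line $\mathcal E_\nu$ is the determinant line $\det(V_F^\infty,\nabla(\tau_\nu)^\infty)$ of the Fredholm operator induced by $\nabla(\tau_\nu)$, modulo operators of finite rank, on the discrete space $V_F/V_O$. It carries the $\varepsilon$-connection $\nabla^\varepsilon$: for $\theta\in\mathrm{Der}_k(K)$ put $a=\theta(u)/u$, so that $[\nabla(\theta),\nabla(\tau_\nu)]=-a\nabla(\tau_\nu)$; then $\nabla^\varepsilon_\theta$ is given by transport of structure along the infinitesimal symmetry $1+\epsilon\nabla(\theta)$, followed by the action of the lift $\nabla_\nu^{\mathrm{tr}\nabla}(a)$ of $a$ to the Tate central extension $\mathfrak{gl}^\flat(V_F)$. Here $\nabla_\nu^{\mathrm{tr}\nabla}(a)$ is the lift of $a$ that is anti-invariant under the involution of $\mathfrak{gl}^\flat(V_F)$ defined by the form $(x,y)\mapsto tr_{K'/K}\mathrm{Res}(\sum x_iy_i\nu)$ in coordinates with respect to a $k$-basis of $V_k$, minus the scalar $tr_{K'/K}\mathrm{Res}(a\,\mathrm{Tr}\mathcal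 A_t)$. The isomorphism $V_F/V_O\to V_F/t^{-\ell-m}V_O$ induced by $\nabla(\tau_\nu)$, together with multiplication by powers of $t$, yields a natural isomorphism of $K$-lines $$\beta_\nu:\mathcal E_\nu\simeq(\det{}_KV_{K'})^{\otimes(\ell+m)}.$$ Let $\nabla^0_{\mathcal E}$ be the connection on $\mathcal E_\nu$ that corresponds under $\beta_\nu$ to the connection on the right hand side defined by the $k$-structure $V_k$. Then $$\nabla^\varepsilon-\nabla^0_{\mathcal E}=tr_{K'/K}(\phi_1+\phi_2+\phi_3),$$ where $\phi_i\in\Omega^1_{K'/k}$ are $$\phi_1=\mathrm{Res}\,\mathrm{Tr}(g^{-1}dg\wedge\mathcal A_x)-\tfrac m2\,d\log\det g_0,$$ $$\phi_2=(\ell+m)\,\mathrm{Res}\,\mathrm{Tr}(\mathcal A_x\wedge dt/t),$$ $$\phi_3=n(\tfrac{\ell}{2}+m)\,d\log u_0-\mathrm{Res}(d\log u\wedge\mathrm{Tr}\mathcal A).$$ Here $\mathrm{Res}$ is the residue along the fibres, with $\mathrm{Res}(\alpha\wedge f\,dt)=\alpha\cdot\mathrm{Res}(f\,dt)$ for horizontal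 $\alpha$. The equality is an equality of 1-forms evaluated on all $\theta\in\mathrm{Der}_k(K)$. -/

import Mathlib

noncomputable section

namespace EpsLine

/-! ### Traces, determinants and determinant lines of Fredholm operators over a field -/

section Linear

variable {K : Type*} [Field K]
variable {M N : Type*} [AddCommGroup M] [Module K M] [AddCommGroup N] [Module K N]

/-- A linear map of finite rank. Two maps with the same source and target define the same
asymptotic morphism iff their difference has finite rank. -/
def FiniteRank (f : N →ₗ[K] M) : Prop := Module.Finite K (LinearMap.range f)

/-- The trace of an endomorphism `x` such that `x ∘ x` has finite rank: the trace of the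
restriction of `x` to the finite-dimensional space `range (x ∘ x)`.
For `x` of finite rank this is the usual trace. For an endomorphism `x` of a Tate vector space
with `x L = 0` and `range x ⊆ L'`, where `L ⊆ L'` are c-lattices, it is the trace of the
endomorphism of `L' / L` induced by `x`. -/
def ftrace (x : Module.End K M) : K :=
  LinearMap.trace K (LinearMap.range (x ∘ₗ x))
    (x.restrict (p := LinearMap.range (x ∘ₗ x)) (q := LinearMap.range (x ∘ₗ x))
      (by rintro _ ⟨z, rfl⟩; exact ⟨x z, rfl⟩))

/-- The determinant of an endomorphism `h` such that `h - 1` has finite rank: the determinant of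
the restriction of `h` to the range of `h - 1`. -/
def fdet (h : Module.End K M) : K :=
  LinearMap.det
    (h.restrict (p := LinearMap.range (h - 1)) (q := LinearMap.range (h - 1))
      (by rintro _ ⟨z, rfl⟩; exact ⟨h z, by simp⟩))

/-- A frame of size `(a, b)` of the determinant line of the asymptotic isomorphism `N → M` defined
by a Fredholm operator `f`: an honest isomorphism `N ⊕ K^a ≃ M ⊕ K^b` whose component `N → M`
equals `f` up to finite rank. The frame stands for the generator of the determinant line given
by the determinant of this isomorphism, `K^a` and `K^b` having their standard volume elements. -/
structure DetFrame (f : N →ₗ[K] M) (a b : ℕ) where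
  iso : (N × (Fin a → K)) ≃ₗ[K] (M × (Fin b → K))
  lift : FiniteRank (LinearMap.fst K M (Fin b → K) ∘ₗ iso.toLinearMap ∘ₗ
    LinearMap.inl K N (Fin a → K) - f)

/-- `q'` is the frame `q ⊕ id` of size `(a + 1, b + 1)`. -/
def DetFrame.IsStab {f : N →ₗ[K] M} {a b : ℕ} (q : DetFrame f a b)
    (q' : DetFrame f (a + 1) (b + 1)) : Prop :=
  ∀ (x : N) (c : Fin a → K) (z : K),
    q'.iso (x, Fin.snoc c z) = ((q.iso (x, c)).1, Fin.snoc (q.iso (x, c)).2 z)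

/-- The determinant line of a Fredholm operator `f : N → M` (it depends only on the asymptotic
morphism of `f`). A vector is given by its coordinate `s q` with respect to each frame `q`, where
`[q'] = det (q⁻¹ q') [q]` and `[q ⊕ id] = [q]`. For `M`, `N` of finite dimension it is
`det M ⊗ (det N)⁻¹`, and a frame with `a = b = 0` is the trivialization by an isomorphism. -/
def DetLine (f : N →ₗ[K] M) : Submodule K ((a b : ℕ) → DetFrame f a b → K) where
  carrier := {s |
    (∀ (a b : ℕ) (q q' : DetFrame f a b),
      s a b q = s a b q' * fdet (q.iso.symm.toLinearMap ∘ₗ q'.iso.toLinearMap)) ∧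
    (∀ (a b : ℕ) (q : DetFrame f a b) (q' : DetFrame f (a + 1) (b + 1)),
      q.IsStab q' → s (a + 1) (b + 1) q' = s a b q)}
  add_mem' := by
    rintro s s' ⟨h1, h2⟩ ⟨h1', h2'⟩
    refine ⟨fun a b q q' => ?_, fun a b q q' hq => ?_⟩
    · simp only [Pi.add_apply]
      rw [h1 a b q q', h1' a b q q', add_mul]
    · simp only [Pi.add_apply]
      rw [h2 a b q q' hq, h2' a b q q' hq]
  zero_mem' := by
    refine ⟨fun a b q q' => ?_, fun a b q q' _ => ?_⟩ <;> simp
  smul_mem' := by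
    rintro c s ⟨h1, h2⟩
    refine ⟨fun a b q q' => ?_, fun a b q q' hq => ?_⟩
    · simp only [Pi.smul_apply, smul_eq_mul]
      rw [h1 a b q q', mul_assoc]
    · simp only [Pi.smul_apply]
      rw [h2 a b q q' hq]

/-- The line `(det_K U)^{⊗ N}`, `N ∈ ℤ`, for a finite-dimensional `K`-vector space `U`. A vector is
given by its coordinate `s e` with respect to the generator `(e₁ ∧ ⋯ ∧ e_r)^{⊗ N}` for each
basis `e` of `U`. -/
def DetPow (N : ℤ) (U : Type*) [AddCommGroup U] [Module K U] :
    Submodule K (Module.Basis (Fin (Module.finrank K U)) K U → K) where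
  carrier := {s | ∀ e e', s e = s e' * (e.det e') ^ N}
  add_mem' := by
    intro s s' h h' e e'
    simp only [Pi.add_apply]
    rw [h e e', h' e e', add_mul]
  zero_mem' := by intro e e'; simp
  smul_mem' := by
    intro c s h e e'
    simp only [Pi.smul_apply, smul_eq_mul]
    rw [h e e', mul_assoc]

end Linear

/-! ### Operators along a derivation -/

section Along

variable {k K : Type*} [Field k] [Field K] [Algebra k K]

/-- The action on the `K`-space `M` of a derivation `θ` of `K` (a connection along `θ`). -/
structure ConnAlong (θ : Derivation k K K) (M : Type*) [AddCommGroup M] [Module K M] where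
  toFun : M →+ M
  leibniz : ∀ (c : K) (x : M), toFun (c • x) = θ c • x + c • toFun x

variable {θ : Derivation k K K}
variable {M N : Type*} [AddCommGroup M] [Module K M] [AddCommGroup N] [Module K N]

/-- Extension to `M ⊕ K^a`, with the coordinatewise action on `K^a`. -/
def ConnAlong.extend (D : ConnAlong θ M) (a : ℕ) : ConnAlong θ (M × (Fin a → K)) where
  toFun :=
    { toFun := fun x => (D.toFun x.1, fun i => θ (x.2 i))
      map_zero' := by ext <;> simp
      map_add' := by intro x y; ext <;> simp }
  leibniz := by
    intro c x
    ext
    · simp [D.leibniz]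
    · simp [mul_comm, add_comm]

/-- The commutator `D₁ ∘ q - q ∘ D₂`, a `K`-linear map. -/
def ConnAlong.comm (D₁ : ConnAlong θ M) (D₂ : ConnAlong θ N) (q : N →ₗ[K] M) : N →ₗ[K] M where
  toFun x := D₁.toFun (q x) - q (D₂.toFun x)
  map_add' := by intro x y; simp only [map_add]; abel
  map_smul' := by
    intro c x
    simp only [map_smul, D₁.leibniz, D₂.leibniz, map_add, RingHom.id_apply, smul_sub]
    abel

/-- For a connection along `θ` on `U`, the induced action on `(det_K U)^{⊗ N}`, in coordinates:
`θ (s e) + N · tr(matrix of D in the basis e) · s e`. -/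
def detPowDeriv (N : ℤ) {U : Type*} [AddCommGroup U] [Module K U] (D : ConnAlong θ U)
    (s : DetPow (K := K) N U) (e : Module.Basis (Fin (Module.finrank K U)) K U) : K :=
  θ (s.1 e) + (N : K) * (∑ i, e.repr (D.toFun (e i)) i) * s.1 e

/-- The action of an infinitesimal symmetry on a determinant line, in coordinates. Let `[q]` be a
frame of the determinant line of the Fredholm operator `f : M → M`. Let `D` be an operator along
`θ` on `M`, `B` a linear operator on `M`, and `z` a scalar. Transport of structure along
`1 + ε D` followed by multiplication by the lift `(1 + ε B)(1 + ε z)` of `(1 + ε B)^∞` to the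
Tate extension gives
`[q] ↦ (tr (q⁻¹ ([D, q] + B q)) + z) [q]`,
extended to `s q • [q]` by the Leibniz rule. (The operator under the trace has finite rank as soon
as `[D, f] + B f` has.) -/
def detLineDeriv {f : M →ₗ[K] M} (D : ConnAlong θ M) (B : Module.End K M) (z : K)
    (s : DetLine f) (a b : ℕ) (q : DetFrame f a b) : K :=
  θ (s.1 a b q) + s.1 a b q *
    (ftrace (q.iso.symm.toLinearMap ∘ₗ
      ((D.extend b).comm (D.extend a) q.iso.toLinearMap +
        (B.prodMap (0 : (Fin b → K) →ₗ[K] (Fin b → K))) ∘ₗ q.iso.toLinearMap)) + z)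

end Along

/-! ### Laurent series, absolute connections -/

section Laurent

variable {k K K' : Type*} [Field k] [Field K] [Field K'] [Algebra k K] [Algebra k K'] [Algebra K K']

/-- The power `t ^ j` of the parameter. -/
def tpow (K' : Type*) [Field K'] (j : ℤ) : LaurentSeries K' := HahnSeries.single j 1

/-- The vector field `∂_t` on `K'((t))`. -/
def ddt (f : LaurentSeries K') : LaurentSeries K' := LaurentSeries.derivative K' f

/-- The extension of a vector field on `K'` to `K'((t))` that kills `t`: it acts on coefficients. -/
def horDer (θ : Derivation k K' K') (f : LaurentSeries K') : LaurentSeries K' :=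
  HahnSeries.map f θ

/-- The residue of `f dt`. -/
def res (f : LaurentSeries K') : K' := f.coeff (-1)

variable (k K K') in
/-- A vector field on `Spec K`, together with its (unique) extension to the finite separable
extension `K'`. -/
structure HorField where
  base : Derivation k K K
  ext : Derivation k K' K'
  compat : ∀ c : K, ext (algebraMap K K' c) = algebraMap K K' (base c)

variable (k K') in
/-- An absolute (i.e. relative to `k`) flat connection on a vector space `V` over `F = K'((t))`:
the action `vert` of the vertical vector field `∂_t`, and the action `hor θ` of the horizontal
vector fields `θ` on `K'` (acting on `F` with `θ(t) = 0`); these fields commute with `∂_t`. -/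
structure AbsFlatConn (V : Type*) [AddCommGroup V] [Module (LaurentSeries K') V] where
  vert : V →+ V
  hor : Derivation k K' K' → V →+ V
  vert_leibniz : ∀ (f : LaurentSeries K') (v : V), vert (f • v) = ddt f • v + f • vert v
  hor_leibniz : ∀ (θ : Derivation k K' K') (f : LaurentSeries K') (v : V),
    hor θ (f • v) = horDer θ f • v + f • hor θ v
  hor_add : ∀ (θ θ' : Derivation k K' K') (v : V), hor (θ + θ') v = hor θ v + hor θ' v
  hor_smul : ∀ (c : K') (θ : Derivation k K' K') (v : V),
    hor (c • θ) v = (HahnSeries.C c : LaurentSeries K') • hor θ v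
  flat_vert : ∀ (θ : Derivation k K' K') (v : V), hor θ (vert v) = vert (hor θ v)
  flat_hor : ∀ (θ θ' : Derivation k K' K') (v : V),
    hor θ (hor θ' v) - hor θ' (hor θ v) = hor ⁅θ, θ'⁆ v

/-- Differential 1-forms on `F = K'((t))` relative to `k`, with values in an `F`-algebra `A`:
the horizontal part of a form `α` is given by its values `α.x θ` on the horizontal vector fields `θ`,
and its vertical part is `α.t dt`. -/
structure OneForm (k K' : Type*) [Field k] [Field K'] [Algebra k K'] (A : Type*) where
  x : Derivation k K' K' → A
  t : A

/-- The function `c` such that the contraction of `α ∧ β` with the horizontal field `θ` in the first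
argument is `c dt` modulo horizontal forms:
`(α_x + α_t dt) ∧ (β_x + β_t dt) = (α_x β_t - α_t β_x) ∧ dt + ⋯`.
The residue of `α ∧ β` along the fibres is the residue of `c dt`. -/
def OneForm.wedge {A : Type*} [Ring A] (α β : OneForm k K' A) (θ : Derivation k K' K') : A :=
  α.x θ * β.t - α.t * β.x θ

/-- `d log f`. -/
def dlog (f : LaurentSeries K') : OneForm k K' (LaurentSeries K') where
  x θ := horDer θ f * f⁻¹
  t := ddt f * f⁻¹

/-- The form `dt / t`. -/
def dtOverT : OneForm k K' (LaurentSeries K') where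
  x _ := 0
  t := tpow K' (-1)

/-- `g⁻¹ dg` for a matrix of Laurent series. -/
def matDlog {ι : Type*} [Fintype ι] [DecidableEq ι] (g : Matrix ι ι (LaurentSeries K')) :
    OneForm k K' (Matrix ι ι (LaurentSeries K')) where
  x θ := g⁻¹ * g.map (horDer θ)
  t := g⁻¹ * g.map ddt

/-- The trace of a matrix-valued form. -/
def OneForm.trace {ι : Type*} [Fintype ι] (α : OneForm k K' (Matrix ι ι (LaurentSeries K'))) :
    OneForm k K' (LaurentSeries K') where
  x θ := (α.x θ).trace
  t := α.t.trace

/-- The horizontal part of a form. -/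
def OneForm.horPart {A : Type*} [Zero A] (α : OneForm k K' A) : OneForm k K' A where
  x := α.x
  t := 0

/-! Let `V` be an `F`-vector space with an `F`-basis `v`. It defines
* the `k`-structure `V_k = ⊕ k v_i`, and `V_{K'} = K' ⊗ V_k`,
* the lattice `V_O = ⊕ O v_i` with `O = K'[[t]]`,
* the flat connection `∇⁰` with `∇⁰(v_i) = 0`.
Every `k`-structure arises in this way. -/

variable {V : Type*} [AddCommGroup V] [Module (LaurentSeries K') V]
variable [Module K V] [IsScalarTower K (LaurentSeries K') V]
variable {ι : Type*} [Fintype ι]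

lemma smul_eq_C_smul (c : K) (x : V) :
    c • x = (HahnSeries.C (algebraMap K K' c) : LaurentSeries K') • x := by
  have h : c • (1 : LaurentSeries K') = HahnSeries.C (algebraMap K K' c) := by
    ext n
    rw [HahnSeries.coeff_smul, HahnSeries.C_apply]
    by_cases hn : n = 0
    · subst hn; simp [Algebra.smul_def]
    · rw [HahnSeries.coeff_single_of_ne hn, HahnSeries.coeff_one, if_neg hn, smul_zero]
  rw [← h, smul_assoc, one_smul]

lemma C_mul_eq_smul (c : K) (f : LaurentSeries K') :
    (HahnSeries.C (algebraMap K K' c) : LaurentSeries K') * f = c • f := by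
  ext n
  rw [HahnSeries.C_mul_eq_smul, HahnSeries.coeff_smul, HahnSeries.coeff_smul, algebraMap_smul]

/-- The connection form `𝒜 = ∇ - ∇⁰` in the `∇⁰`-horizontal basis `v`. -/
def connForm (C : AbsFlatConn k K' V) (v : Module.Basis ι (LaurentSeries K') V) :
    OneForm k K' (Matrix ι ι (LaurentSeries K')) where
  x θ := Matrix.of fun i j => v.repr (C.hor θ (v j)) i
  t := Matrix.of fun i j => v.repr (C.vert (v j)) i

variable (K) in
/-- The lattice `V_O`, viewed as a `K`-subspace of `V`. -/
def latticeO (v : Module.Basis ι (LaurentSeries K') V) : Submodule K V where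
  carrier := {x | ∀ i, ∀ j : ℤ, j < 0 → (v.repr x i).coeff j = 0}
  add_mem' := by
    intro x y hx hy i j hj
    simp [hx i j hj, hy i j hj]
  zero_mem' := by intro i j _; simp
  smul_mem' := by
    intro c x hx i j hj
    rw [smul_eq_C_smul (K' := K') c x, map_smul, Finsupp.smul_apply, smul_eq_mul, C_mul_eq_smul,
      HahnSeries.coeff_smul, hx i j hj, smul_zero]

variable (K) in
/-- `∇` is `m`-admissible with respect to `V_O`: `t^m ∇(∂_t)` maps `V_O` isomorphically onto itself
and the horizontal part has a pole of order at most `m - 1`. -/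
def IsAdmissible (C : AbsFlatConn k K' V) (v : Module.Basis ι (LaurentSeries K') V)
    (m : ℕ) : Prop :=
  Set.BijOn (fun x => tpow K' m • C.vert x) (latticeO K v) (latticeO K v) ∧
  ∀ θ : Derivation k K' K',
    Set.MapsTo (fun x => tpow K' ((m : ℤ) - 1) • C.hor θ x) (latticeO K v) (latticeO K v)

variable (K) in
/-- The projector `V → V` that keeps the terms of degree `< N` in `t` (with respect to `v`). -/
def trunc (v : Module.Basis ι (LaurentSeries K') V) (N : ℤ) : V →ₗ[K] V where
  toFun x := ∑ i, HahnSeries.truncLT N (v.repr x i) • v i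
  map_add' := by
    intro x y
    simp [HahnSeries.truncLT_add, add_smul, Finset.sum_add_distrib]
  map_smul' := by
    intro c x
    rw [smul_eq_C_smul (K' := K') c x]
    simp only [map_smul, Finsupp.smul_apply, smul_eq_mul, C_mul_eq_smul,
      HahnSeries.truncLT_smul, smul_assoc, Finset.smul_sum, RingHom.id_apply]

variable (K) in
lemma latticeO_le_ker (v : Module.Basis ι (LaurentSeries K') V) :
    latticeO K v ≤ LinearMap.ker (trunc K v 0) := by
  intro x hx
  rw [LinearMap.mem_ker]
  refine Finset.sum_eq_zero fun i _ => ?_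
  have : HahnSeries.truncLT (0 : ℤ) (v.repr x i) = 0 := by
    ext j
    rw [HahnSeries.coeff_truncLT]
    split_ifs with h
    · exact hx i j h
    · rfl
  rw [this, zero_smul]

variable (K) in
/-- The discrete space `V / V_O`, which represents the asymptotic space `V^∞`. -/
abbrev Disc (v : Module.Basis ι (LaurentSeries K') V) : Type _ := V ⧸ latticeO K v

variable (K) in
/-- The projection `V → V / V_O`. -/
def proj (v : Module.Basis ι (LaurentSeries K') V) : V →ₗ[K] Disc K v := (latticeO K v).mkQ

variable (K) in
/-- The section `V / V_O → V` whose image is the d-lattice `t⁻¹ V_{K'}[t⁻¹]`. -/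
def sec (v : Module.Basis ι (LaurentSeries K') V) : Disc K v →ₗ[K] V :=
  (latticeO K v).liftQ (trunc K v 0) (latticeO_le_ker K v)

/-- The operator on `V / V_O` representing the asymptotic operator `A^∞` of a continuous
operator `A` on `V`. -/
def asym (v : Module.Basis ι (LaurentSeries K') V) (A : Module.End K V) : Module.End K (Disc K v) :=
  proj K v ∘ₗ A ∘ₗ sec K v

lemma ddt_C (c : K') : ddt (HahnSeries.C c : LaurentSeries K') = 0 := by
  ext n
  simp only [ddt, LaurentSeries.derivative_apply, LaurentSeries.hasseDeriv_coeff,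
    HahnSeries.C_apply, HahnSeries.coeff_zero]
  by_cases h : n + 1 = 0
  · simp [h]
  · rw [HahnSeries.coeff_single_of_ne (by exact_mod_cast h), smul_zero]

variable (K) in
/-- For `ν = f dt`, the operator `∇(τ_ν)`, where `τ_ν = ν⁻¹ = f⁻¹ ∂_t`. -/
def tau (C : AbsFlatConn k K' V) (f : LaurentSeries K') : Module.End K V where
  toFun x := f⁻¹ • C.vert x
  map_add' := by intro x y; simp
  map_smul' := by
    intro c x
    rw [smul_eq_C_smul (K' := K') c x, C.vert_leibniz, ddt_C, zero_smul, zero_add,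
      RingHom.id_apply, smul_comm, ← smul_eq_C_smul]

variable (K) in
/-- The `ε`-line `ℰ_ν = det (V^∞, ∇(τ_ν)^∞)` at `ν = f dt`. -/
abbrev epsLine (C : AbsFlatConn k K' V) (v : Module.Basis ι (LaurentSeries K') V)
    (f : LaurentSeries K') : Submodule K ((a b : ℕ) → DetFrame (asym v (tau K C f)) a b → K) :=
  DetLine (asym v (tau K C f))

lemma horDer_C (θ : Derivation k K' K') (c : K') :
    horDer θ (HahnSeries.C c : LaurentSeries K') = HahnSeries.C (θ c) := by
  ext n
  simp only [horDer, HahnSeries.map_coeff, HahnSeries.C_apply]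
  by_cases h : n = 0
  · subst h; simp
  · rw [HahnSeries.coeff_single_of_ne h, HahnSeries.coeff_single_of_ne h, map_zero]

/-- The operator along `θ` on `V / V_O` representing `∇(θ)^∞`. -/
def asymHor (C : AbsFlatConn k K' V) (v : Module.Basis ι (LaurentSeries K') V)
    (θ : HorField k K K') : ConnAlong θ.base (Disc K v) where
  toFun := (proj K v).toAddMonoidHom.comp ((C.hor θ.ext).comp (sec K v).toAddMonoidHom)
  leibniz := by
    intro c x
    have hs : proj K v (sec K v x) = x := by
      obtain ⟨y, rfl⟩ := (latticeO K v).mkQ_surjective x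
      refine (Submodule.Quotient.eq _).mpr ?_
      intro i j hj
      have h1 : sec K v ((latticeO K v).mkQ y) = trunc K v 0 y := rfl
      have h2 : v.repr (trunc K v 0 y) i = HahnSeries.truncLT 0 (v.repr y i) := by
        simp only [trunc, LinearMap.coe_mk, AddHom.coe_mk]
        exact congrFun (v.repr_sum_self fun i => HahnSeries.truncLT 0 (v.repr y i)) i
      rw [h1, map_sub, Finsupp.sub_apply, h2, HahnSeries.coeff_sub, HahnSeries.coeff_truncLT,
        if_pos hj, sub_self]
    change proj K v (C.hor θ.ext (sec K v (c • x))) =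
      θ.base c • x + c • proj K v (C.hor θ.ext (sec K v x))
    rw [map_smul, smul_eq_C_smul (K' := K') c, C.hor_leibniz, horDer_C, θ.compat,
      ← smul_eq_C_smul, ← smul_eq_C_smul, map_add, map_smul, map_smul, hs]

/-! ### The `ε`-connection -/

variable (K) in
/-- The bilinear form `(x, y) ↦ Res_{F/K} (ν · Σ x_i y_i)` on `V ≃ F^n`, for `ν = f dt`. Here
`Res_{F/K} = tr_{K'/K} ∘ Res`. -/
def resForm (v : Module.Basis ι (LaurentSeries K') V) (f : LaurentSeries K') (x y : V) : K :=
  Algebra.trace K K' (res (f * ∑ i, v.repr x i * v.repr y i))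

open Classical in
/-- The adjoint (transpose) of a continuous operator with respect to `resForm`. -/
def adj (v : Module.Basis ι (LaurentSeries K') V) (f : LaurentSeries K')
    (A : Module.End K V) : Module.End K V :=
  if h : ∃ A' : Module.End K V, ∀ x y, resForm K v f (A x) y = resForm K v f x (A' y)
  then h.choose else 0

/-- A representative of an element of the Tate extension `gl^♭(V)`, a central extension of the
Lie algebra `gl(V)` of continuous endomorphisms by `K`. The extension has canonical splittings `s_d`
over the ideal `gl_d` of operators with open kernel, and `s_c` over the ideal `gl_c` of operators
with bounded image, and `s_d - s_c` is the trace on `gl_d ∩ gl_c`. The triple represents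
`s_d(d) + s_c(c) + z`, an element over `d + c`, where `d ∈ gl_d` and `c ∈ gl_c`. -/
structure TateLift (K V : Type*) [Field K] [AddCommGroup V] [Module K V] where
  d : Module.End K V
  c : Module.End K V
  z : K

/-- Two triples represent the same element of the Tate extension. -/
def TateLift.Equiv (x y : TateLift K V) : Prop :=
  x.d + x.c = y.d + y.c ∧ x.z - y.z = ftrace (y.d - x.d)

/-- The negative of an element. -/
def TateLift.neg (x : TateLift K V) : TateLift K V := ⟨-x.d, -x.c, -x.z⟩

/-- The involution `𝔰_ν` of the Tate extension for `ν = f dt`. It lifts the involution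
`A ↦ -ᵗA` of `gl(V)`, where the transpose is taken with respect to the duality
`V ≃ V^*` defined by `resForm`; it is the identity on the centre and, as a duality,
interchanges `s_c` and `s_d`. -/
def TateLift.invol (v : Module.Basis ι (LaurentSeries K') V) (f : LaurentSeries K')
    (x : TateLift K V) : TateLift K V :=
  ⟨-adj v f x.c, -adj v f x.d, x.z⟩

variable (K) in
/-- Multiplication by `a ∈ F` on `V`. -/
def mulOp (V : Type*) [AddCommGroup V] [Module (LaurentSeries K') V] [Module K V]
    [IsScalarTower K (LaurentSeries K') V] (a : LaurentSeries K') : Module.End K V where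
  toFun x := a • x
  map_add' := by intro x y; simp
  map_smul' := by
    intro c x
    rw [smul_eq_C_smul (K' := K') c x, RingHom.id_apply, smul_comm, ← smul_eq_C_smul]

variable (K) in
/-- The canonical lift of `a ∈ F` to the Tate extension attached to `ν = f dt` and to the connection
on `det V` with horizontal section `v₁ ∧ ⋯ ∧ v_n`: the unique lift which is `𝔰_ν`-equivariant
(`𝔰_ν` acts on `F ⊆ gl(V)` by `-1`), i.e. with `𝔰_ν(x) = -x`. It is written here with
`d = p a p`, `p = trunc K v 0` the projector with kernel `V_O`. -/
def canonicalLift (v : Module.Basis ι (LaurentSeries K') V) (f a : LaurentSeries K') :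
    TateLift K V :=
  let d := trunc K v 0 ∘ₗ mulOp K V a ∘ₗ trunc K v 0
  let c := mulOp K V a - d
  ⟨d, c, (1 / 2) * ftrace (adj v f c - d)⟩

/-- The scalar in `canonicalLift` is the one for which `𝔰_ν(x)` and `-x` agree. -/
lemma canonicalLift_invol [CharZero K] (v : Module.Basis ι (LaurentSeries K') V)
    (f a : LaurentSeries K') :
    ((canonicalLift K v f a).invol v f).z - (canonicalLift K v f a).neg.z =
      ftrace ((canonicalLift K v f a).neg.d - ((canonicalLift K v f a).invol v f).d) := by
  simp only [canonicalLift, TateLift.invol, TateLift.neg, sub_neg_eq_add]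
  rw [neg_add_eq_sub]
  ring

/-- The `ε`-connection on `ℰ_ν`, `ν = f dt`, along the vector field `θ` on `Spec K`, in coordinates
with respect to the frames of `ℰ_ν`.

The operator `∇(θ)` satisfies `[∇(θ), ∇(τ_ν)] = - a ∇(τ_ν)` with `a = θ(f) / f`. So transport of
structure along `1 + ε ∇(θ)` maps `ℰ_ν` to the fibre of `ℰ` at an infinitesimally near form,
and one returns to `ν` by means of the relative `ε`-connection: by the action of the lift
`∇^{tr ∇}_ν(a)` of `a` to the Tate extension. The connections `tr ∇` and `tr ∇⁰` on `det V` (relative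
to `K`) differ by `χ = tr (∇ - ∇⁰)_t`, and the lift attached to `tr ∇` is the one attached to
`tr ∇⁰`, which is the canonical lift above, minus `Res_{F/K} (a χ)`. The element `s_d(d) + s_c(c) + z` with `d` killing `V_O` acts through
`d : V / V_O → V / V_O` and the scalar `z`. -/
def epsDeriv (C : AbsFlatConn k K' V) (v : Module.Basis ι (LaurentSeries K') V)
    (f : LaurentSeries K') (θ : HorField k K K') (s : epsLine K C v f)
    (a b : ℕ) (q : DetFrame (asym v (tau K C f)) a b) : K :=
  let α : LaurentSeries K' := horDer θ.ext f * f⁻¹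
  let L := canonicalLift K v f α
  detLineDeriv (asymHor C v θ) (asym v L.d)
    (L.z - Algebra.trace K K' (res (α * (connForm C v).trace.t))) s a b q

/-! ### The comparison isomorphism -/

/-- The connection along `θ` on `V_{K'} = K' ⊗ V_k ≃ K'^n` given by the `k`-structure `V_k`. -/
def constConn (ι : Type*) (θ : HorField k K K') : ConnAlong θ.base (ι → K') where
  toFun :=
    { toFun := fun x i => θ.ext (x i)
      map_zero' := by ext; simp
      map_add' := by intro x y; ext; simp }
  leibniz := by
    intro c x
    ext i
    simp [Algebra.smul_def, θ.compat, mul_comm]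

/-- The embedding `V_{K'} ⊆ V`. -/
def constVec (v : Module.Basis ι (LaurentSeries K') V) (x : ι → K') : V :=
  ∑ i, (HahnSeries.C (x i) : LaurentSeries K') • v i

/-- The frame `q` of `ℰ_ν` corresponds under `β_ν` to the generator `(e₁ ∧ ⋯ ∧ e_r)^{⊗ N}`,
`N = ℓ + m`. The operator `τ = ∇(τ_ν)` yields an isomorphism `V / V_O ≃ V / t^{-N} V_O`.

If `N ≥ 0`, then `V / V_O ≃ V / t^{-N} V_O ⊕ t^{-N} V_O / V_O`, and
`(t^{-j-1} e_i)`, `0 ≤ j < N`, is a basis of `t^{-N} V_O / V_O`; this gives an isomorphism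
`V / V_O ⊕ K^{Nr} ≃ V / V_O`.

If `N < 0`, then `V / t^{-N} V_O ≃ V / V_O ⊕ V_O / t^{-N} V_O`, and
`(t^j e_i)`, `0 ≤ j < -N`, is a basis of `V_O / t^{-N} V_O`; this gives an isomorphism
`V / V_O ≃ V / V_O ⊕ K^{-Nr}`.

The equation below covers both cases (one of the two sums is empty). -/
def IsBetaFrame (C : AbsFlatConn k K' V) (v : Module.Basis ι (LaurentSeries K') V)
    (f : LaurentSeries K') (N : ℤ) {r : ℕ} (e : Module.Basis (Fin r) K (ι → K'))
    (q : DetFrame (asym v (tau K C f)) (N.toNat * r) ((-N).toNat * r)) : Prop :=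
  ∀ (x : Disc K v) (c : Fin (N.toNat * r) → K),
    sec K v (q.iso (x, c)).1 +
        ∑ j : Fin (-N).toNat, ∑ i : Fin r,
          (q.iso (x, c)).2 (finProdFinEquiv (j, i)) • (tpow K' (j : ℤ) • constVec v (e i)) =
      trunc K v (-N) (tau K C f (sec K v x)) +
        ∑ j : Fin N.toNat, ∑ i : Fin r,
          c (finProdFinEquiv (j, i)) • (tpow K' (-(j : ℤ) - 1) • constVec v (e i))

variable (K) in
/-- `β` is the natural isomorphism `β_ν : ℰ_ν ≃ (det_K V_{K'})^{⊗ N}`: every basis `e` of `V_{K'}`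
has a corresponding frame `q`, and `β` maps `[q]` to `(e₁ ∧ ⋯ ∧ e_r)^{⊗ N}`. -/
def IsBeta (C : AbsFlatConn k K' V) (v : Module.Basis ι (LaurentSeries K') V)
    (f : LaurentSeries K') (N : ℤ)
    (β : epsLine K C v f ≃ₗ[K] DetPow (K := K) N (ι → K')) : Prop :=
  ∀ e : Module.Basis (Fin (Module.finrank K (ι → K'))) K (ι → K'),
    (∃ q, IsBetaFrame C v f N e q) ∧
    ∀ q, IsBetaFrame C v f N e q → ∀ s, (β s).1 e = s.1 _ _ q

/-! ### The three forms -/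

/-- `g`, where `𝒜_t = t^{-m} g dt`. -/
def gMat (C : AbsFlatConn k K' V) (v : Module.Basis ι (LaurentSeries K') V) (m : ℕ) :
    Matrix ι ι (LaurentSeries K') :=
  tpow K' m • (connForm C v).t

/-- The constant term `g₀` of `g`. -/
def gMatZero (C : AbsFlatConn k K' V) (v : Module.Basis ι (LaurentSeries K') V) (m : ℕ) :
    Matrix ι ι K' :=
  (gMat C v m).map fun h => h.coeff 0

/-- `φ₁ = Res Tr(g⁻¹ dg ∧ 𝒜_x) - (m/2) d log det g₀`. -/
def phi1 [DecidableEq ι] (C : AbsFlatConn k K' V) (v : Module.Basis ι (LaurentSeries K') V)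
    (m : ℕ) (θ : Derivation k K' K') : K' :=
  res (((matDlog (gMat C v m)).wedge (connForm C v).horPart θ).trace) -
    (m : K') / 2 * (θ (gMatZero C v m).det / (gMatZero C v m).det)

/-- `φ₂ = (ℓ + m) Res Tr(𝒜_x ∧ dt/t)`. -/
def phi2 (C : AbsFlatConn k K' V) (v : Module.Basis ι (LaurentSeries K') V)
    (m : ℕ) (ℓ : ℤ) (θ : Derivation k K' K') : K' :=
  ((ℓ : K') + m) * res ((connForm C v).horPart.trace.wedge dtOverT θ)

/-- `φ₃ = n (ℓ/2 + m) d log u₀ - Res(d log u ∧ Tr 𝒜)`. -/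
def phi3 (C : AbsFlatConn k K' V) (v : Module.Basis ι (LaurentSeries K') V)
    (m : ℕ) (ℓ : ℤ) (u : PowerSeries K') (θ : Derivation k K' K') : K' :=
  (Fintype.card ι : K') * ((ℓ : K') / 2 + m) *
      (θ (PowerSeries.constantCoeff u) / PowerSeries.constantCoeff u) -
    res ((dlog (u : LaurentSeries K')).wedge (connForm C v).trace θ)

end Laurent

end EpsLine

end

/-!
# The `ε`-connection of an admissible flat connection

Let `p` and `p_N` be the truncations of `V` below degree `0` and `-N`, where `N = ℓ + m`, and let
`T = ∇(τ_ν)`. Admissibility with `m ≥ 2` means that `T` acts on leading terms by the invertible matrix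
`u₀⁻¹ g₀`, with a shift of degree by `-N`; so `T` is bijective and maps `V_O` onto `t^(-N) V_O`
(`IsAdmissible.tau_mem_lat_iff`, `IsAdmissible.tau_bijective`). A basis `e` of `V_{K'}` therefore
gives a frame of the `ε`-line (`betaFrame`). Two such frames differ by the `N`-th power of the
determinant of the change of basis (`fdet_betaIso`), and the determinant line is one-dimensional
(`DetFrame.gen`, `DetLine.eq_zero_of_apply_eq_zero`); this yields `β`.

The two connections preserve the lines (`detLineDeriv_mem`, `detPowDeriv_mem`) by Jacobi's formula for
determinants of finite-rank perturbations of the identity (`ConnAlong.deriv_fdet`). They are compared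
at the frame of a basis `e`, and what has to be computed is the trace of the logarithmic derivative
of this frame, together with the scalar of the canonical lift. By cyclicity the trace becomes the
trace of an operator on `V`, and the relation `T ∇(θ) = (∇(θ) + a) T` splits this operator into three
summands (`tgt_frameDeriv`).

* One summand acts in the degrees between `-N` and `0` by the difference of the constant connection
  and of the connection killing `e`. It gives the term of the constant connection on
  `(det V_{K'})^{⊗ N}`.
* The summand `p X p - p_N X p_N`, where `X = 𝒜_θ + a`, has trace `tr_{K'/K} (N Tr X₀)`
  (`ftrace_trunc_mulMat_sub`). It gives `φ₂` and a part of `φ₃`.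
* The summand `p_N T p 𝒜_θ (1 - p) T⁻¹ p_N` has the trace of `-p 𝒜_θ g⁻¹ u (1 - p) S p`, where
  `S = t^N T = u⁻¹ (g + t^m ∂_t)`, because `T⁻¹` equals `u g⁻¹ t^N` on `t^(-N) V_O` modulo `t^m V_O`.
  The matrix part of `S` contributes a residue, by the formula `tr (p X (1 - p) G p) = Res Tr (X dG)`
  (`ftrace_trunc_mulMat_mulMat`). The part with `t^m ∂_t` contributes `m (m - 1) / 2` times the
  polar coefficient of order `m - 1` of `Tr (𝒜_θ g⁻¹)` (`ftrace_trunc_mulMat_derOp`), and flatness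
  says that `m - 1` times this coefficient is `-d log det g₀`
  (`IsAdmissible.coeff_trace_mul_gMat_inv`). This gives `φ₁` and another part of `φ₃`.

The scalar of the canonical lift is determined by the transpose of multiplication operators for the
residue pairing; it is `-tr_{K'/K} (ℓ n a₀) / 2` (`canonicalLift_z`) and completes `φ₃`.
-/

set_option linter.unusedSectionVars false

noncomputable section

namespace EpsLine

/-! ### Finite-rank maps, their traces, and determinants of finite-rank perturbations of `1` -/

section FiniteRank

variable {K : Type*} [Field K]
variable {M N Q : Type*} [AddCommGroup M] [Module K M] [AddCommGroup N] [Module K N]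
  [AddCommGroup Q] [Module K Q]

lemma finiteRank_of_forall_mem {f : N →ₗ[K] M} (W : Submodule K M) [Module.Finite K W]
    (h : ∀ x, f x ∈ W) : FiniteRank f :=
  Submodule.finiteDimensional_of_le (S₂ := W) (by rintro _ ⟨x, rfl⟩; exact h x)

lemma finiteRank_of_finite_left [Module.Finite K N] (f : N →ₗ[K] M) : FiniteRank f :=
  inferInstanceAs (Module.Finite K (LinearMap.range f))

lemma finiteRank_of_finite_right [Module.Finite K M] (f : N →ₗ[K] M) : FiniteRank f :=
  inferInstanceAs (Module.Finite K (LinearMap.range f))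

lemma finiteRank_zero : FiniteRank (0 : N →ₗ[K] M) :=
  finiteRank_of_forall_mem ⊥ (by simp)

lemma FiniteRank.add {f g : N →ₗ[K] M} (hf : FiniteRank f) (hg : FiniteRank g) :
    FiniteRank (f + g) := by
  have := hf
  have := hg
  unfold FiniteRank at *
  exact finiteRank_of_forall_mem (LinearMap.range f ⊔ LinearMap.range g)
    fun x => Submodule.add_mem_sup ⟨x, rfl⟩ ⟨x, rfl⟩

lemma FiniteRank.neg {f : N →ₗ[K] M} (hf : FiniteRank f) : FiniteRank (-f) := by
  unfold FiniteRank at *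
  exact finiteRank_of_forall_mem (LinearMap.range f) fun x => ⟨-x, by simp⟩

lemma FiniteRank.sub {f g : N →ₗ[K] M} (hf : FiniteRank f) (hg : FiniteRank g) :
    FiniteRank (f - g) := by
  rw [sub_eq_add_neg]
  exact hf.add hg.neg

lemma FiniteRank.comp_left {f : N →ₗ[K] M} (hf : FiniteRank f) (g : M →ₗ[K] Q) :
    FiniteRank (g ∘ₗ f) := by
  unfold FiniteRank at *
  exact finiteRank_of_forall_mem ((LinearMap.range f).map g) fun x => ⟨f x, ⟨x, rfl⟩, rfl⟩

lemma FiniteRank.comp_right {f : N →ₗ[K] M} (hf : FiniteRank f) (g : Q →ₗ[K] N) :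
    FiniteRank (f ∘ₗ g) := by
  unfold FiniteRank at *
  exact finiteRank_of_forall_mem (LinearMap.range f) fun x => ⟨g x, rfl⟩

lemma FiniteRank.sum {ι : Type*} {s : Finset ι} {f : ι → N →ₗ[K] M}
    (h : ∀ i ∈ s, FiniteRank (f i)) : FiniteRank (∑ i ∈ s, f i) :=
  Finset.sum_induction f FiniteRank (fun _ _ => FiniteRank.add) finiteRank_zero h

lemma trace_restrict_of_le {x : Module.End K M} {W W' : Submodule K M} [Module.Finite K W']
    (hW : W ≤ W') (h : ∀ y ∈ W', x y ∈ W) (h1 : ∀ y ∈ W, x y ∈ W) (h2 : ∀ y ∈ W', x y ∈ W') :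
    LinearMap.trace K W (x.restrict h1) = LinearMap.trace K W' (x.restrict h2) := by
  rw [← LinearMap.trace_restrict_eq_of_forall_mem (W.comap W'.subtype) (x.restrict h2)
    (fun y => h y y.2), ← LinearMap.trace_conj' _ (Submodule.comapSubtypeEquivOfLe hW)]
  rfl

/-- `ftrace x` may be computed on any finite-dimensional subspace that contains the image of `x`. -/
lemma ftrace_eq_trace_restrict {x : Module.End K M} (W : Submodule K M) [Module.Finite K W]
    (h : ∀ y, x y ∈ W) : ftrace x = LinearMap.trace K W (x.restrict fun y _ => h y) := by
  have hle : LinearMap.range x ≤ W := by rintro _ ⟨z, rfl⟩; exact h z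
  have : Module.Finite K (LinearMap.range x) := Submodule.finiteDimensional_of_le hle
  have h1 : ∀ y ∈ LinearMap.range x, x y ∈ LinearMap.range x := fun y _ => ⟨y, rfl⟩
  unfold ftrace
  rw [← trace_restrict_of_le (W := LinearMap.range x) hle (fun y _ => ⟨y, rfl⟩) h1]
  refine trace_restrict_of_le (by rintro _ ⟨z, rfl⟩; exact ⟨x z, rfl⟩) ?_ _ h1
  rintro _ ⟨z, rfl⟩
  exact ⟨z, rfl⟩

lemma ftrace_eq_trace [Module.Finite K M] (x : Module.End K M) :
    ftrace x = LinearMap.trace K M x := by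
  rw [ftrace_eq_trace_restrict ⊤ (by simp),
    LinearMap.trace_restrict_eq_of_forall_mem ⊤ x (by simp)]

lemma ftrace_add {x y : Module.End K M} (hx : FiniteRank x) (hy : FiniteRank y) :
    ftrace (x + y) = ftrace x + ftrace y := by
  unfold FiniteRank at *
  let W := LinearMap.range x ⊔ LinearMap.range y
  have h1 : ∀ z, x z ∈ W := fun z => Submodule.mem_sup_left ⟨z, rfl⟩
  have h2 : ∀ z, y z ∈ W := fun z => Submodule.mem_sup_right ⟨z, rfl⟩
  rw [ftrace_eq_trace_restrict W h1, ftrace_eq_trace_restrict W h2,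
    ftrace_eq_trace_restrict W (fun z => W.add_mem (h1 z) (h2 z)), ← map_add]
  rfl

lemma ftrace_zero : ftrace (0 : Module.End K M) = 0 := by
  have := ftrace_add (x := (0 : Module.End K M)) (y := 0) finiteRank_zero finiteRank_zero
  simpa using this

lemma ftrace_neg {x : Module.End K M} (hx : FiniteRank x) : ftrace (-x) = -ftrace x := by
  have := ftrace_add hx hx.neg
  rw [add_neg_cancel, ftrace_zero] at this
  exact (neg_eq_of_add_eq_zero_right this.symm).symm

lemma ftrace_sub {x y : Module.End K M} (hx : FiniteRank x) (hy : FiniteRank y) :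
    ftrace (x - y) = ftrace x - ftrace y := by
  rw [sub_eq_add_neg, ftrace_add hx hy.neg, ftrace_neg hy, sub_eq_add_neg]

lemma ftrace_sum {ι : Type*} {s : Finset ι} {x : ι → Module.End K M}
    (h : ∀ i ∈ s, FiniteRank (x i)) : ftrace (∑ i ∈ s, x i) = ∑ i ∈ s, ftrace (x i) := by
  classical
  induction s using Finset.induction_on with
  | empty => simp [ftrace_zero]
  | insert a s ha ih =>
    rw [Finset.sum_insert ha, Finset.sum_insert ha, ftrace_add (h a (by simp))
      (FiniteRank.sum fun i hi => h i (by simp [hi])), ih fun i hi => h i (by simp [hi])]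

/-- `tr (f g) = tr (g f)` if `f` has finite rank. -/
lemma ftrace_comp_comm {f : N →ₗ[K] M} (hf : FiniteRank f) (g : M →ₗ[K] N) :
    ftrace (f ∘ₗ g) = ftrace (g ∘ₗ f) := by
  unfold FiniteRank at hf
  let W := LinearMap.range f
  let W' := W.map g
  have h1 : ∀ z ∈ W, g z ∈ W' := fun z hz => ⟨z, hz, rfl⟩
  have h2 : ∀ z ∈ W', f z ∈ W := fun z _ => ⟨z, rfl⟩
  rw [ftrace_eq_trace_restrict W (fun z => ⟨g z, rfl⟩),
    ftrace_eq_trace_restrict W' (fun z => ⟨f z, ⟨z, rfl⟩, rfl⟩)]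
  exact LinearMap.trace_comp_comm' (g.restrict h1) (f.restrict h2)

lemma ftrace_comp_comm' {f : N →ₗ[K] M} {g : M →ₗ[K] N} (hg : FiniteRank g) :
    ftrace (f ∘ₗ g) = ftrace (g ∘ₗ f) :=
  (ftrace_comp_comm hg f).symm

/-- If `x² = x e x` with `e` of finite rank, then `ftrace x` is the trace of the finite-rank
operator `x e`. This computes `ftrace` for operators that are not of finite rank themselves. -/
lemma ftrace_eq_ftrace_comp {x e : Module.End K M} (he : FiniteRank e)
    (h : x ∘ₗ x = x ∘ₗ e ∘ₗ x) : ftrace x = ftrace (x ∘ₗ e) := by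
  have h' : ∀ z, x (x z) = x (e (x z)) := fun z => LinearMap.congr_fun h z
  have hfin : Module.Finite K (LinearMap.range (x ∘ₗ e)) := he.comp_left x
  rw [ftrace_eq_trace_restrict (LinearMap.range (x ∘ₗ e)) (fun z => ⟨z, rfl⟩)]
  have h1 : ∀ y ∈ LinearMap.range (x ∘ₗ e), x y ∈ LinearMap.range (x ∘ₗ e) := by
    rintro _ ⟨z, rfl⟩
    exact ⟨x (e z), (h' _).symm⟩
  have h2 : ftrace x = LinearMap.trace K _ (x.restrict h1) := by
    refine trace_restrict_of_le ?_ ?_ _ h1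
    · rintro _ ⟨z, rfl⟩
      exact ⟨x z, (h' z).symm⟩
    · rintro _ ⟨z, rfl⟩
      exact ⟨e z, rfl⟩
  rw [h2]
  congr 1
  ext ⟨_, z, rfl⟩
  exact h' (e z)

lemma det_restrict_of_le {h : Module.End K M} {W W' : Submodule K M} [Module.Finite K W']
    (hW : W ≤ W') (hh : ∀ y, h y - y ∈ W) (h1 : ∀ y ∈ W, h y ∈ W) (h2 : ∀ y ∈ W', h y ∈ W') :
    LinearMap.det (h.restrict h1) = LinearMap.det (h.restrict h2) := by
  have h3 : W.comap W'.subtype ≤ (W.comap W'.subtype).comap (h.restrict h2) :=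
    fun y hy => h1 y hy
  have h4 : (W.comap W'.subtype).mapQ _ (h.restrict h2) h3 = LinearMap.id := by
    refine Submodule.linearMap_qext _ (LinearMap.ext fun y => ?_)
    exact (Submodule.Quotient.eq _).mpr (hh y)
  rw [LinearMap.det_eq_det_mul_det (W.comap W'.subtype) (h.restrict h2) h3, h4,
    LinearMap.det_id, mul_one, ← LinearMap.det_conj _ (Submodule.comapSubtypeEquivOfLe hW)]
  rfl

lemma map_mem_of_sub_mem {h : Module.End K M} {W : Submodule K M} (hh : ∀ y, h y - y ∈ W) (y : M)
    (hy : y ∈ W) : h y ∈ W := by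
  simpa using W.add_mem (hh y) hy

/-- `fdet h` may be computed on any finite-dimensional subspace that contains the image of `h - 1`. -/
lemma fdet_eq_det_restrict {h : Module.End K M} (W : Submodule K M) [Module.Finite K W]
    (hh : ∀ y, h y - y ∈ W) :
    fdet h = LinearMap.det (h.restrict (map_mem_of_sub_mem hh)) :=
  det_restrict_of_le (by rintro _ ⟨z, rfl⟩; exact hh z) (fun z => (⟨z, rfl⟩ : _ ∈ LinearMap.range (h - 1))) _ _

lemma fdet_eq_det [Module.Finite K M] (h : Module.End K M) : fdet h = LinearMap.det h := by
  rw [fdet_eq_det_restrict (W := (⊤ : Submodule K M)) (by simp),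
    ← LinearMap.det_conj _ (Submodule.topEquiv (R := K) (M := M))]
  rfl

lemma fdet_one : fdet (1 : Module.End K M) = 1 := by
  rw [fdet_eq_det_restrict (W := (⊥ : Submodule K M)) (by simp)]
  exact LinearMap.det_eq_one_of_finrank_eq_zero (by simp) _

lemma fdet_mul {h h' : Module.End K M} (hh : FiniteRank (h - 1)) (hh' : FiniteRank (h' - 1)) :
    fdet (h ∘ₗ h') = fdet h * fdet h' := by
  unfold FiniteRank at *
  let W := LinearMap.range (h - 1) ⊔ LinearMap.range (h' - 1)
  have h1 : ∀ z, h z - z ∈ W := fun z => Submodule.mem_sup_left ⟨z, rfl⟩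
  have h2 : ∀ z, h' z - z ∈ W := fun z => Submodule.mem_sup_right ⟨z, rfl⟩
  have h3 : ∀ z, (h ∘ₗ h') z - z ∈ W := fun z => by
    simpa using W.add_mem (h1 (h' z)) (h2 z)
  rw [fdet_eq_det_restrict W h1, fdet_eq_det_restrict W h2, fdet_eq_det_restrict W h3,
    ← map_mul]
  rfl

lemma det_one_add_comp_comm [Module.Finite K M] [Module.Finite K N] (f : N →ₗ[K] M)
    (g : M →ₗ[K] N) : LinearMap.det (1 + f ∘ₗ g) = LinearMap.det (1 + g ∘ₗ f) := by
  classical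
  let bM := Module.finBasis K M
  let bN := Module.finBasis K N
  rw [← LinearMap.det_toMatrix bM, ← LinearMap.det_toMatrix bN, map_add, map_add,
    LinearMap.toMatrix_one, LinearMap.toMatrix_one, LinearMap.toMatrix_comp bM bN bM,
    LinearMap.toMatrix_comp bN bM bN, Matrix.det_one_add_mul_comm]

/-- `det (1 + f g) = det (1 + g f)` if `f` has finite rank. -/
lemma fdet_one_add_comp_comm {f : N →ₗ[K] M} (hf : FiniteRank f) (g : M →ₗ[K] N) :
    fdet (1 + f ∘ₗ g) = fdet (1 + g ∘ₗ f) := by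
  unfold FiniteRank at hf
  let W := LinearMap.range f
  let W' := W.map g
  have h1 : ∀ z ∈ W, g z ∈ W' := fun z hz => ⟨z, hz, rfl⟩
  have h2 : ∀ z ∈ W', f z ∈ W := fun z _ => ⟨z, rfl⟩
  have h3 : ∀ z, (1 + f ∘ₗ g : Module.End K M) z - z ∈ W := fun z => by simp [W]
  have h4 : ∀ z, (1 + g ∘ₗ f : Module.End K N) z - z ∈ W' := fun z => by
    simpa using h1 (f z) ⟨z, rfl⟩
  rw [fdet_eq_det_restrict W h3, fdet_eq_det_restrict W' h4]
  exact det_one_add_comp_comm (f.restrict h2) (g.restrict h1)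

lemma fdet_conj {h : Module.End K M} (hh : FiniteRank (h - 1)) (e : M ≃ₗ[K] N) :
    fdet (e.toLinearMap ∘ₗ h ∘ₗ e.symm.toLinearMap) = fdet h := by
  have h1 : e.toLinearMap ∘ₗ h ∘ₗ e.symm.toLinearMap =
      1 + (e.toLinearMap ∘ₗ (h - 1)) ∘ₗ e.symm.toLinearMap := by
    ext x; simp
  have h2 : h = 1 + e.symm.toLinearMap ∘ₗ (e.toLinearMap ∘ₗ (h - 1)) := by
    ext x; simp
  rw [h1, fdet_one_add_comp_comm (hh.comp_left _), ← h2]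

/-- A finite-rank perturbation of the identity supported on a direct summand, given by its
inclusion `J` and projection `J'`, has the determinant of its restriction to the summand. -/
lemma fdet_eq_of_summand {h : Module.End K M} (hh : FiniteRank (h - 1)) {h' : Module.End K N}
    (J : M →ₗ[K] N) (J' : N →ₗ[K] M) (hJ : ∀ x, J' (J x) = x)
    (heq : ∀ y, h' y = y + J (h (J' y) - J' y)) : fdet h' = fdet h := by
  have h1 : h' = 1 + (J ∘ₗ (h - 1)) ∘ₗ J' := by ext x; simp [heq]
  have h2 : h = 1 + J' ∘ₗ (J ∘ₗ (h - 1)) := by ext x; simp [hJ]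
  rw [h1, fdet_one_add_comp_comm (hh.comp_left _), ← h2]

end FiniteRank

/-! ### Logarithmic derivatives of determinants -/

section Jacobi

variable {k K : Type*} [Field k] [Field K] [Algebra k K]

/-- Jacobi's formula, by evaluating the determinant over the dual numbers. -/
lemma derivation_det {n : Type*} [Fintype n] [DecidableEq n] (θ : Derivation k K K)
    {A B : Matrix n n K} (h : A * B = 1) :
    θ A.det = A.det * (B * A.map θ).trace := by
  let φ : K →+* DualNumber K :=
    { toFun := fun a => TrivSqZeroExt.inl a + TrivSqZeroExt.inr (θ a)
      map_one' := by ext <;> simp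
      map_mul' := fun a b => by ext <;> simp [mul_comm]
      map_zero' := by ext <;> simp
      map_add' := fun a b => by ext <;> simp }
  have h1 : A.map φ = A.map TrivSqZeroExt.inl *
      (1 + (DualNumber.eps : DualNumber K) • (B * A.map θ).map TrivSqZeroExt.inl) := by
    have h2 : (A.map TrivSqZeroExt.inl : Matrix n n (DualNumber K)) *
        (B * A.map θ).map TrivSqZeroExt.inl = (A.map θ).map TrivSqZeroExt.inl := by
      rw [← Matrix.mul_one (A.map θ), ← Matrix.one_mul (A.map θ * 1), ← h]
      have := (RingHom.mapMatrix (TrivSqZeroExt.inlHom K K) (m := n)).map_mul A (B * A.map θ)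
      rw [← Matrix.mul_assoc, h, Matrix.one_mul] at this
      rw [h, Matrix.mul_one, Matrix.one_mul]
      exact this.symm
    rw [Matrix.mul_add, Matrix.mul_one, Matrix.mul_smul, h2]
    ext i j <;> simp [φ]
  have h2 : φ A.det = (A.map φ).det := RingHom.map_det φ A
  have h3 : (A.map TrivSqZeroExt.inl : Matrix n n (DualNumber K)).det =
      TrivSqZeroExt.inl A.det := (RingHom.map_det (TrivSqZeroExt.inlHom K K) A).symm
  have h4 : ((B * A.map θ).map TrivSqZeroExt.inl : Matrix n n (DualNumber K)).trace =
      TrivSqZeroExt.inl (B * A.map θ).trace :=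
    (AddMonoidHom.map_trace (TrivSqZeroExt.inlHom K K : K →+* DualNumber K) (B * A.map θ)).symm
  rw [h1, Matrix.det_mul, Matrix.det_one_add_smul, h3, h4, sq, DualNumber.eps_mul_eps] at h2
  have h5 := congrArg TrivSqZeroExt.snd h2
  simpa [φ] using h5

end Jacobi

section Along

variable {k K : Type*} [Field k] [Field K] [Algebra k K] {θ : Derivation k K K}
variable {M N Q : Type*} [AddCommGroup M] [Module K M] [AddCommGroup N] [Module K N]
  [AddCommGroup Q] [Module K Q]

@[simp] lemma ConnAlong.comm_apply (D₁ : ConnAlong θ M) (D₂ : ConnAlong θ N) (q : N →ₗ[K] M)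
    (x : N) : D₁.comm D₂ q x = D₁.toFun (q x) - q (D₂.toFun x) := rfl

/-- The commutator with operators along `θ` preserves finite rank: the values lie in the span of a
finite spanning set of the image and of its image under `D₁`. -/
lemma FiniteRank.comm {r : N →ₗ[K] M} (hr : FiniteRank r) (D₁ : ConnAlong θ M)
    (D₂ : ConnAlong θ N) : FiniteRank (D₁.comm D₂ r) := by
  unfold FiniteRank at hr
  obtain ⟨S, hS⟩ := (Submodule.fg_iff_finiteDimensional (LinearMap.range r)).mpr hr
  let W : Submodule K M := Submodule.span K (S : Set M) ⊔ Submodule.span K (D₁.toFun '' S)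
  have : Module.Finite K (Submodule.span K (D₁.toFun '' (S : Set M))) :=
    FiniteDimensional.span_of_finite K (S.finite_toSet.image _)
  have hW : ∀ w ∈ Submodule.span K (S : Set M), D₁.toFun w ∈ W := by
    intro w hw
    induction hw using Submodule.span_induction with
    | mem x hx => exact Submodule.mem_sup_right (Submodule.subset_span ⟨x, hx, rfl⟩)
    | zero => simp
    | add x y _ _ hx hy => rw [map_add]; exact W.add_mem hx hy
    | smul c x hx ih =>
      rw [D₁.leibniz]
      exact W.add_mem (W.smul_mem _ (Submodule.mem_sup_left hx)) (W.smul_mem _ ih)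
  refine finiteRank_of_forall_mem W fun x => W.sub_mem (hW _ ?_) (Submodule.mem_sup_left ?_)
  · rw [hS]; exact ⟨x, rfl⟩
  · rw [hS]; exact ⟨_, rfl⟩

lemma FiniteRank.comm_of_sub_one {h : Module.End K M} (hh : FiniteRank (h - 1))
    (D : ConnAlong θ M) : FiniteRank (D.comm D h) := by
  have : D.comm D h = D.comm D (h - 1) := by ext x; simp
  rw [this]
  exact hh.comm D D

/-- Jacobi's formula for an operator along `θ` on a finite-dimensional space. -/
lemma ConnAlong.deriv_det [Module.Finite K M] (D : ConnAlong θ M) {A B : Module.End K M}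
    (h : A ∘ₗ B = 1) :
    θ (LinearMap.det A) = LinearMap.det A * LinearMap.trace K M (B ∘ₗ D.comm D A) := by
  classical
  let b := Module.finBasis K M
  let Γ : Matrix _ _ K := .of fun i j => b.repr (D.toFun (b j)) i
  have h' : B ∘ₗ A = 1 := mul_eq_one_comm.mp h
  have hAB : LinearMap.toMatrix b b A * LinearMap.toMatrix b b B = 1 := by
    rw [← LinearMap.toMatrix_comp, h, LinearMap.toMatrix_one]
  have hBA : LinearMap.toMatrix b b B * LinearMap.toMatrix b b A = 1 := by
    rw [← LinearMap.toMatrix_comp, h', LinearMap.toMatrix_one]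
  have hD : ∀ x : M, ∀ i, b.repr (D.toFun x) i = θ (b.repr x i) + ∑ j, Γ i j * b.repr x j := by
    intro x i
    conv_lhs => rw [← b.sum_repr x]
    simp [-Module.Basis.sum_repr, D.leibniz, Finsupp.single_apply, Γ, Finset.sum_add_distrib,
      mul_comm]
  have hC : LinearMap.toMatrix b b (D.comm D A) = (LinearMap.toMatrix b b A).map θ +
      Γ * LinearMap.toMatrix b b A - LinearMap.toMatrix b b A * Γ := by
    ext i j
    rw [LinearMap.toMatrix_apply, comm_apply, map_sub, Finsupp.sub_apply, hD]
    conv_lhs => rw [← b.sum_repr (D.toFun (b j))]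
    simp [-Module.Basis.sum_repr, Matrix.mul_apply, LinearMap.toMatrix_apply, Γ, mul_comm]
  rw [← LinearMap.det_toMatrix b, LinearMap.trace_eq_matrix_trace K b,
    LinearMap.toMatrix_comp b b b, hC, derivation_det θ hAB, mul_sub, mul_add,
    Matrix.trace_sub, Matrix.trace_add, ← Matrix.mul_assoc, ← Matrix.mul_assoc, hBA,
    Matrix.one_mul, Matrix.mul_assoc, Matrix.trace_mul_comm _ (Γ * _), Matrix.mul_assoc, hAB,
    Matrix.mul_one, add_sub_cancel_right]

/-- Jacobi's formula for a finite-rank perturbation `h` of the identity. The operator `D` need not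
preserve any finite-dimensional subspace; subtracting from it a linear operator of finite rank,
which does not affect `tr (h⁻¹ [D, h])`, makes it preserve the range of `h - 1`. -/
lemma ConnAlong.deriv_fdet (D : ConnAlong θ M) (h : M ≃ₗ[K] M)
    (hh : FiniteRank (h.toLinearMap - 1)) :
    θ (fdet h.toLinearMap) =
      fdet h.toLinearMap * ftrace (h.symm.toLinearMap ∘ₗ D.comm D h.toLinearMap) := by
  have hfin := hh
  unfold FiniteRank at hfin
  set W := LinearMap.range (h.toLinearMap - 1) with hWdef
  have hW : ∀ y, h.toLinearMap y - y ∈ W := fun z => ⟨z, rfl⟩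
  have hW' : ∀ y ∈ W, h.symm y ∈ W := by
    intro y hy
    have : h.symm y - y ∈ W := by
      have := W.neg_mem (hW (h.symm y))
      simpa using this
    simpa using W.add_mem this hy
  obtain ⟨p, hp⟩ := W.subtype.exists_leftInverse_of_injective W.ker_subtype
  have hp' : ∀ w : W, p w = w := fun w => LinearMap.congr_fun hp w
  let DW : ConnAlong θ W :=
    { toFun := p.toAddMonoidHom.comp (D.toFun.comp W.subtype.toAddMonoidHom)
      leibniz := fun c x => by simp [D.leibniz, hp'] }
  let Λ : Module.End K M :=
    { toFun := fun x => D.toFun (p x) - p (D.toFun (p x))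
      map_add' := fun x y => by simp; abel
      map_smul' := fun c x => by simp [D.leibniz, hp', smul_sub] }
  have hΛ : FiniteRank Λ := by
    have : Λ = (Λ ∘ₗ W.subtype) ∘ₗ p := by ext x; simp [Λ, hp']
    rw [this]
    exact (finiteRank_of_finite_right p).comp_left _
  let D' : ConnAlong θ M :=
    { toFun := D.toFun - Λ.toAddMonoidHom
      leibniz := fun c x => by simp [D.leibniz, smul_sub]; abel }
  have hD' : ∀ w : W, D'.toFun w = DW.toFun w := fun w => by simp [D', DW, Λ, hp']
  have hmem : ∀ x, (h.symm.toLinearMap ∘ₗ D'.comm D' h.toLinearMap) x ∈ W := by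
    intro x
    refine hW' _ ?_
    have h1 : D'.comm D' h.toLinearMap x = D'.toFun (h x - x) - (h (D'.toFun x) - D'.toFun x) := by
      simp
    rw [h1]
    refine W.sub_mem ?_ (hW _)
    have := hD' ⟨h x - x, hW x⟩
    rw [this]
    exact (DW.toFun _).2
  have e1 : h.symm.toLinearMap ∘ₗ D.comm D h.toLinearMap =
      h.symm.toLinearMap ∘ₗ D'.comm D' h.toLinearMap +
        ((h.symm.toLinearMap ∘ₗ Λ) ∘ₗ h.toLinearMap - Λ) := by
    ext x; simp [D']; abel
  have e2 : h.toLinearMap ∘ₗ h.symm.toLinearMap ∘ₗ Λ = Λ := by ext x; simp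
  rw [e1, ftrace_add (finiteRank_of_forall_mem W hmem) (((hΛ.comp_left _).comp_right _).sub hΛ),
    ftrace_sub ((hΛ.comp_left _).comp_right _) hΛ, ftrace_comp_comm (hΛ.comp_left _), e2, sub_self,
    add_zero, ftrace_eq_trace_restrict W hmem, fdet_eq_det_restrict W hW]
  have h2 : (h.toLinearMap.restrict (map_mem_of_sub_mem hW)) ∘ₗ
      (h.symm.toLinearMap.restrict hW') = 1 := by
    ext x; simp
  rw [DW.deriv_det h2]
  congr 2
  ext x
  have hx : h.toLinearMap x ∈ W := map_mem_of_sub_mem hW x x.2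
  have e3 := hD' ⟨_, hx⟩
  have e4 := hD' x
  simp only [LinearEquiv.coe_coe] at e3
  simp [e3, e4]
  rfl

end Along

/-! ### Determinant lines are one-dimensional -/

section Frames

variable {K : Type*} [Field K]
variable {M N : Type*} [AddCommGroup M] [Module K M] [AddCommGroup N] [Module K N]

variable (K N) in
/-- Splitting off the last coordinate: `(N ⊕ K^a) ⊕ K ≃ N ⊕ K^(a+1)`. -/
def snocE (a : ℕ) : ((N × (Fin a → K)) × K) ≃ₗ[K] (N × (Fin (a + 1) → K)) where
  toFun p := (p.1.1, Fin.snoc p.1.2 p.2)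
  invFun p := ((p.1, Fin.init p.2), p.2 (Fin.last a))
  map_add' p p' := by
    refine Prod.ext rfl (funext fun i => ?_)
    refine Fin.lastCases ?_ (fun i => ?_) i <;> simp
  map_smul' c p := by
    refine Prod.ext rfl (funext fun i => ?_)
    refine Fin.lastCases ?_ (fun i => ?_) i <;> simp
  left_inv p := by simp
  right_inv p := by simp

@[simp] lemma snocE_apply (a : ℕ) (p : (N × (Fin a → K)) × K) :
    snocE K N a p = (p.1.1, Fin.snoc p.1.2 p.2) := rfl

@[simp] lemma snocE_symm_apply (a : ℕ) (p : N × (Fin (a + 1) → K)) :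
    (snocE K N a).symm p = ((p.1, Fin.init p.2), p.2 (Fin.last a)) := rfl

variable (K N) in
/-- Splitting off all coordinates from the `a`-th on: `(N ⊕ K^a) ⊕ K^ℕ ≃ N ⊕ K^ℕ`. -/
def tailE (a : ℕ) : ((N × (Fin a → K)) × (ℕ → K)) ≃ₗ[K] (N × (ℕ → K)) where
  toFun p := (p.1.1, fun i => if h : i < a then p.1.2 ⟨i, h⟩ else p.2 (i - a))
  invFun p := ((p.1, fun i => p.2 i), fun i => p.2 (i + a))
  map_add' p p' := by
    refine Prod.ext rfl (funext fun i => ?_)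
    by_cases h : i < a <;> simp [h]
  map_smul' c p := by
    refine Prod.ext rfl (funext fun i => ?_)
    by_cases h : i < a <;> simp [h]
  left_inv p := by simp
  right_inv p := by
    refine Prod.ext rfl (funext fun i => ?_)
    by_cases h : i < a
    · simp [h]
    · simp [h, Nat.sub_add_cancel (not_lt.mp h)]

variable {f : N →ₗ[K] M} {a b a' b' : ℕ}

lemma DetFrame.finiteRank_fst (q : DetFrame f a b) :
    FiniteRank (LinearMap.fst K M (Fin b → K) ∘ₗ q.iso.toLinearMap -
      f ∘ₗ LinearMap.fst K N (Fin a → K)) := by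
  have h : LinearMap.fst K M (Fin b → K) ∘ₗ q.iso.toLinearMap -
      f ∘ₗ LinearMap.fst K N (Fin a → K) =
      (LinearMap.fst K M (Fin b → K) ∘ₗ q.iso.toLinearMap ∘ₗ
        LinearMap.inl K N (Fin a → K) - f) ∘ₗ LinearMap.fst K N (Fin a → K) +
      (LinearMap.fst K M (Fin b → K) ∘ₗ q.iso.toLinearMap ∘ₗ LinearMap.inr K N (Fin a → K)) ∘ₗ
        LinearMap.snd K N (Fin a → K) := by
    refine LinearMap.ext fun ⟨x, c⟩ => ?_
    have : q.iso (x, c) = q.iso (x, 0) + q.iso (0, c) := by rw [← map_add]; simp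
    simp [this]
    abel
  rw [h]
  exact (q.lift.comp_right _).add ((finiteRank_of_finite_left _).comp_right _)

/-- A frame is `f` up to finite rank. -/
lemma DetFrame.finiteRank_sub (q : DetFrame f a b) :
    FiniteRank (q.iso.toLinearMap - LinearMap.inl K M (Fin b → K) ∘ₗ f ∘ₗ
      LinearMap.fst K N (Fin a → K)) := by
  have h : q.iso.toLinearMap - LinearMap.inl K M (Fin b → K) ∘ₗ f ∘ₗ
      LinearMap.fst K N (Fin a → K) =
      LinearMap.inl K M (Fin b → K) ∘ₗ (LinearMap.fst K M (Fin b → K) ∘ₗ q.iso.toLinearMap -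
        f ∘ₗ LinearMap.fst K N (Fin a → K)) +
      LinearMap.inr K M (Fin b → K) ∘ₗ (LinearMap.snd K M (Fin b → K) ∘ₗ q.iso.toLinearMap) := by
    refine LinearMap.ext fun x => ?_
    ext <;> simp
  rw [h]
  exact (q.finiteRank_fst.comp_left _).add ((finiteRank_of_finite_right _).comp_left _)

lemma DetFrame.finiteRank_symm_comp (q q' : DetFrame f a b) :
    FiniteRank (q.iso.symm.toLinearMap ∘ₗ q'.iso.toLinearMap - 1) := by
  have h : q.iso.symm.toLinearMap ∘ₗ q'.iso.toLinearMap - 1 = q.iso.symm.toLinearMap ∘ₗ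
      ((q'.iso.toLinearMap - LinearMap.inl K M (Fin b → K) ∘ₗ f ∘ₗ LinearMap.fst K N (Fin a → K)) -
      (q.iso.toLinearMap - LinearMap.inl K M (Fin b → K) ∘ₗ f ∘ₗ
        LinearMap.fst K N (Fin a → K))) := by
    refine LinearMap.ext fun x => ?_
    simp
  rw [h]
  exact (q'.finiteRank_sub.sub q.finiteRank_sub).comp_left _

/-- The frame `q ⊕ id` of size `(a + 1, b + 1)`. -/
def DetFrame.stab (q : DetFrame f a b) : DetFrame f (a + 1) (b + 1) where
  iso := (snocE K N a).symm ≪≫ₗ (q.iso.prodCongr (LinearEquiv.refl K K)) ≪≫ₗ snocE K M b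
  lift := by
    convert q.lift using 2
    refine LinearMap.ext fun x => ?_
    simp
    rfl

lemma DetFrame.isStab_stab (q : DetFrame f a b) : q.IsStab q.stab := by
  intro x c z
  simp [DetFrame.stab]

lemma DetFrame.IsStab.iso_eq {q : DetFrame f a b} {q' : DetFrame f (a + 1) (b + 1)}
    (h : q.IsStab q') (p : (N × (Fin a → K)) × K) :
    q'.iso (snocE K N a p) = snocE K M b (q.iso p.1, p.2) := h _ _ _

/-- Every frame can be enlarged without changing the coordinates of vectors at it. -/
lemma DetFrame.exists_stab_add (q : DetFrame f a b) (j : ℕ) :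
    ∃ q' : DetFrame f (a + j) (b + j), ∀ s : DetLine f, s.1 _ _ q' = s.1 _ _ q := by
  induction j with
  | zero => exact ⟨q, fun s => rfl⟩
  | succ j ih =>
    obtain ⟨q', h⟩ := ih
    exact ⟨q'.stab, fun s => (s.2.2 _ _ _ _ q'.isStab_stab).trans (h s)⟩

/-- The extension of a frame to `N ⊕ K^ℕ ≃ M ⊕ K^ℕ` by the shift on the remaining coordinates. It
does not change when the frame is stabilized, and so it compares frames of different sizes. -/
def DetFrame.inf (q : DetFrame f a b) : (N × (ℕ → K)) ≃ₗ[K] (M × (ℕ → K)) :=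
  (tailE K N a).symm ≪≫ₗ (q.iso.prodCongr (LinearEquiv.refl K _)) ≪≫ₗ tailE K M b

lemma DetFrame.inf_apply (q : DetFrame f a b) (x : N) (c : ℕ → K) :
    q.inf (x, c) = ((q.iso (x, fun i => c i)).1,
      fun i => if h : i < b then (q.iso (x, fun i => c i)).2 ⟨i, h⟩ else c (i - b + a)) := rfl

lemma DetFrame.IsStab.inf_eq {q : DetFrame f a b} {q' : DetFrame f (a + 1) (b + 1)}
    (h : q.IsStab q') : q'.inf = q.inf := by
  refine LinearEquiv.ext fun ⟨x, c⟩ => ?_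
  rw [DetFrame.inf_apply, DetFrame.inf_apply]
  have hc : (fun i : Fin (a + 1) => c i) =
      Fin.snoc (α := fun _ => K) (fun i : Fin a => c i) (c a) := by
    funext i
    refine Fin.lastCases ?_ (fun i => ?_) i <;> simp
  rw [hc, h]
  refine Prod.ext rfl (funext fun i => ?_)
  rcases lt_trichotomy i b with hi | rfl | hi
  · have : (⟨i, by omega⟩ : Fin (b + 1)) = Fin.castSucc ⟨i, hi⟩ := rfl
    simp only [hi, dif_pos, show i < b + 1 by omega]
    rw [this, Fin.snoc_castSucc]
  · have : (⟨i, by omega⟩ : Fin (i + 1)) = Fin.last i := rfl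
    simp [this]
  · simp only [show ¬ i < b by omega, show ¬ i < b + 1 by omega, dif_neg, not_false_eq_true]
    congr 1
    omega

/-- An isomorphism `N ⊕ U ≃ N ⊕ U'` that is the identity on `N` up to finite rank is the identity on a
subspace of finite codimension; passing to the quotient by it shows that `U` and `U'` have the same
dimension. -/
lemma finrank_eq_of_finiteRank {U U' : Type*} [AddCommGroup U] [Module K U] [Module.Finite K U]
    [AddCommGroup U'] [Module K U'] [Module.Finite K U'] (H : (N × U) ≃ₗ[K] (N × U'))
    (hr : FiniteRank (H.toLinearMap ∘ₗ LinearMap.inl K N U - LinearMap.inl K N U')) :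
    Module.finrank K U = Module.finrank K U' := by
  -- `H` is the identity on the kernel `D` of `r`, which has finite codimension.
  set r := H.toLinearMap ∘ₗ LinearMap.inl K N U - LinearMap.inl K N U' with hrdef
  let D := LinearMap.ker r
  have hD : ∀ x ∈ D, H (x, 0) = (x, 0) := by
    intro x hx
    have : r x = 0 := hx
    simpa [hrdef, sub_eq_zero] using this
  have : Module.Finite K (N ⧸ D) := by
    unfold FiniteRank at hr
    exact Module.Finite.equiv r.quotKerEquivRange.symm
  let π : (N × U) →ₗ[K] (N ⧸ D) × U := D.mkQ.prodMap LinearMap.id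
  let π' : (N × U) →ₗ[K] (N ⧸ D) × U' := (D.mkQ.prodMap LinearMap.id) ∘ₗ H.toLinearMap
  have hπ : Function.Surjective π :=
    Function.Surjective.prodMap D.mkQ_surjective Function.surjective_id
  have hπ' : Function.Surjective π' :=
    (Function.Surjective.prodMap D.mkQ_surjective Function.surjective_id).comp H.surjective
  have hker : LinearMap.ker π = LinearMap.ker π' := by
    ext ⟨x, u⟩
    have h1 : ∀ (y : N) (w : U'), (D.mkQ.prodMap LinearMap.id) (y, w) = 0 ↔ y ∈ D ∧ w = 0 := by
      intro y w; simp [Prod.ext_iff]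
    have h2 : π (x, u) = 0 ↔ x ∈ D ∧ u = 0 := by simp [π, Prod.ext_iff]
    rw [LinearMap.mem_ker, LinearMap.mem_ker, h2]
    constructor
    · rintro ⟨hx, rfl⟩
      simp only [π', LinearMap.comp_apply, LinearEquiv.coe_coe, hD x hx]
      exact (h1 _ _).mpr ⟨hx, rfl⟩
    · intro h
      obtain ⟨h3, h4⟩ := (h1 (H (x, u)).1 (H (x, u)).2).mp h
      have h5 : H (x, u) = H ((H (x, u)).1, 0) := by
        rw [hD _ h3]
        exact Prod.ext rfl h4
      have h6 := H.injective h5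
      simp only [Prod.mk.injEq] at h6
      exact ⟨by rw [h6.1]; exact h3, h6.2⟩
  have e1 := (π.quotKerEquivOfSurjective hπ).finrank_eq
  have e2 := (π'.quotKerEquivOfSurjective hπ').finrank_eq
  have e3 := (Submodule.quotEquivOfEq _ _ hker).finrank_eq
  rw [Module.finrank_prod] at e1 e2
  omega

/-- The index: all frames have the same `a - b`. -/
lemma DetFrame.add_eq_add (q : DetFrame f a b) (q' : DetFrame f a' b') : a + b' = a' + b := by
  let E : (N × ((Fin a → K) × (Fin b' → K))) ≃ₗ[K] (M × ((Fin b → K) × (Fin b' → K))) :=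
    (LinearEquiv.prodAssoc K N _ _).symm ≪≫ₗ (q.iso.prodCongr (LinearEquiv.refl K _)) ≪≫ₗ
      LinearEquiv.prodAssoc K M _ _
  let E' : (N × ((Fin a' → K) × (Fin b → K))) ≃ₗ[K] (M × ((Fin b → K) × (Fin b' → K))) :=
    (LinearEquiv.prodAssoc K N _ _).symm ≪≫ₗ (q'.iso.prodCongr (LinearEquiv.refl K _)) ≪≫ₗ
      LinearEquiv.prodAssoc K M _ _ ≪≫ₗ
      ((LinearEquiv.refl K M).prodCongr (LinearEquiv.prodComm K _ _))
  have h := finrank_eq_of_finiteRank (E ≪≫ₗ E'.symm) ?_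
  · simpa using h
  have h1 : (E ≪≫ₗ E'.symm).toLinearMap ∘ₗ LinearMap.inl K N _ - LinearMap.inl K N _ =
      E'.symm.toLinearMap ∘ₗ (E.toLinearMap ∘ₗ LinearMap.inl K N _ -
        E'.toLinearMap ∘ₗ LinearMap.inl K N _) := by
    refine LinearMap.ext fun x => ?_
    simp
  have h2 : E.toLinearMap ∘ₗ LinearMap.inl K N _ - E'.toLinearMap ∘ₗ LinearMap.inl K N _ =
      LinearMap.inl K M _ ∘ₗ ((LinearMap.fst K M (Fin b → K) ∘ₗ q.iso.toLinearMap ∘ₗ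
        LinearMap.inl K N (Fin a → K) - f) - (LinearMap.fst K M (Fin b' → K) ∘ₗ
        q'.iso.toLinearMap ∘ₗ LinearMap.inl K N (Fin a' → K) - f)) +
      LinearMap.inr K M _ ∘ₗ (LinearMap.snd K M _ ∘ₗ (E.toLinearMap ∘ₗ LinearMap.inl K N _ -
        E'.toLinearMap ∘ₗ LinearMap.inl K N _)) := by
    refine LinearMap.ext fun x => Prod.ext ?_ ?_
    · simp [E, E']
      rfl
    · simp
  rw [h1, h2]
  exact (((q.lift.sub q'.lift).comp_left _).add
    ((finiteRank_of_finite_right _).comp_left _)).comp_left _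

/-- The shifts by which two frames are extended agree since the frames have the same index. -/
lemma DetFrame.finiteRank_inf_symm_comp (q : DetFrame f a b) (q' : DetFrame f a' b') :
    FiniteRank (q.inf.symm.toLinearMap ∘ₗ q'.inf.toLinearMap - 1) := by
  have hidx := q.add_eq_add q'
  have h1 : q.inf.symm.toLinearMap ∘ₗ q'.inf.toLinearMap - 1 =
      q.inf.symm.toLinearMap ∘ₗ (q'.inf.toLinearMap - q.inf.toLinearMap) := by
    refine LinearMap.ext fun x => ?_
    simp
  let R (n : ℕ) : (ℕ → K) →ₗ[K] (Fin n → K) := LinearMap.funLeft K K (fun i : Fin n => (i : ℕ))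
  let I (n : ℕ) : (Fin n → K) →ₗ[K] (ℕ → K) :=
    { toFun := fun c i => if h : i < n then c ⟨i, h⟩ else 0
      map_add' := fun c c' => by funext i; by_cases h : i < n <;> simp [h]
      map_smul' := fun z c => by funext i; by_cases h : i < n <;> simp [h] }
  let G (n : ℕ) : (N × (ℕ → K)) →ₗ[K] (N × (Fin n → K)) := LinearMap.id.prodMap (R n)
  have h2 : q'.inf.toLinearMap - q.inf.toLinearMap =
      LinearMap.inl K M _ ∘ₗ
        ((LinearMap.fst K M (Fin b' → K) ∘ₗ q'.iso.toLinearMap -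
          f ∘ₗ LinearMap.fst K N (Fin a' → K)) ∘ₗ G a' -
        (LinearMap.fst K M (Fin b → K) ∘ₗ q.iso.toLinearMap -
          f ∘ₗ LinearMap.fst K N (Fin a → K)) ∘ₗ G a) +
      LinearMap.inr K M _ ∘ₗ I (max b b') ∘ₗ R (max b b') ∘ₗ LinearMap.snd K M _ ∘ₗ
        (q'.inf.toLinearMap - q.inf.toLinearMap) := by
    refine LinearMap.ext fun ⟨x, c⟩ => Prod.ext ?_ (funext fun i => ?_)
    · simp [G, DetFrame.inf_apply, R]
      rfl
    · by_cases hi : i < max b b'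
      · have : I (max b b') (R (max b b') (q'.inf (x, c) - q.inf (x, c)).2) i =
            (q'.inf (x, c) - q.inf (x, c)).2 i := dif_pos hi
        simp [-Prod.snd_sub, this]
      · simp only [I, R, hi, DetFrame.inf_apply, LinearMap.sub_apply, LinearMap.add_apply,
          LinearMap.comp_apply, Prod.snd_sub, Prod.snd_add, LinearMap.inl_apply,
          LinearMap.inr_apply, LinearEquiv.coe_coe, Pi.sub_apply, Pi.add_apply, Pi.zero_apply,
          LinearMap.coe_mk, AddHom.coe_mk, dif_neg, not_false_eq_true]
        rw [dif_neg (by omega), dif_neg (by omega), show i - b' + a' = i - b + a by omega]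
        simp
  rw [h1, h2]
  exact ((((q'.finiteRank_fst.comp_right _).sub (q.finiteRank_fst.comp_right _)).comp_left _).add
    (((finiteRank_of_finite_left (I (max b b'))).comp_right _).comp_left _)).comp_left _

lemma DetFrame.fdet_inf (q q' : DetFrame f a b) :
    fdet (q.inf.symm.toLinearMap ∘ₗ q'.inf.toLinearMap) =
      fdet (q.iso.symm.toLinearMap ∘ₗ q'.iso.toLinearMap) := by
  refine fdet_eq_of_summand (q.finiteRank_symm_comp q')
    ((tailE K N a).toLinearMap ∘ₗ LinearMap.inl K _ _)
    (LinearMap.fst K _ _ ∘ₗ (tailE K N a).symm.toLinearMap) (fun x => by simp) fun y => ?_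
  obtain ⟨⟨w, c⟩, rfl⟩ := (tailE K N a).surjective y
  simp only [LinearMap.comp_apply, LinearEquiv.coe_coe, LinearEquiv.symm_apply_apply,
    LinearMap.fst_apply, LinearMap.inl_apply]
  rw [← map_add]
  simp [DetFrame.inf]

/-- The vector of the determinant line whose coordinate at the frame `q₀` is `1`. -/
def DetFrame.gen (q₀ : DetFrame f a' b') : DetLine f :=
  ⟨fun _ _ q => fdet (q.inf.symm.toLinearMap ∘ₗ q₀.inf.toLinearMap), by
    refine ⟨fun a b q q' => ?_, fun a b q q' h => ?_⟩
    · have h1 := fdet_mul (q.finiteRank_inf_symm_comp q') (q'.finiteRank_inf_symm_comp q₀)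
      have h2 : (q.inf.symm.toLinearMap ∘ₗ q'.inf.toLinearMap) ∘ₗ
          (q'.inf.symm.toLinearMap ∘ₗ q₀.inf.toLinearMap) =
          q.inf.symm.toLinearMap ∘ₗ q₀.inf.toLinearMap := by
        refine LinearMap.ext fun x => ?_
        simp
      rw [h2, q.fdet_inf q'] at h1
      exact h1.trans (mul_comm _ _)
    · simp only [h.inf_eq]⟩

lemma DetFrame.gen_self (q₀ : DetFrame f a b) : q₀.gen.1 a b q₀ = 1 := by
  have : q₀.inf.symm.toLinearMap ∘ₗ q₀.inf.toLinearMap = 1 := by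
    refine LinearMap.ext fun x => ?_
    simp
  change fdet _ = 1
  rw [this, fdet_one]

/-- The determinant line is spanned by any of its frames: a vector is determined by its coordinate at
one frame. -/
lemma DetLine.eq_zero_of_apply_eq_zero (q₀ : DetFrame f a b) (s : DetLine f)
    (h : s.1 a b q₀ = 0) : s = 0 := by
  refine Subtype.ext (funext fun a' => funext fun b' => funext fun q => ?_)
  have hidx := q.add_eq_add q₀
  rcases le_total a a' with hle | hle
  · obtain ⟨j, rfl⟩ := Nat.exists_eq_add_of_le hle
    obtain rfl : b' = b + j := by omega
    obtain ⟨q', hq'⟩ := q₀.exists_stab_add j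
    rw [s.2.1 _ _ q q', hq', h, zero_mul]
    rfl
  · obtain ⟨j, rfl⟩ := Nat.exists_eq_add_of_le hle
    obtain rfl : b = b' + j := by omega
    obtain ⟨q', hq'⟩ := q.exists_stab_add j
    rw [← hq', s.2.1 _ _ q' q₀, h, zero_mul]
    rfl

end Frames

/-! ### Connections on determinant lines -/

section Connection

variable {k K : Type*} [Field k] [Field K] [Algebra k K] {θ : Derivation k K K}
variable {M : Type*} [AddCommGroup M] [Module K M] {f : Module.End K M} {a b : ℕ}

/-- The operator `[D, q] + B q`, the derivative of the frame `q` along the infinitesimal symmetry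
`(1 + ε B) (1 + ε D)`. -/
def frameDeriv (D : ConnAlong θ M) (B : Module.End K M) (q : DetFrame f a b) :
    (M × (Fin a → K)) →ₗ[K] (M × (Fin b → K)) :=
  (D.extend b).comm (D.extend a) q.iso.toLinearMap +
    (B.prodMap (0 : (Fin b → K) →ₗ[K] (Fin b → K))) ∘ₗ q.iso.toLinearMap

/-- Replacing the frame `q` by `f` changes its derivative by an operator of finite rank. -/
lemma finiteRank_frameDeriv {D : ConnAlong θ M} {B : Module.End K M}
    (hDB : FiniteRank (D.comm D f + B ∘ₗ f)) (q : DetFrame f a b) :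
    FiniteRank (frameDeriv D B q) := by
  set Bp : Module.End K (M × (Fin b → K)) := B.prodMap (0 : (Fin b → K) →ₗ[K] (Fin b → K)) with hBp
  set f' := LinearMap.inl K M (Fin b → K) ∘ₗ f ∘ₗ LinearMap.fst K M (Fin a → K)
  have h1 : frameDeriv D B q = LinearMap.inl K M (Fin b → K) ∘ₗ (D.comm D f + B ∘ₗ f) ∘ₗ
      LinearMap.fst K M (Fin a → K) + ((D.extend b).comm (D.extend a) (q.iso.toLinearMap - f') +
        Bp ∘ₗ (q.iso.toLinearMap - f')) := by
    refine LinearMap.ext fun ⟨x, c⟩ => ?_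
    ext <;> (simp [frameDeriv, ConnAlong.extend, f', hBp]; try abel)
  rw [h1]
  exact ((hDB.comp_right _).comp_left _).add ((q.finiteRank_sub.comm _ _).add
    (q.finiteRank_sub.comp_left _))

/-- The action of an infinitesimal symmetry is well defined on the determinant line: compatibility
with a change `q' = q h` of the frame is Jacobi's formula for `fdet h`. -/
lemma detLineDeriv_mem {D : ConnAlong θ M} {B : Module.End K M}
    (hDB : FiniteRank (D.comm D f + B ∘ₗ f)) (z : K) (s : DetLine f) :
    (fun a b q => detLineDeriv D B z s a b q) ∈ DetLine f := by
  refine ⟨fun a b q q' => ?_, fun a b q q' hq => ?_⟩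
  · let h : (M × (Fin a → K)) ≃ₗ[K] (M × (Fin a → K)) := q'.iso ≪≫ₗ q.iso.symm
    have hh : FiniteRank (h.toLinearMap - 1) := q.finiteRank_symm_comp q'
    have hs : s.1 a b q = s.1 a b q' * fdet h.toLinearMap := s.2.1 a b q q'
    have e1 : q'.iso.symm.toLinearMap ∘ₗ frameDeriv D B q' =
        (h.symm.toLinearMap ∘ₗ q.iso.symm.toLinearMap ∘ₗ frameDeriv D B q) ∘ₗ h.toLinearMap +
          h.symm.toLinearMap ∘ₗ (D.extend a).comm (D.extend a) h.toLinearMap := by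
      refine LinearMap.ext fun x => ?_
      simp [frameDeriv, h]
      abel
    have hfr := finiteRank_frameDeriv hDB q
    have e2 : h.toLinearMap ∘ₗ h.symm.toLinearMap ∘ₗ q.iso.symm.toLinearMap ∘ₗ frameDeriv D B q =
        q.iso.symm.toLinearMap ∘ₗ frameDeriv D B q := by
      refine LinearMap.ext fun x => ?_
      simp
    have e3 : ftrace (q'.iso.symm.toLinearMap ∘ₗ frameDeriv D B q') =
        ftrace (q.iso.symm.toLinearMap ∘ₗ frameDeriv D B q) +
          ftrace (h.symm.toLinearMap ∘ₗ (D.extend a).comm (D.extend a) h.toLinearMap) := by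
      rw [e1, ftrace_add (((hfr.comp_left _).comp_left _).comp_right _)
        ((hh.comm_of_sub_one _).comp_left _), ftrace_comp_comm ((hfr.comp_left _).comp_left _), e2]
    have e4 := (D.extend a).deriv_fdet h hh
    change θ (s.1 a b q) + s.1 a b q *
      (ftrace (q.iso.symm.toLinearMap ∘ₗ frameDeriv D B q) + z) =
      (θ (s.1 a b q') + s.1 a b q' *
      (ftrace (q'.iso.symm.toLinearMap ∘ₗ frameDeriv D B q') + z)) * fdet h.toLinearMap
    rw [e3, hs, θ.leibniz, e4]
    simp only [smul_eq_mul]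
    ring
  · have hs : s.1 (a + 1) (b + 1) q' = s.1 a b q := s.2.2 a b q q' hq
    let J (n : ℕ) : (M × (Fin n → K)) →ₗ[K] (M × (Fin (n + 1) → K)) :=
      (snocE K M n).toLinearMap ∘ₗ LinearMap.inl K _ _
    let J' (n : ℕ) : (M × (Fin (n + 1) → K)) →ₗ[K] (M × (Fin n → K)) :=
      LinearMap.fst K _ _ ∘ₗ (snocE K M n).symm.toLinearMap
    have hD : ∀ (n : ℕ) (p : (M × (Fin n → K)) × K), (D.extend (n + 1)).toFun (snocE K M n p) =
        snocE K M n ((D.extend n).toFun p.1, θ p.2) := by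
      intro n p
      refine Prod.ext rfl (funext fun i => ?_)
      refine Fin.lastCases ?_ (fun i => ?_) i <;> simp [ConnAlong.extend]
    have hB : ∀ p : (M × (Fin b → K)) × K,
        (B.prodMap (0 : (Fin (b + 1) → K) →ₗ[K] (Fin (b + 1) → K))) (snocE K M b p) =
        snocE K M b ((B.prodMap (0 : (Fin b → K) →ₗ[K] (Fin b → K))) p.1, 0) := by
      intro p
      refine Prod.ext rfl (funext fun i => ?_)
      refine Fin.lastCases ?_ (fun i => ?_) i <;> simp
    have e1 : q'.iso.symm.toLinearMap ∘ₗ frameDeriv D B q' =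
        J a ∘ₗ (q.iso.symm.toLinearMap ∘ₗ frameDeriv D B q) ∘ₗ J' a := by
      refine LinearMap.ext fun x => ?_
      obtain ⟨p, rfl⟩ := (snocE K M a).surjective x
      apply q'.iso.injective
      simp only [LinearMap.comp_apply, LinearEquiv.coe_coe, LinearEquiv.apply_symm_apply, J, J',
        LinearEquiv.symm_apply_apply, LinearMap.inl_apply, LinearMap.fst_apply, frameDeriv,
        LinearMap.add_apply, ConnAlong.comm_apply, hD, hq.iso_eq, hB]
      rw [← map_sub, ← map_add]
      congr 1
      ext <;> simp
    have hfr := finiteRank_frameDeriv hDB q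
    have e2 : ftrace (q'.iso.symm.toLinearMap ∘ₗ frameDeriv D B q') =
        ftrace (q.iso.symm.toLinearMap ∘ₗ frameDeriv D B q) := by
      rw [e1, ftrace_comp_comm' ((hfr.comp_left _).comp_right _)]
      congr 1
      refine LinearMap.ext fun x => ?_
      simp [J, J']
    change θ (s.1 _ _ q') + s.1 _ _ q' *
      (ftrace (q'.iso.symm.toLinearMap ∘ₗ frameDeriv D B q') + z) = θ (s.1 a b q) + s.1 a b q *
      (ftrace (q.iso.symm.toLinearMap ∘ₗ frameDeriv D B q) + z)
    rw [e2, hs]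

/-- A connection along `θ` on `U` induces one on `(det_K U)^{⊗ N}`. -/
lemma detPowDeriv_mem (N : ℤ) {U : Type*} [AddCommGroup U] [Module K U] (D : ConnAlong θ U)
    (s : DetPow (K := K) N U) : (fun e => detPowDeriv N D s e) ∈ DetPow (K := K) N U := by
  intro e e'
  have hs : s.1 e = s.1 e' * (e.det e') ^ N := s.2 e e'
  let P := e.toMatrix e'
  let P' := e'.toMatrix e
  have hPP : P * P' = 1 := e.toMatrix_mul_toMatrix_flip e'
  have hPP' : P' * P = 1 := e'.toMatrix_mul_toMatrix_flip e
  let Γ : Matrix _ _ K := .of fun i j => e.repr (D.toFun (e j)) i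
  have hdet : e.det e' = P.det := e.det_apply e'
  have hunit : IsUnit P.det := Matrix.isUnit_det_of_right_inverse hPP
  have hD : ∀ j i, e.repr (D.toFun (e' j)) i = (P.map θ + Γ * P) i j := by
    intro j i
    conv_lhs => rw [← e.sum_toMatrix_smul_self e' j]
    simp [-Module.Basis.sum_toMatrix_smul_self, D.leibniz, Matrix.mul_apply,
      Finset.sum_add_distrib, Finsupp.single_apply, P, Γ, mul_comm]
  have htr : ∑ i, e'.repr (D.toFun (e' i)) i = (P' * (P.map θ + Γ * P)).trace := by
    refine Finset.sum_congr rfl fun i _ => ?_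
    rw [Matrix.diag_apply, Matrix.mul_apply]
    conv_lhs => rw [← e.sum_repr (D.toFun (e' i))]
    simp [-Module.Basis.sum_repr, hD, Module.Basis.toMatrix_apply, P', mul_comm]
  rw [Matrix.mul_add, Matrix.trace_add, Matrix.trace_mul_comm _ (Γ * P), Matrix.mul_assoc, hPP,
    Matrix.mul_one] at htr
  have hθ := derivation_det θ hPP
  have htr' : ∑ i, e.repr (D.toFun (e i)) i = Γ.trace := rfl
  have hne : P.det ≠ 0 := hunit.ne_zero
  change θ (s.1 e) + N * (∑ i, e.repr (D.toFun (e i)) i) * s.1 e =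
    (θ (s.1 e') + N * (∑ i, e'.repr (D.toFun (e' i)) i) * s.1 e') * e.det e' ^ N
  rw [htr, htr', hs, hdet, θ.leibniz, θ.leibniz_zpow, hθ]
  simp only [smul_eq_mul, zsmul_eq_mul]
  rw [zpow_sub_one₀ hne]
  field_simp
  ring

end Connection

/-! ### Laurent series -/

section Series

variable {k K' : Type*} [Field k] [Field K'] [Algebra k K']

/-- `f ∈ t^A K'[[t]]`. -/
def OrdGE (A : ℤ) (f : LaurentSeries K') : Prop := ∀ d < A, f.coeff d = 0

lemma tpow_add (i j : ℤ) : tpow K' (i + j) = tpow K' i * tpow K' j := by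
  simp [tpow]

lemma tpow_zero : tpow K' 0 = 1 := rfl

lemma tpow_ne_zero (i : ℤ) : tpow K' i ≠ 0 := HahnSeries.single_ne_zero one_ne_zero

lemma tpow_inv (i : ℤ) : (tpow K' i)⁻¹ = tpow K' (-i) := by
  refine inv_eq_of_mul_eq_one_right ?_
  rw [← tpow_add, add_neg_cancel, tpow_zero]

lemma coeff_tpow_mul (j : ℤ) (f : LaurentSeries K') (d : ℤ) :
    (tpow K' j * f).coeff d = f.coeff (d - j) := by
  have := HahnSeries.coeff_single_mul_add (Γ := ℤ) (r := (1 : K')) (x := f) (a := d - j) (b := j)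
  rw [sub_add_cancel, one_mul] at this
  exact this

lemma coeff_ddt (f : LaurentSeries K') (d : ℤ) :
    (ddt f).coeff d = ((d : K') + 1) * f.coeff (d + 1) := by
  simp [ddt, LaurentSeries.derivative_apply, LaurentSeries.hasseDeriv_coeff]

lemma ddt_add (f g : LaurentSeries K') : ddt (f + g) = ddt f + ddt g := map_add _ _ _

lemma coeff_horDer (θ : Derivation k K' K') (f : LaurentSeries K') (d : ℤ) :
    (horDer θ f).coeff d = θ (f.coeff d) := rfl

lemma horDer_add (θ : Derivation k K' K') (f g : LaurentSeries K') :
    horDer θ (f + g) = horDer θ f + horDer θ g := by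
  ext d; simp [coeff_horDer]

lemma coeff_C_mul (c : K') (f : LaurentSeries K') (d : ℤ) :
    ((HahnSeries.C c : LaurentSeries K') * f).coeff d = c * f.coeff d := by
  rw [HahnSeries.C_mul_eq_smul, HahnSeries.coeff_smul, smul_eq_mul]

lemma OrdGE.add {A : ℤ} {f g : LaurentSeries K'} (hf : OrdGE A f) (hg : OrdGE A g) :
    OrdGE A (f + g) := fun d hd => by simp [hf d hd, hg d hd]

lemma ordGE_zero (A : ℤ) : OrdGE A (0 : LaurentSeries K') := fun d _ => by simp

lemma ordGE_sum {ι : Type*} {s : Finset ι} {A : ℤ} {f : ι → LaurentSeries K'}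
    (h : ∀ i ∈ s, OrdGE A (f i)) : OrdGE A (∑ i ∈ s, f i) :=
  Finset.sum_induction f (OrdGE A) (fun _ _ => OrdGE.add) (ordGE_zero A) h

lemma OrdGE.mono {A B : ℤ} {f : LaurentSeries K'} (hf : OrdGE A f) (h : B ≤ A) : OrdGE B f :=
  fun d hd => hf d (by omega)

lemma ordGE_coe (p : PowerSeries K') : OrdGE 0 (p : LaurentSeries K') := fun d hd => by
  rw [PowerSeries.coeff_coe, if_pos hd]

lemma coeff_coe_zero (p : PowerSeries K') :
    (p : LaurentSeries K').coeff 0 = PowerSeries.constantCoeff p := by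
  rw [PowerSeries.coeff_coe, if_neg (lt_irrefl _)]; simp

lemma ordGE_tpow_mul {A j : ℤ} {f : LaurentSeries K'} :
    OrdGE A (tpow K' j * f) ↔ OrdGE (A - j) f := by
  constructor
  · intro h d hd
    have := h (d + j) (by omega)
    rwa [coeff_tpow_mul, add_sub_cancel_right] at this
  · intro h d hd
    rw [coeff_tpow_mul]
    exact h _ (by omega)

lemma ordGE_tpow (j : ℤ) : OrdGE j (tpow K' j) := fun _ hd =>
  HahnSeries.coeff_single_of_ne hd.ne

lemma OrdGE.exists_coe {A : ℤ} {f : LaurentSeries K'} (h : OrdGE A f) :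
    ∃ p : PowerSeries K', f = tpow K' A * (p : LaurentSeries K') := by
  refine ⟨PowerSeries.mk fun n => f.coeff (n + A), ?_⟩
  ext d
  rw [coeff_tpow_mul, PowerSeries.coeff_coe]
  split_ifs with hd
  · exact h d (by omega)
  · rw [PowerSeries.coeff_mk]
    congr 1
    omega

lemma exists_ordGE (f : LaurentSeries K') : ∃ A, OrdGE A f := by
  by_cases h : f = 0
  · exact ⟨0, h ▸ ordGE_zero 0⟩
  · exact ⟨f.order, fun d hd => HahnSeries.coeff_eq_zero_of_lt_order hd⟩

lemma OrdGE.mul {A B : ℤ} {f g : LaurentSeries K'} (hf : OrdGE A f) (hg : OrdGE B g) :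
    OrdGE (A + B) (f * g) := by
  obtain ⟨p, rfl⟩ := hf.exists_coe
  obtain ⟨q, rfl⟩ := hg.exists_coe
  rw [mul_mul_mul_comm, ← tpow_add, ← PowerSeries.coe_mul, ordGE_tpow_mul, sub_self]
  exact ordGE_coe _

/-- The leading coefficient of a product. -/
lemma OrdGE.coeff_mul {A B : ℤ} {f g : LaurentSeries K'} (hf : OrdGE A f) (hg : OrdGE B g) :
    (f * g).coeff (A + B) = f.coeff A * g.coeff B := by
  obtain ⟨p, rfl⟩ := hf.exists_coe
  obtain ⟨q, rfl⟩ := hg.exists_coe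
  rw [mul_mul_mul_comm, ← tpow_add, ← PowerSeries.coe_mul, coeff_tpow_mul, coeff_tpow_mul,
    coeff_tpow_mul, sub_self, sub_self, sub_self, coeff_coe_zero, coeff_coe_zero, coeff_coe_zero,
    map_mul]

lemma OrdGE.mul' {A B D : ℤ} {f g : LaurentSeries K'} (hf : OrdGE A f) (hg : OrdGE B g)
    (h : D ≤ A + B) : OrdGE D (f * g) := (hf.mul hg).mono h

lemma OrdGE.coeff_mul' {A B D : ℤ} {f g : LaurentSeries K'} (hf : OrdGE A f) (hg : OrdGE B g)
    (h : D = A + B) : (f * g).coeff D = f.coeff A * g.coeff B := by rw [h, hf.coeff_mul hg]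

lemma OrdGE.ddt {A : ℤ} {f : LaurentSeries K'} (hf : OrdGE A f) : OrdGE (A - 1) (ddt f) :=
  fun d hd => by rw [coeff_ddt, hf _ (by omega), mul_zero]

/-- The derivative of a power series is a power series. -/
lemma OrdGE.ddt_of_zero {f : LaurentSeries K'} (hf : OrdGE 0 f) : OrdGE 0 (EpsLine.ddt f) :=
  fun d hd => by
    rw [coeff_ddt]
    rcases eq_or_ne d (-1) with rfl | h
    · simp
    · rw [hf _ (by omega), mul_zero]

lemma OrdGE.horDer {A : ℤ} {f : LaurentSeries K'} (hf : OrdGE A f) (θ : Derivation k K' K') :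
    OrdGE A (horDer θ f) := fun d hd => by rw [coeff_horDer, hf d hd, map_zero]

lemma horDer_tpow_mul (θ : Derivation k K' K') (j : ℤ) (f : LaurentSeries K') :
    horDer θ (tpow K' j * f) = tpow K' j * horDer θ f := by
  ext d; simp only [coeff_horDer, coeff_tpow_mul]

lemma ddt_tpow_mul (j : ℤ) (f : LaurentSeries K') :
    ddt (tpow K' j * f) = (HahnSeries.C (j : K') : LaurentSeries K') * (tpow K' (j - 1) * f) +
      tpow K' j * ddt f := by
  ext d
  rw [HahnSeries.coeff_add, coeff_ddt, coeff_C_mul, coeff_tpow_mul, coeff_tpow_mul, coeff_tpow_mul,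
    coeff_ddt, show d - j + 1 = d + 1 - j by ring, show d - (j - 1) = d + 1 - j by ring]
  push_cast
  ring

lemma ddt_coe (p : PowerSeries K') :
    ddt (p : LaurentSeries K') = ((PowerSeries.derivative K' p : PowerSeries K') : LaurentSeries K') := by
  ext d
  rw [coeff_ddt, PowerSeries.coeff_coe, PowerSeries.coeff_coe]
  split_ifs with h1 h2 h2
  · simp
  · omega
  · obtain rfl : d = -1 := by omega
    simp
  · obtain ⟨n, rfl⟩ := Int.eq_ofNat_of_zero_le (not_lt.mp h2)
    rw [PowerSeries.coeff_derivative]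
    have : ((n : ℤ) + 1).natAbs = n + 1 := by omega
    rw [this]
    simp [mul_comm]

lemma ddt_mul (f g : LaurentSeries K') : ddt (f * g) = ddt f * g + f * ddt g := by
  obtain ⟨A, hA⟩ := exists_ordGE f
  obtain ⟨B, hB⟩ := exists_ordGE g
  obtain ⟨p, rfl⟩ := hA.exists_coe
  obtain ⟨q, rfl⟩ := hB.exists_coe
  have h : ddt ((p : LaurentSeries K') * (q : LaurentSeries K')) =
      ddt (p : LaurentSeries K') * q + p * ddt (q : LaurentSeries K') := by
    rw [← PowerSeries.coe_mul, ddt_coe, ddt_coe, ddt_coe, Derivation.leibniz]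
    simp only [smul_eq_mul, PowerSeries.coe_add, PowerSeries.coe_mul]
    ring
  have e1 : tpow K' (A - 1) * tpow K' B = tpow K' (A + B - 1) := by
    rw [← tpow_add]; congr 1; ring
  have e2 : tpow K' A * tpow K' (B - 1) = tpow K' (A + B - 1) := by
    rw [← tpow_add]; congr 1; ring
  rw [mul_mul_mul_comm, ← tpow_add, ddt_tpow_mul, ddt_tpow_mul, ddt_tpow_mul, h, Int.cast_add,
    map_add, tpow_add]
  linear_combination -(HahnSeries.C (A : K') : LaurentSeries K') * p * q * e1 -
    (HahnSeries.C (B : K') : LaurentSeries K') * p * q * e2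

lemma horDer_mul (θ : Derivation k K' K') (f g : LaurentSeries K') :
    horDer θ (f * g) = horDer θ f * g + f * horDer θ g := by
  have hcoe : ∀ p : PowerSeries K', horDer θ (p : LaurentSeries K') =
      ((PowerSeries.mk fun n => θ (PowerSeries.coeff n p) : PowerSeries K') : LaurentSeries K') := by
    intro p
    ext d
    rw [coeff_horDer, PowerSeries.coeff_coe, PowerSeries.coeff_coe]
    split_ifs with h
    · simp
    · simp
  obtain ⟨A, hA⟩ := exists_ordGE f
  obtain ⟨B, hB⟩ := exists_ordGE g
  obtain ⟨p, rfl⟩ := hA.exists_coe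
  obtain ⟨q, rfl⟩ := hB.exists_coe
  have h : horDer θ ((p : LaurentSeries K') * (q : LaurentSeries K')) =
      horDer θ (p : LaurentSeries K') * q + p * horDer θ (q : LaurentSeries K') := by
    rw [← PowerSeries.coe_mul, hcoe, hcoe, hcoe, ← PowerSeries.coe_mul, ← PowerSeries.coe_mul,
      ← PowerSeries.coe_add]
    congr 1
    ext n
    simp only [PowerSeries.coeff_mk, PowerSeries.coeff_mul, map_add, map_sum,
      ← Finset.sum_add_distrib]
    refine Finset.sum_congr rfl fun x _ => ?_
    rw [θ.leibniz]
    simp only [smul_eq_mul]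
    ring
  rw [mul_mul_mul_comm, ← tpow_add, horDer_tpow_mul, horDer_tpow_mul, horDer_tpow_mul, h, tpow_add]
  ring

lemma ddt_inv {f : LaurentSeries K'} (hf : f ≠ 0) : ddt f⁻¹ = -(ddt f * f⁻¹ * f⁻¹) := by
  have h := ddt_mul f f⁻¹
  have h1 : ddt (1 : LaurentSeries K') = 0 := ddt_C 1
  rw [mul_inv_cancel₀ hf, h1] at h
  field_simp at h ⊢
  linear_combination -h

lemma horDer_inv (θ : Derivation k K' K') {f : LaurentSeries K'} (hf : f ≠ 0) :
    horDer θ f⁻¹ = -(horDer θ f * f⁻¹ * f⁻¹) := by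
  have h := horDer_mul θ f f⁻¹
  have h1 : horDer θ (1 : LaurentSeries K') = 0 := by
    have := horDer_C θ 1
    rwa [map_one, θ.map_one_eq_zero, map_zero] at this
  rw [mul_inv_cancel₀ hf, h1] at h
  field_simp at h ⊢
  linear_combination -h

lemma coe_unit_ne_zero (u : (PowerSeries K')ˣ) : ((u : PowerSeries K') : LaurentSeries K') ≠ 0 := by
  intro h
  have h1 : ((u : PowerSeries K') : LaurentSeries K') *
      ((u⁻¹ : (PowerSeries K')ˣ) : PowerSeries K') = 1 := by
    rw [← PowerSeries.coe_mul, Units.mul_inv, PowerSeries.coe_one]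
  rw [h, zero_mul] at h1
  exact zero_ne_one h1

lemma coe_unit_inv (u : (PowerSeries K')ˣ) : ((u : PowerSeries K') : LaurentSeries K')⁻¹ =
    (((u⁻¹ : (PowerSeries K')ˣ) : PowerSeries K') : LaurentSeries K') := by
  refine inv_eq_of_mul_eq_one_right ?_
  rw [← PowerSeries.coe_mul, Units.mul_inv, PowerSeries.coe_one]

lemma ordGE_coe_unit_inv (u : (PowerSeries K')ˣ) :
    OrdGE 0 ((u : PowerSeries K') : LaurentSeries K')⁻¹ := by
  rw [coe_unit_inv]; exact ordGE_coe _

lemma coeff_coe_unit_inv (u : (PowerSeries K')ˣ) :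
    (((u : PowerSeries K') : LaurentSeries K')⁻¹).coeff 0 =
      (PowerSeries.constantCoeff (u : PowerSeries K'))⁻¹ := by
  rw [coe_unit_inv, coeff_coe_zero]
  refine eq_inv_of_mul_eq_one_right ?_
  rw [← map_mul, Units.mul_inv, map_one]

/-! ### Matrices of Laurent series -/

variable {ι : Type*} [Fintype ι]

/-- All entries of the matrix lie in `t^A K'[[t]]`. -/
def MatOrdGE (A : ℤ) (X : Matrix ι ι (LaurentSeries K')) : Prop := ∀ i j, OrdGE A (X i j)

/-- The coefficient of `t^d` in a matrix of Laurent series. -/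
def matCoeff (d : ℤ) (X : Matrix ι ι (LaurentSeries K')) : Matrix ι ι K' := X.map fun f => f.coeff d

lemma MatOrdGE.mul {A B : ℤ} {X Y : Matrix ι ι (LaurentSeries K')} (hX : MatOrdGE A X)
    (hY : MatOrdGE B Y) : MatOrdGE (A + B) (X * Y) := fun i j => by
  rw [Matrix.mul_apply]
  exact ordGE_sum fun l _ => (hX i l).mul (hY l j)

lemma MatOrdGE.matCoeff_mul {A B : ℤ} {X Y : Matrix ι ι (LaurentSeries K')} (hX : MatOrdGE A X)
    (hY : MatOrdGE B Y) : matCoeff (A + B) (X * Y) = matCoeff A X * matCoeff B Y := by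
  ext i j
  simp only [matCoeff, Matrix.map_apply, Matrix.mul_apply, HahnSeries.coeff_sum]
  exact Finset.sum_congr rfl fun l _ => (hX i l).coeff_mul (hY l j)

lemma coeff_trace (d : ℤ) (X : Matrix ι ι (LaurentSeries K')) :
    X.trace.coeff d = (matCoeff d X).trace := by
  simp [Matrix.trace, matCoeff, HahnSeries.coeff_sum]

variable [DecidableEq ι]

/-- A matrix of power series with invertible constant term has an inverse of the same kind. -/
lemma MatOrdGE.inv {X : Matrix ι ι (LaurentSeries K')} (hX : MatOrdGE 0 X)
    (hdet : (matCoeff 0 X).det ≠ 0) : IsUnit X.det ∧ MatOrdGE 0 X⁻¹ := by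
  let P : Matrix ι ι (PowerSeries K') := X.map fun f => PowerSeries.mk fun n => f.coeff n
  have hP : P.map (HahnSeries.ofPowerSeries ℤ K') = X := by
    ext i j d
    simp only [P, Matrix.map_apply]
    rw [PowerSeries.coeff_coe]
    split_ifs with h
    · exact (hX i j d h).symm
    · rw [PowerSeries.coeff_mk]
      congr 1
      omega
  have hP0 : P.map PowerSeries.constantCoeff = matCoeff 0 X := by
    ext i j
    simp [P, matCoeff]
  have hunit : IsUnit P.det := by
    rw [PowerSeries.isUnit_iff_constantCoeff]
    have : PowerSeries.constantCoeff P.det = (matCoeff 0 X).det := by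
      rw [← hP0]
      exact RingHom.map_det _ _
    rw [this]
    exact hdet.isUnit
  have h1 : X * P⁻¹.map (HahnSeries.ofPowerSeries ℤ K') = 1 := by
    rw [← hP, ← Matrix.map_mul, Matrix.mul_nonsing_inv _ hunit]
    simp
  refine ⟨Matrix.isUnit_det_of_right_inverse h1, ?_⟩
  rw [Matrix.inv_eq_right_inv h1]
  exact fun i j => ordGE_coe _

lemma matCoeff_inv {X : Matrix ι ι (LaurentSeries K')} (hX : MatOrdGE 0 X)
    (hdet : (matCoeff 0 X).det ≠ 0) : matCoeff 0 X * matCoeff 0 X⁻¹ = 1 := by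
  obtain ⟨h1, h2⟩ := hX.inv hdet
  have := hX.matCoeff_mul h2
  rw [Matrix.mul_nonsing_inv _ h1, add_zero] at this
  rw [← this]
  ext i j
  by_cases h : i = j
  · subst h; simp [matCoeff]
  · simp [matCoeff, h]

end Series

/-! ### Coordinates, lattices and truncations -/

section Coordinates

variable {k K K' : Type*} [Field k] [Field K] [Field K'] [Algebra k K'] [Algebra K K']
variable {V : Type*} [AddCommGroup V] [Module (LaurentSeries K') V]
variable [Module K V] [IsScalarTower K (LaurentSeries K') V]
variable {ι : Type*}

lemma repr_K_smul (v : Module.Basis ι (LaurentSeries K') V) (c : K) (x : V) (i : ι) :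
    v.repr (c • x) i = c • v.repr x i := by
  rw [smul_eq_C_smul (K' := K') c x, map_smul, Finsupp.smul_apply, smul_eq_mul, C_mul_eq_smul]

variable (K) in
/-- The coefficient of `t^d v_i`. -/
def coef (v : Module.Basis ι (LaurentSeries K') V) (d : ℤ) (i : ι) : V →ₗ[K] K' where
  toFun x := (v.repr x i).coeff d
  map_add' x y := by simp
  map_smul' c x := by rw [repr_K_smul, HahnSeries.coeff_smul, RingHom.id_apply]

variable (K) in
/-- The map `c ↦ c t^d v_i`. -/
def incl (v : Module.Basis ι (LaurentSeries K') V) (d : ℤ) (i : ι) : K' →ₗ[K] V where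
  toFun c := (HahnSeries.single d c : LaurentSeries K') • v i
  map_add' x y := by
    rw [← add_smul]
    congr 1
    ext e
    by_cases h : e = d
    · subst h; simp
    · simp [HahnSeries.coeff_single_of_ne h]
  map_smul' c x := by
    rw [RingHom.id_apply, ← smul_assoc]
    congr 1
    ext e
    rw [HahnSeries.coeff_smul]
    by_cases h : e = d
    · subst h; simp
    · rw [HahnSeries.coeff_single_of_ne h, HahnSeries.coeff_single_of_ne h, smul_zero]

@[simp] lemma coef_apply (v : Module.Basis ι (LaurentSeries K') V) (d : ℤ) (i : ι) (x : V) :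
    coef K v d i x = (v.repr x i).coeff d := rfl

lemma repr_incl [DecidableEq ι] (v : Module.Basis ι (LaurentSeries K') V) (d : ℤ) (i j : ι)
    (c : K') : v.repr (incl K v d i c) j = if i = j then HahnSeries.single d c else 0 := by
  simp [incl, Finsupp.single_apply]

lemma ext_coef (v : Module.Basis ι (LaurentSeries K') V) {x y : V}
    (h : ∀ d i, (v.repr x i).coeff d = (v.repr y i).coeff d) : x = y := by
  refine v.repr.injective (Finsupp.ext fun i => ?_)
  ext d
  exact h d i

lemma coeff_single_eq (d e : ℤ) (c : K') :
    (HahnSeries.single d c : LaurentSeries K').coeff e = if e = d then c else 0 := by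
  split_ifs with h
  · subst h; simp
  · exact HahnSeries.coeff_single_of_ne h

variable [Fintype ι]

lemma repr_sum_smul (v : Module.Basis ι (LaurentSeries K') V) (g : ι → LaurentSeries K') (i : ι) :
    v.repr (∑ j, g j • v j) i = g i := congrFun (v.repr_sum_self g) i

lemma repr_trunc (v : Module.Basis ι (LaurentSeries K') V) (A : ℤ) (x : V) (i : ι) :
    v.repr (trunc K v A x) i = HahnSeries.truncLT A (v.repr x i) :=
  repr_sum_smul v (fun i => HahnSeries.truncLT A (v.repr x i)) i

@[simp] lemma coeff_trunc (v : Module.Basis ι (LaurentSeries K') V) (A : ℤ) (x : V) (i : ι)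
    (d : ℤ) : (v.repr (trunc K v A x) i).coeff d = if d < A then (v.repr x i).coeff d else 0 := by
  rw [repr_trunc, HahnSeries.coeff_truncLT]

variable (K) in
/-- The lattice `t^A V_O`. -/
def lat (v : Module.Basis ι (LaurentSeries K') V) (A : ℤ) : Submodule K V :=
  LinearMap.ker (trunc K v A)

lemma mem_lat {v : Module.Basis ι (LaurentSeries K') V} {A : ℤ} {x : V} :
    x ∈ lat K v A ↔ ∀ i, OrdGE A (v.repr x i) := by
  rw [lat, LinearMap.mem_ker]
  constructor
  · intro h i d hd
    have := coeff_trunc (K := K) v A x i d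
    rw [h, if_pos hd] at this
    simpa using this.symm
  · intro h
    refine ext_coef v fun d i => ?_
    rw [coeff_trunc]
    split_ifs with hd
    · simpa using h i d hd
    · simp

lemma latticeO_eq_lat (v : Module.Basis ι (LaurentSeries K') V) : latticeO K v = lat K v 0 := by
  ext x
  rw [mem_lat]
  rfl

lemma trunc_eq_zero {v : Module.Basis ι (LaurentSeries K') V} {A : ℤ} {x : V}
    (h : x ∈ lat K v A) : trunc K v A x = 0 := h

lemma lat_le {v : Module.Basis ι (LaurentSeries K') V} {A B : ℤ} (h : A ≤ B) :
    lat K v B ≤ lat K v A := fun x hx => by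
  rw [mem_lat] at *
  exact fun i => (hx i).mono h

lemma sub_trunc_mem_lat (v : Module.Basis ι (LaurentSeries K') V) (A : ℤ) (x : V) :
    x - trunc K v A x ∈ lat K v A := by
  rw [mem_lat]
  intro i d hd
  simp [hd]

lemma trunc_trunc (v : Module.Basis ι (LaurentSeries K') V) (A B : ℤ) (x : V) :
    trunc K v A (trunc K v B x) = trunc K v (min A B) x := by
  refine ext_coef v fun d i => ?_
  simp only [coeff_trunc, lt_min_iff]
  split_ifs <;> first | rfl | (exfalso; omega)

lemma exists_mem_lat (v : Module.Basis ι (LaurentSeries K') V) (x : V) :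
    ∃ A ≤ 0, x ∈ lat K v A := by
  choose A hA using fun i => exists_ordGE (v.repr x i)
  obtain ⟨B, hB⟩ := (Set.finite_range A).bddBelow
  refine ⟨min B 0, min_le_right _ _, mem_lat.mpr fun i => (hA i).mono ?_⟩
  exact (min_le_left _ _).trans (hB ⟨i, rfl⟩)

lemma eq_zero_of_forall_mem_lat {v : Module.Basis ι (LaurentSeries K') V} {x : V}
    (h : ∀ A, x ∈ lat K v A) : x = 0 := by
  refine ext_coef v fun d i => ?_
  simpa using mem_lat.mp (h (d + 1)) i d (by omega)

lemma smul_mem_lat {v : Module.Basis ι (LaurentSeries K') V} {A B D : ℤ} {f : LaurentSeries K'}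
    {x : V} (hf : OrdGE A f) (hx : x ∈ lat K v B) (h : D ≤ A + B) : f • x ∈ lat K v D := by
  rw [mem_lat] at *
  intro i
  rw [map_smul, Finsupp.smul_apply, smul_eq_mul]
  exact hf.mul' (hx i) h

lemma tpow_smul_mem_lat {v : Module.Basis ι (LaurentSeries K') V} {A j : ℤ} {x : V} :
    tpow K' j • x ∈ lat K v A ↔ x ∈ lat K v (A - j) := by
  simp only [mem_lat, map_smul, Finsupp.smul_apply, smul_eq_mul, ordGE_tpow_mul]

lemma trunc_tpow_smul (v : Module.Basis ι (LaurentSeries K') V) (A j : ℤ) (x : V) :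
    trunc K v A (tpow K' j • x) = tpow K' j • trunc K v (A - j) x := by
  refine ext_coef v fun d i => ?_
  simp only [coeff_trunc, map_smul, Finsupp.smul_apply, smul_eq_mul, coeff_tpow_mul]
  split_ifs <;> first | rfl | (exfalso; omega)

@[simp] lemma mulOp_apply (a : LaurentSeries K') (x : V) : mulOp K V a x = a • x := rfl

@[simp] lemma tau_apply (C : AbsFlatConn k K' V) (f : LaurentSeries K') (x : V) :
    tau K C f x = f⁻¹ • C.vert x := rfl

lemma proj_surjective (v : Module.Basis ι (LaurentSeries K') V) :
    Function.Surjective (proj K v) := Submodule.mkQ_surjective _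

@[simp] lemma sec_proj (v : Module.Basis ι (LaurentSeries K') V) (x : V) :
    sec K v (proj K v x) = trunc K v 0 x := rfl

lemma proj_eq_zero_iff {v : Module.Basis ι (LaurentSeries K') V} {x : V} :
    proj K v x = 0 ↔ x ∈ lat K v 0 := by
  rw [← latticeO_eq_lat]
  exact Submodule.Quotient.mk_eq_zero _

lemma proj_eq_proj_iff {v : Module.Basis ι (LaurentSeries K') V} {x y : V} :
    proj K v x = proj K v y ↔ x - y ∈ lat K v 0 := by
  rw [← proj_eq_zero_iff, map_sub, sub_eq_zero]

@[simp] lemma proj_trunc (v : Module.Basis ι (LaurentSeries K') V) (x : V) :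
    proj K v (trunc K v 0 x) = proj K v x := by
  rw [eq_comm, proj_eq_proj_iff]
  exact sub_trunc_mem_lat v 0 x

@[simp] lemma proj_sec (v : Module.Basis ι (LaurentSeries K') V) (x : Disc K v) :
    proj K v (sec K v x) = x := by
  obtain ⟨y, rfl⟩ := proj_surjective v x
  rw [sec_proj, proj_trunc]

lemma trunc_sec (v : Module.Basis ι (LaurentSeries K') V) (x : Disc K v) :
    trunc K v 0 (sec K v x) = sec K v x := by
  obtain ⟨y, rfl⟩ := proj_surjective v x
  rw [sec_proj, trunc_trunc, min_self]

variable (K) in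
/-- The operator with matrix `X`. -/
def mulMat (v : Module.Basis ι (LaurentSeries K') V) (X : Matrix ι ι (LaurentSeries K')) :
    Module.End K V where
  toFun x := ∑ i, (∑ j, X i j * v.repr x j) • v i
  map_add' x y := by simp [mul_add, Finset.sum_add_distrib, add_smul]
  map_smul' c x := by
    have h : ∀ f g : LaurentSeries K', f * (c • g) = c • (f * g) := by
      intro f g
      rw [← C_mul_eq_smul, ← C_mul_eq_smul, mul_left_comm]
    simp only [repr_K_smul, h, ← Finset.smul_sum, smul_assoc, RingHom.id_apply]

@[simp] lemma repr_mulMat (v : Module.Basis ι (LaurentSeries K') V)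
    (X : Matrix ι ι (LaurentSeries K')) (x : V) (i : ι) :
    v.repr (mulMat K v X x) i = ∑ j, X i j * v.repr x j :=
  repr_sum_smul v (fun i => ∑ j, X i j * v.repr x j) i

lemma mulMat_mul (v : Module.Basis ι (LaurentSeries K') V)
    (X Y : Matrix ι ι (LaurentSeries K')) (x : V) :
    mulMat K v (X * Y) x = mulMat K v X (mulMat K v Y x) := by
  refine ext_coef v fun d i => ?_
  simp only [repr_mulMat, Matrix.mul_apply, Finset.sum_mul, Finset.mul_sum]
  rw [Finset.sum_comm]
  simp only [mul_assoc]

lemma mulMat_one [DecidableEq ι] (v : Module.Basis ι (LaurentSeries K') V) (x : V) :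
    mulMat K v 1 x = x := by
  refine ext_coef v fun d i => ?_
  simp [Matrix.one_apply]

lemma mulMat_mem_lat {v : Module.Basis ι (LaurentSeries K') V} {A B D : ℤ}
    {X : Matrix ι ι (LaurentSeries K')} {x : V} (hX : MatOrdGE A X) (hx : x ∈ lat K v B)
    (h : D ≤ A + B) : mulMat K v X x ∈ lat K v D := by
  rw [mem_lat] at *
  intro i
  rw [repr_mulMat]
  exact ordGE_sum fun j _ => (hX i j).mul' (hx j) h

variable (K) in
/-- The derivation `∂_t` of the coordinates, i.e. `∇⁰(∂_t)`. -/
def derOp (v : Module.Basis ι (LaurentSeries K') V) : Module.End K V where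
  toFun x := ∑ i, ddt (v.repr x i) • v i
  map_add' x y := by simp [ddt_add, Finset.sum_add_distrib, add_smul]
  map_smul' c x := by
    have h : ∀ f : LaurentSeries K', ddt (c • f) = c • ddt f := by
      intro f
      ext d
      rw [coeff_ddt, HahnSeries.coeff_smul, HahnSeries.coeff_smul, coeff_ddt, mul_smul_comm]
    simp only [repr_K_smul, h, Finset.smul_sum, smul_assoc, RingHom.id_apply]

@[simp] lemma repr_derOp (v : Module.Basis ι (LaurentSeries K') V) (x : V) (i : ι) :
    v.repr (derOp K v x) i = ddt (v.repr x i) :=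
  repr_sum_smul v (fun i => ddt (v.repr x i)) i

lemma repr_vert (C : AbsFlatConn k K' V) (v : Module.Basis ι (LaurentSeries K') V) (x : V) (i : ι) :
    v.repr (C.vert x) i = ddt (v.repr x i) + ∑ j, (connForm C v).t i j * v.repr x j := by
  conv_lhs => rw [← v.sum_repr x]
  rw [map_sum, map_sum, Finsupp.finsetSum_apply]
  simp only [C.vert_leibniz, map_add, map_smul, Finsupp.add_apply, Finsupp.smul_apply, smul_eq_mul,
    Finset.sum_add_distrib, v.repr_self]
  congr 1
  · classical
    simp [Finsupp.single_apply]
  · exact Finset.sum_congr rfl fun j _ => mul_comm _ _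

lemma repr_hor (C : AbsFlatConn k K' V) (v : Module.Basis ι (LaurentSeries K') V)
    (θ : Derivation k K' K') (x : V) (i : ι) :
    v.repr (C.hor θ x) i = horDer θ (v.repr x i) + ∑ j, (connForm C v).x θ i j * v.repr x j := by
  conv_lhs => rw [← v.sum_repr x]
  rw [map_sum, map_sum, Finsupp.finsetSum_apply]
  simp only [C.hor_leibniz, map_add, map_smul, Finsupp.add_apply, Finsupp.smul_apply, smul_eq_mul,
    Finset.sum_add_distrib, v.repr_self]
  congr 1
  · classical
    simp [Finsupp.single_apply]
  · exact Finset.sum_congr rfl fun j _ => mul_comm _ _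

/-- The action of `θ` on the coordinates, i.e. `∇⁰(θ)`. -/
def horOp (v : Module.Basis ι (LaurentSeries K') V) (θ : Derivation k K' K') : V →+ V where
  toFun x := ∑ i, horDer θ (v.repr x i) • v i
  map_zero' := by
    have h : horDer θ (0 : LaurentSeries K') = 0 := by ext d; simp [coeff_horDer]
    simp [h]
  map_add' x y := by simp [horDer_add, Finset.sum_add_distrib, add_smul]

@[simp] lemma repr_horOp (v : Module.Basis ι (LaurentSeries K') V) (θ : Derivation k K' K') (x : V)
    (i : ι) : v.repr (horOp v θ x) i = horDer θ (v.repr x i) :=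
  repr_sum_smul v (fun i => horDer θ (v.repr x i)) i

lemma hor_eq (C : AbsFlatConn k K' V) (v : Module.Basis ι (LaurentSeries K') V)
    (θ : Derivation k K' K') (x : V) :
    C.hor θ x = horOp v θ x + mulMat K v ((connForm C v).x θ) x := by
  refine ext_coef v fun d i => ?_
  rw [repr_hor]
  simp

lemma horOp_trunc (v : Module.Basis ι (LaurentSeries K') V) (θ : Derivation k K' K') (A : ℤ)
    (x : V) : horOp v θ (trunc K v A x) = trunc K v A (horOp v θ x) := by
  refine ext_coef v fun d i => ?_
  simp only [repr_horOp, coeff_horDer, coeff_trunc]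
  split_ifs <;> simp

lemma horOp_mem_lat {v : Module.Basis ι (LaurentSeries K') V} (θ : Derivation k K' K') {A : ℤ}
    {x : V} (hx : x ∈ lat K v A) : horOp v θ x ∈ lat K v A := by
  rw [mem_lat] at *
  intro i
  rw [repr_horOp]
  exact (hx i).horDer θ

end Coordinates

/-! ### Admissible connections -/

section Admissible

variable {k K K' : Type*} [Field k] [Field K] [Field K'] [Algebra k K'] [Algebra K K']
variable {V : Type*} [AddCommGroup V] [Module (LaurentSeries K') V]
variable [Module K V] [IsScalarTower K (LaurentSeries K') V]
variable {ι : Type*} [Fintype ι]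
variable {C : AbsFlatConn k K' V} {v : Module.Basis ι (LaurentSeries K') V} {m : ℕ}

lemma basis_mem_lat (v : Module.Basis ι (LaurentSeries K') V) (j : ι) : v j ∈ lat K v 0 := by
  classical
  rw [mem_lat]
  intro i d hd
  rw [v.repr_self, Finsupp.single_apply]
  split_ifs
  · simp [HahnSeries.coeff_one, hd.ne]
  · simp

lemma repr_tpow_smul_vert (C : AbsFlatConn k K' V) (v : Module.Basis ι (LaurentSeries K') V) (m : ℕ)
    (x : V) (i : ι) : v.repr (tpow K' m • C.vert x) i =
      tpow K' m * ddt (v.repr x i) + ∑ j, gMat C v m i j * v.repr x j := by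
  rw [map_smul, Finsupp.smul_apply, smul_eq_mul, repr_vert, mul_add, Finset.mul_sum]
  simp [gMat, mul_assoc]

lemma IsAdmissible.ordGE_gMat (h : IsAdmissible K C v m) : MatOrdGE 0 (gMat C v m) := by
  intro i j
  have h1 : tpow K' m • C.vert (v j) ∈ lat K v 0 := by
    rw [← latticeO_eq_lat]
    exact h.1.mapsTo (by rw [latticeO_eq_lat]; exact basis_mem_lat v j)
  have h2 := mem_lat.mp h1 i
  rw [map_smul, Finsupp.smul_apply, smul_eq_mul] at h2
  exact h2

lemma IsAdmissible.ordGE_connForm (h : IsAdmissible K C v m) (θ : Derivation k K' K') :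
    MatOrdGE (1 - (m : ℤ)) ((connForm C v).x θ) := by
  intro i j
  have h1 : tpow K' ((m : ℤ) - 1) • C.hor θ (v j) ∈ lat K v 0 := by
    rw [← latticeO_eq_lat]
    exact h.2 θ (by rw [latticeO_eq_lat]; exact basis_mem_lat v j)
  have h2 := mem_lat.mp (tpow_smul_mem_lat.mp h1) i
  rw [show (0 : ℤ) - ((m : ℤ) - 1) = 1 - m by ring] at h2
  exact h2

/-- For `m ≥ 2` the term `t^m ∂_t` raises the degree, so that `t^m ∇(∂_t)` acts on leading
coefficients by `g₀`. -/
lemma IsAdmissible.mem_lat_and_coeff (h : IsAdmissible K C v m) (hm : 2 ≤ m) {A : ℤ} {x : V}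
    (hx : x ∈ lat K v A) : tpow K' m • C.vert x ∈ lat K v A ∧
      ∀ i, (v.repr (tpow K' m • C.vert x) i).coeff A =
        ∑ j, gMatZero C v m i j * (v.repr x j).coeff A := by
  rw [mem_lat] at hx
  have hd : ∀ i, OrdGE (A + 1) (tpow K' m * ddt (v.repr x i)) := fun i =>
    ordGE_tpow_mul.mpr ((hx i).ddt.mono (by omega))
  refine ⟨mem_lat.mpr fun i => ?_, fun i => ?_⟩
  · rw [repr_tpow_smul_vert]
    exact ((hd i).mono (by omega)).add
      (ordGE_sum fun j _ => (h.ordGE_gMat i j).mul' (hx j) (by omega))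
  · rw [repr_tpow_smul_vert, HahnSeries.coeff_add, hd i A (by omega), zero_add,
      HahnSeries.coeff_sum]
    exact Finset.sum_congr rfl fun j _ => (h.ordGE_gMat i j).coeff_mul' (hx j) (by omega)

/-- The constant term `g₀` is invertible since constant terms of vectors in `V_O` are all attained. -/
lemma IsAdmissible.isUnit_det [DecidableEq ι] (h : IsAdmissible K C v m) (hm : 2 ≤ m) :
    IsUnit (gMatZero C v m).det := by
  rw [← Matrix.isUnit_iff_isUnit_det, ← Matrix.mulVec_surjective_iff_isUnit]
  intro w
  let y : V := ∑ i, (HahnSeries.C (w i) : LaurentSeries K') • v i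
  have hy : y ∈ latticeO K v := by
    intro i d hd
    rw [repr_sum_smul]
    exact HahnSeries.coeff_single_of_ne hd.ne
  obtain ⟨x, hx, hxy⟩ := h.1.surjOn hy
  rw [SetLike.mem_coe, latticeO_eq_lat] at hx
  have h1 := (h.mem_lat_and_coeff hm hx).2
  refine ⟨fun j => (v.repr x j).coeff 0, funext fun i => ?_⟩
  have h2 := h1 i
  have hxy' : tpow K' m • C.vert x = y := hxy
  rw [hxy', repr_sum_smul] at h2
  simpa [Matrix.mulVec, dotProduct] using h2.symm

/-- `t^m ∇(∂_t)` preserves the degree of the leading term, since `g₀` is injective. -/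
lemma IsAdmissible.mem_lat_iff (h : IsAdmissible K C v m) (hm : 2 ≤ m) {A : ℤ} {x : V} :
    tpow K' m • C.vert x ∈ lat K v A ↔ x ∈ lat K v A := by
  classical
  refine ⟨fun hS => ?_, fun hx => (h.mem_lat_and_coeff hm hx).1⟩
  obtain ⟨B, -, hB⟩ := exists_mem_lat (K := K) v x
  have key : ∀ D, B ≤ D → D ≤ A → x ∈ lat K v D := by
    intro D hBD
    induction D, hBD using Int.leInduction with
    | base => exact fun _ => hB
    | succ D hBD ih =>
      intro hDA
      have hD := ih (by omega)
      have h1 := (h.mem_lat_and_coeff hm hD).2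
      have h2 : (gMatZero C v m).mulVec (fun j => (v.repr x j).coeff D) = 0 := by
        funext i
        have h3 := h1 i
        rw [mem_lat.mp hS i D (by omega)] at h3
        simpa [Matrix.mulVec, dotProduct] using h3.symm
      have h3 := Matrix.eq_zero_of_mulVec_eq_zero (h.isUnit_det hm).ne_zero h2
      rw [mem_lat] at hD ⊢
      intro i d hd
      rcases eq_or_lt_of_le (Int.lt_add_one_iff.mp hd) with rfl | hd'
      · exact congrFun h3 i
      · exact hD i d hd'
  rcases le_total A B with hAB | hAB
  · exact lat_le hAB hB
  · exact key A hAB le_rfl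

/-- Surjectivity onto `t^(-n) V_O` follows from that onto `V_O` by removing leading terms, which are in
the image because `g₀` is surjective. -/
lemma IsAdmissible.bijective (h : IsAdmissible K C v m) (hm : 2 ≤ m) :
    Function.Bijective fun x => tpow K' m • C.vert x := by
  classical
  constructor
  · intro x y hxy
    rw [← sub_eq_zero]
    refine eq_zero_of_forall_mem_lat (K := K) (v := v) fun A => ?_
    rw [← h.mem_lat_iff hm, map_sub, smul_sub, sub_eq_zero.mpr hxy]
    exact Submodule.zero_mem _
  · have key : ∀ n : ℕ, ∀ y ∈ lat K v (-(n : ℤ)), ∃ x, tpow K' m • C.vert x = y := by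
      intro n
      induction n with
      | zero =>
        intro y hy
        obtain ⟨x, -, hx⟩ := h.1.surjOn (show y ∈ (latticeO K v : Set V) by
          rw [latticeO_eq_lat]; simpa using hy)
        exact ⟨x, hx⟩
      | succ n ih =>
        intro y hy
        obtain ⟨c, hc⟩ := (Matrix.mulVec_surjective_iff_isUnit.mpr
          ((Matrix.isUnit_iff_isUnit_det _).mpr (h.isUnit_det hm)))
          fun i => (v.repr y i).coeff (-((n + 1 : ℕ) : ℤ))
        let x₁ : V := ∑ i, (HahnSeries.single (-((n + 1 : ℕ) : ℤ)) (c i) : LaurentSeries K') • v i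
        have hx₁ : x₁ ∈ lat K v (-((n + 1 : ℕ) : ℤ)) := by
          rw [mem_lat]
          intro i d hd
          rw [repr_sum_smul]
          exact HahnSeries.coeff_single_of_ne hd.ne
        obtain ⟨h1, h2⟩ := h.mem_lat_and_coeff hm hx₁
        have h3 : y - tpow K' m • C.vert x₁ ∈ lat K v (-(n : ℤ)) := by
          have h4 := mem_lat.mp (Submodule.sub_mem _ hy h1)
          rw [mem_lat]
          intro i d hd
          rcases eq_or_lt_of_le (show d ≤ -(n : ℤ) - 1 by omega) with hd' | hd'
          · have hd'' : d = -((n + 1 : ℕ) : ℤ) := by push_cast; omega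
            rw [hd'', map_sub, Finsupp.sub_apply, HahnSeries.coeff_sub, h2 i]
            have h5 := congrFun hc i
            simp only [Matrix.mulVec, dotProduct] at h5
            rw [← h5, sub_eq_zero]
            refine Finset.sum_congr rfl fun j _ => ?_
            rw [repr_sum_smul, HahnSeries.coeff_single_same]
          · exact h4 i d (by push_cast; omega)
        obtain ⟨x₂, hx₂⟩ := ih _ h3
        exact ⟨x₁ + x₂, by rw [map_add, smul_add, hx₂]; abel⟩
    intro y
    obtain ⟨A, hA, hy⟩ := exists_mem_lat (K := K) v y
    obtain ⟨n, rfl⟩ := Int.exists_eq_neg_ofNat hA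
    exact key n y hy

section Tau

variable {ℓ : ℤ} {u : (PowerSeries K')ˣ} {f : LaurentSeries K'}

lemma tau_eq (C : AbsFlatConn k K' V) (m : ℕ)
    (hf : f = ((u : PowerSeries K') : LaurentSeries K') * tpow K' ℓ) (x : V) :
    tau K C f x = (((u : PowerSeries K') : LaurentSeries K')⁻¹ * tpow K' (-(ℓ + m))) •
      (tpow K' m • C.vert x) := by
  rw [tau_apply, smul_smul, mul_assoc, ← tpow_add, hf, mul_inv, tpow_inv]
  congr 3
  ring

/-- `∇(τ_ν)` maps `t^A V_O` onto `t^(A - ℓ - m) V_O`. -/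
lemma IsAdmissible.tau_mem_lat_iff (h : IsAdmissible K C v m) (hm : 2 ≤ m)
    (hf : f = ((u : PowerSeries K') : LaurentSeries K') * tpow K' ℓ) {A : ℤ} {x : V} :
    tau K C f x ∈ lat K v (A - (ℓ + m)) ↔ x ∈ lat K v A := by
  rw [← h.mem_lat_iff hm (A := A) (x := x), tau_eq C m hf, mul_comm, mul_smul, tpow_smul_mem_lat]
  rw [show A - (ℓ + m) - -(ℓ + m) = A by ring]
  constructor
  · intro h1
    have := smul_mem_lat (ordGE_coe (u : PowerSeries K')) h1 (D := A) (by omega)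
    rwa [smul_smul, mul_inv_cancel₀ (coe_unit_ne_zero u), one_smul] at this
  · exact fun h1 => smul_mem_lat (ordGE_coe_unit_inv u) h1 (by omega)

lemma IsAdmissible.tau_bijective (h : IsAdmissible K C v m) (hm : 2 ≤ m)
    (hf : f = ((u : PowerSeries K') : LaurentSeries K') * tpow K' ℓ) :
    Function.Bijective (tau K C f) := by
  have hw : ((u : PowerSeries K') : LaurentSeries K')⁻¹ * tpow K' (-(ℓ + m)) ≠ 0 :=
    mul_ne_zero (inv_ne_zero (coe_unit_ne_zero u)) (tpow_ne_zero _)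
  have h1 : Function.Bijective fun x : V =>
      (((u : PowerSeries K') : LaurentSeries K')⁻¹ * tpow K' (-(ℓ + m))) • x := by
    refine ⟨fun x y hxy => smul_right_injective _ hw hxy, fun y => ⟨_, smul_inv_smul₀ hw y⟩⟩
  have h2 := h1.comp (h.bijective hm)
  have h3 : (tau K C f : V → V) = (fun x : V =>
      (((u : PowerSeries K') : LaurentSeries K')⁻¹ * tpow K' (-(ℓ + m))) • x) ∘
      fun x => tpow K' m • C.vert x := funext fun x => tau_eq C m hf x
  rw [h3]
  exact h2

/-- `∇(τ_ν)` as an automorphism of `V`. -/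
def tauE (h : IsAdmissible K C v m) (hm : 2 ≤ m)
    (hf : f = ((u : PowerSeries K') : LaurentSeries K') * tpow K' ℓ) : V ≃ₗ[K] V :=
  LinearEquiv.ofBijective (tau K C f) (h.tau_bijective hm hf)

@[simp] lemma tauE_apply (h : IsAdmissible K C v m) (hm : 2 ≤ m)
    (hf : f = ((u : PowerSeries K') : LaurentSeries K') * tpow K' ℓ) (x : V) :
    tauE h hm hf x = tau K C f x := rfl

end Tau

end Admissible

/-! ### Windows of degrees -/

section Window

variable {K K' : Type*} [Field K] [Field K'] [Algebra K K']
variable {V : Type*} [AddCommGroup V] [Module (LaurentSeries K') V]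
variable [Module K V] [IsScalarTower K (LaurentSeries K') V]
variable {ι : Type*} [Fintype ι]

variable (K) in
/-- The coefficient of `t^d`, with values in `V_{K'} = K'^ι`. -/
def coefVec (v : Module.Basis ι (LaurentSeries K') V) (d : ℤ) : V →ₗ[K] (ι → K') :=
  LinearMap.pi fun i => coef K v d i

variable (K) in
/-- The map `y ↦ t^d y` from `V_{K'}` to `V`. -/
def inclVec (v : Module.Basis ι (LaurentSeries K') V) (d : ℤ) : (ι → K') →ₗ[K] V :=
  ∑ i, incl K v d i ∘ₗ LinearMap.proj i

@[simp] lemma coefVec_apply (v : Module.Basis ι (LaurentSeries K') V) (d : ℤ) (x : V) (i : ι) :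
    coefVec K v d x i = (v.repr x i).coeff d := rfl

lemma tpow_smul_constVec (v : Module.Basis ι (LaurentSeries K') V) (d : ℤ) (y : ι → K') :
    tpow K' d • constVec v y = inclVec K v d y := by
  simp only [constVec, inclVec, Finset.smul_sum, LinearMap.sum_apply, LinearMap.comp_apply,
    LinearMap.proj_apply]
  refine Finset.sum_congr rfl fun i _ => ?_
  rw [smul_smul, mul_comm]
  change _ = (HahnSeries.single d (y i) : LaurentSeries K') • v i
  congr 1
  ext e
  rw [coeff_C_mul, tpow, coeff_single_eq, coeff_single_eq]
  split_ifs <;> simp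

@[simp] lemma coeff_inclVec (v : Module.Basis ι (LaurentSeries K') V) (d : ℤ) (y : ι → K') (i : ι)
    (e : ℤ) : (v.repr (inclVec K v d y) i).coeff e = if e = d then y i else 0 := by
  classical
  simp only [inclVec, LinearMap.sum_apply, LinearMap.comp_apply, LinearMap.proj_apply, map_sum,
    Finsupp.finsetSum_apply, repr_incl, Finset.sum_ite_eq', Finset.mem_univ, if_true]
  exact coeff_single_eq _ _ _

lemma coefVec_inclVec (v : Module.Basis ι (LaurentSeries K') V) (d e : ℤ) (y : ι → K') :
    coefVec K v d (inclVec K v e y) = if d = e then y else 0 := by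
  funext i
  rw [coefVec_apply, coeff_inclVec]
  split_ifs <;> rfl

lemma inclVec_mem_lat {v : Module.Basis ι (LaurentSeries K') V} {d A : ℤ} (h : A ≤ d)
    (y : ι → K') : inclVec K v d y ∈ lat K v A := by
  rw [mem_lat]
  intro i e he
  rw [coeff_inclVec, if_neg (by omega)]

variable {r w : ℕ}

/-- The span of the vectors `t^(deg j) e_i`, with its coordinates. -/
def win (v : Module.Basis ι (LaurentSeries K') V) (e : Module.Basis (Fin r) K (ι → K'))
    (deg : Fin w → ℤ) : (Fin (w * r) → K) →ₗ[K] V :=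
  ∑ j : Fin w, ∑ i : Fin r,
    (LinearMap.proj (finProdFinEquiv (j, i))).smulRight (inclVec K v (deg j) (e i))

/-- The coordinates of the components of degrees `deg j` in the basis `e`. -/
def winCoord (v : Module.Basis ι (LaurentSeries K') V) (e : Module.Basis (Fin r) K (ι → K'))
    (deg : Fin w → ℤ) : V →ₗ[K] (Fin (w * r) → K) :=
  LinearMap.pi fun p => e.coord (finProdFinEquiv.symm p).2 ∘ₗ
    coefVec K v (deg (finProdFinEquiv.symm p).1)

variable {v : Module.Basis ι (LaurentSeries K') V} {e e' : Module.Basis (Fin r) K (ι → K')}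
  {deg : Fin w → ℤ}

lemma win_apply (c : Fin (w * r) → K) : win v e deg c =
    ∑ j, inclVec K v (deg j) (∑ i, c (finProdFinEquiv (j, i)) • e i) := by
  simp [win]

lemma winCoord_apply (x : V) (j : Fin w) (i : Fin r) :
    winCoord v e deg x (finProdFinEquiv (j, i)) = e.repr (coefVec K v (deg j) x) i := by
  simp only [winCoord, LinearMap.pi_apply, Equiv.symm_apply_apply, LinearMap.comp_apply,
    Module.Basis.coord_apply]

lemma win_winCoord (x : V) : win v e deg (winCoord v e deg x) =
    ∑ j, inclVec K v (deg j) (coefVec K v (deg j) x) := by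
  rw [win_apply]
  simp only [winCoord_apply, e.sum_repr]

lemma coefVec_win (hdeg : Function.Injective deg) (c : Fin (w * r) → K) (j : Fin w) :
    coefVec K v (deg j) (win v e deg c) = ∑ i, c (finProdFinEquiv (j, i)) • e i := by
  rw [win_apply, map_sum]
  simp only [coefVec_inclVec, hdeg.eq_iff]
  simp

lemma win_mem_lat {A : ℤ} (h : ∀ j, A ≤ deg j) (c : Fin (w * r) → K) :
    win v e deg c ∈ lat K v A := by
  rw [win_apply]
  exact Submodule.sum_mem _ fun j _ => inclVec_mem_lat (h j) _

lemma winCoord_eq_zero {x : V} (h : ∀ j, coefVec K v (deg j) x = 0) : winCoord v e deg x = 0 := by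
  funext p
  obtain ⟨⟨j, i⟩, rfl⟩ := finProdFinEquiv.surjective p
  rw [winCoord_apply, h]
  simp

lemma winCoord_win (hdeg : Function.Injective deg) (c : Fin (w * r) → K) :
    winCoord v e deg (win v e' deg c) = Matrix.toLin' (Matrix.submatrix
      (Matrix.kroneckerMap (· * ·) (1 : Matrix (Fin w) (Fin w) K) (e.toMatrix e'))
      finProdFinEquiv.symm finProdFinEquiv.symm) c := by
  funext p
  obtain ⟨⟨j, i⟩, rfl⟩ := finProdFinEquiv.surjective p
  rw [winCoord_apply, coefVec_win hdeg, Matrix.toLin'_apply, Matrix.mulVec, dotProduct,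
    ← finProdFinEquiv.sum_comp, Fintype.sum_prod_type]
  simp [Matrix.one_apply, Module.Basis.toMatrix_apply, mul_comm, Finset.sum_ite_eq]

lemma winCoord_win_self (hdeg : Function.Injective deg) (c : Fin (w * r) → K) :
    winCoord v e deg (win v e deg c) = c := by
  rw [winCoord_win hdeg, Module.Basis.toMatrix_self, Matrix.kroneckerMap_one_one _ (by simp)
    (by simp) (by simp)]
  simp

/-- Change of basis in a window of `w` degrees has determinant `det(e, e')^w`. -/
lemma det_winCoord_win (hdeg : Function.Injective deg) :
    LinearMap.det (winCoord v e deg ∘ₗ win v e' deg) = e.det e' ^ w := by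
  have : winCoord v e deg ∘ₗ win v e' deg = Matrix.toLin' (Matrix.submatrix
      (Matrix.kroneckerMap (· * ·) (1 : Matrix (Fin w) (Fin w) K) (e.toMatrix e'))
      finProdFinEquiv.symm finProdFinEquiv.symm) := LinearMap.ext fun c => winCoord_win hdeg c
  rw [this, LinearMap.det_toLin', Matrix.det_submatrix_equiv_self, Matrix.det_kronecker]
  simp [Module.Basis.det_apply]

lemma fdet_id_prodMap {P : Type*} [AddCommGroup P] [Module K P] {n : ℕ}
    (h : Module.End K (P × (Fin n → K))) (g : Module.End K (Fin n → K))
    (hg : ∀ x c, h (x, c) = (x, g c)) : fdet h = LinearMap.det g := by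
  rw [fdet_eq_of_summand (finiteRank_of_finite_left (g - 1)) (LinearMap.inr K P _)
    (LinearMap.snd K P _) (fun x => rfl) (fun ⟨x, c⟩ => ?_), fdet_eq_det]
  rw [hg]
  simp

end Window

/-! ### The frames of `β` -/

section BetaFrame

variable {K K' : Type*} [Field K] [Field K'] [Algebra K K']
variable {V : Type*} [AddCommGroup V] [Module (LaurentSeries K') V]
variable [Module K V] [IsScalarTower K (LaurentSeries K') V]
variable {ι : Type*} [Fintype ι]
variable {v : Module.Basis ι (LaurentSeries K') V} {T : V ≃ₗ[K] V} {N : ℤ} {r : ℕ}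

/-- The degrees `0, …, -N - 1` of `V_O / t^(-N) V_O`, for `N < 0`. -/
def degPos (N : ℤ) (j : Fin (-N).toNat) : ℤ := j

/-- The degrees `-1, …, -N` of `t^(-N) V_O / V_O`, for `N > 0`. -/
def degNeg (N : ℤ) (j : Fin N.toNat) : ℤ := -(j : ℤ) - 1

lemma degPos_injective : Function.Injective (degPos N) := fun i j h => by
  simp only [degPos] at h
  exact Fin.ext (by omega)

lemma degNeg_injective : Function.Injective (degNeg N) := fun i j h => by
  simp only [degNeg] at h
  exact Fin.ext (by omega)

/-- The embedding of `V / V_O ⊕ K^{(-N) r}` in `V`. -/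
def tgt (v : Module.Basis ι (LaurentSeries K') V) (N : ℤ) (e : Module.Basis (Fin r) K (ι → K')) :
    (Disc K v × (Fin ((-N).toNat * r) → K)) →ₗ[K] V :=
  (sec K v).coprod (win v e (degPos N))

/-- The projection of `V` on `V / V_O ⊕ K^{(-N) r}`. -/
def tgtInv (v : Module.Basis ι (LaurentSeries K') V) (N : ℤ)
    (e : Module.Basis (Fin r) K (ι → K')) :
    V →ₗ[K] (Disc K v × (Fin ((-N).toNat * r) → K)) :=
  (proj K v).prod (winCoord v e (degPos N))

/-- The embedding of `V / V_O ⊕ K^{N r}` in `V` defined by the operator `T`. -/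
def src (v : Module.Basis ι (LaurentSeries K') V) (T : V ≃ₗ[K] V) (N : ℤ)
    (e : Module.Basis (Fin r) K (ι → K')) :
    (Disc K v × (Fin (N.toNat * r) → K)) →ₗ[K] V :=
  (trunc K v (-N) ∘ₗ T.toLinearMap ∘ₗ sec K v).coprod (win v e (degNeg N))

/-- The projection of `V` on `V / V_O ⊕ K^{N r}` defined by the operator `T`. -/
def srcInv (v : Module.Basis ι (LaurentSeries K') V) (T : V ≃ₗ[K] V) (N : ℤ)
    (e : Module.Basis (Fin r) K (ι → K')) :
    V →ₗ[K] (Disc K v × (Fin (N.toNat * r) → K)) :=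
  (proj K v ∘ₗ T.symm.toLinearMap ∘ₗ trunc K v (-N)).prod (winCoord v e (degNeg N))

variable (hT : ∀ x, T x ∈ lat K v (-N) ↔ x ∈ lat K v 0)
  (e e' : Module.Basis (Fin r) K (ι → K'))

lemma tgt_apply (y : Disc K v) (c : Fin ((-N).toNat * r) → K) :
    tgt v N e (y, c) = sec K v y + win v e (degPos N) c := rfl

lemma tgtInv_apply (x : V) : tgtInv v N e x = (proj K v x, winCoord v e (degPos N) x) := rfl

lemma src_apply (y : Disc K v) (c : Fin (N.toNat * r) → K) :
    src v T N e (y, c) = trunc K v (-N) (T (sec K v y)) + win v e (degNeg N) c := rfl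

lemma srcInv_apply (x : V) : srcInv v T N e x =
    (proj K v (T.symm (trunc K v (-N) x)), winCoord v e (degNeg N) x) := rfl

lemma coefVec_trunc_of_le {A d : ℤ} (h : A ≤ d) (x : V) : coefVec K v d (trunc K v A x) = 0 := by
  funext i
  rw [coefVec_apply, coeff_trunc, if_neg (by omega)]
  rfl

include hT in
lemma trunc_map_trunc (x : V) : trunc K v (-N) (T (trunc K v 0 x)) = trunc K v (-N) (T x) := by
  rw [eq_comm, ← sub_eq_zero, ← map_sub, ← map_sub]
  exact trunc_eq_zero ((hT _).mpr (sub_trunc_mem_lat v 0 x))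

include hT in
lemma proj_symm_trunc_map (x : V) : proj K v (T.symm (trunc K v (-N) (T x))) = proj K v x := by
  rw [proj_eq_proj_iff, ← hT, map_sub, T.apply_symm_apply, ← neg_sub]
  exact Submodule.neg_mem _ (sub_trunc_mem_lat v _ _)

lemma tgtInv_tgt_apply (p : Disc K v × (Fin ((-N).toNat * r) → K)) :
    tgtInv v N e (tgt v N e' p) = (p.1, winCoord v e (degPos N) (win v e' (degPos N) p.2)) := by
  obtain ⟨y, c⟩ := p
  have h1 : proj K v (win v e' (degPos N) c) = 0 :=
    proj_eq_zero_iff.mpr (win_mem_lat (fun j => by simp [degPos]) c)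
  have h2 : winCoord v e (degPos N) (sec K v y) = 0 := winCoord_eq_zero fun j => by
    rw [← trunc_sec, coefVec_trunc_of_le (by simp [degPos])]
  rw [tgt_apply, tgtInv_apply, map_add, map_add, h1, h2, proj_sec, add_zero, zero_add]

lemma tgtInv_tgt (p : Disc K v × (Fin ((-N).toNat * r) → K)) :
    tgtInv v N e (tgt v N e p) = p := by
  rw [tgtInv_tgt_apply, winCoord_win_self degPos_injective]

lemma sum_degPos (d : ℤ) (y : K') : (∑ j, if d = degPos N j then y else 0) =
    if 0 ≤ d ∧ d < -N then y else 0 := by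
  split_ifs with h
  · rw [Finset.sum_eq_single (⟨d.toNat, by omega⟩ : Fin (-N).toNat)]
    · rw [if_pos]
      simp [degPos, h.1]
    · intro j _ hj
      rw [if_neg]
      intro hd
      apply hj
      simp only [degPos] at hd
      exact Fin.ext (by simp; omega)
    · simp
  · refine Finset.sum_eq_zero fun j _ => if_neg ?_
    intro hd
    simp only [degPos] at hd
    omega

lemma sum_degNeg (d : ℤ) (y : K') : (∑ j, if d = degNeg N j then y else 0) =
    if -N ≤ d ∧ d < 0 then y else 0 := by
  split_ifs with h
  · rw [Finset.sum_eq_single (⟨(-d - 1).toNat, by omega⟩ : Fin N.toNat)]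
    · rw [if_pos]
      simp only [degNeg]
      omega
    · intro j _ hj
      rw [if_neg]
      intro hd
      apply hj
      simp only [degNeg] at hd
      exact Fin.ext (by simp; omega)
    · simp
  · refine Finset.sum_eq_zero fun j _ => if_neg ?_
    intro hd
    simp only [degNeg] at hd
    omega

lemma tgt_tgtInv (x : V) : tgt v N e (tgtInv v N e x) = trunc K v (max 0 (-N)) x := by
  rw [tgtInv_apply, tgt_apply, sec_proj, win_winCoord]
  refine ext_coef v fun d i => ?_
  rw [map_add, Finsupp.add_apply, HahnSeries.coeff_add, coeff_trunc, coeff_trunc, map_sum,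
    Finsupp.finsetSum_apply, HahnSeries.coeff_sum]
  have h : ∀ j : Fin (-N).toNat, (v.repr (inclVec K v (degPos N j)
      (coefVec K v (degPos N j) x)) i).coeff d =
      if d = degPos N j then (v.repr x i).coeff d else 0 := by
    intro j
    rw [coeff_inclVec]
    split_ifs with h
    · rw [h]; rfl
    · rfl
  simp only [h, sum_degPos]
  split_ifs <;> first | (exfalso; omega) | simp

lemma sum_window_degNeg (x : V) :
    trunc K v (-N) x + ∑ j, inclVec K v (degNeg N j) (coefVec K v (degNeg N j) x) =
      trunc K v (max 0 (-N)) x := by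
  refine ext_coef v fun d i => ?_
  rw [map_add, Finsupp.add_apply, HahnSeries.coeff_add, coeff_trunc, coeff_trunc, map_sum,
    Finsupp.finsetSum_apply, HahnSeries.coeff_sum]
  have h : ∀ j : Fin N.toNat, (v.repr (inclVec K v (degNeg N j)
      (coefVec K v (degNeg N j) x)) i).coeff d =
      if d = degNeg N j then (v.repr x i).coeff d else 0 := by
    intro j
    rw [coeff_inclVec]
    split_ifs with h
    · rw [h]; rfl
    · rfl
  simp only [h, sum_degNeg]
  split_ifs <;> first | (exfalso; omega) | simp

lemma degNeg_ge (j : Fin N.toNat) : -N ≤ degNeg N j := by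
  simp only [degNeg]
  omega

include hT in
lemma srcInv_src_apply (p : Disc K v × (Fin (N.toNat * r) → K)) :
    srcInv v T N e (src v T N e' p) =
      (p.1, winCoord v e (degNeg N) (win v e' (degNeg N) p.2)) := by
  obtain ⟨y, c⟩ := p
  have h1 : trunc K v (-N) (win v e' (degNeg N) c) = 0 :=
    trunc_eq_zero (win_mem_lat degNeg_ge c)
  have h2 : winCoord v e (degNeg N) (trunc K v (-N) (T (sec K v y))) = 0 :=
    winCoord_eq_zero fun j => coefVec_trunc_of_le (degNeg_ge j) _
  rw [src_apply, srcInv_apply, map_add (trunc K v (-N)), map_add (winCoord v e (degNeg N)), h1, h2,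
    trunc_trunc, min_self, add_zero, zero_add, proj_symm_trunc_map hT, proj_sec]

include hT in
lemma srcInv_src (p : Disc K v × (Fin (N.toNat * r) → K)) :
    srcInv v T N e (src v T N e p) = p := by
  rw [srcInv_src_apply hT, winCoord_win_self degNeg_injective]

include hT in
lemma src_srcInv (x : V) : src v T N e (srcInv v T N e x) = trunc K v (max 0 (-N)) x := by
  rw [srcInv_apply, src_apply, sec_proj, win_winCoord, trunc_map_trunc hT, T.apply_symm_apply,
    trunc_trunc, min_self, sum_window_degNeg]

/-- The isomorphism of the frame of `β` at the basis `e`. -/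
def betaIso : (Disc K v × (Fin (N.toNat * r) → K)) ≃ₗ[K]
    (Disc K v × (Fin ((-N).toNat * r) → K)) :=
  LinearEquiv.ofLinearMap (tgtInv v N e ∘ₗ src v T N e) (srcInv v T N e ∘ₗ tgt v N e)
    (by
      refine LinearMap.ext fun p => ?_
      have h := src_srcInv hT e (tgt v N e p)
      rw [← tgt_tgtInv e, tgtInv_tgt] at h
      change tgtInv v N e (src v T N e (srcInv v T N e (tgt v N e p))) = p
      rw [h, tgtInv_tgt])
    (by
      refine LinearMap.ext fun p => ?_
      have h := tgt_tgtInv (v := v) (N := N) e (src v T N e p)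
      rw [← src_srcInv hT e, srcInv_src hT] at h
      change srcInv v T N e (tgt v N e (tgtInv v N e (src v T N e p))) = p
      rw [h, srcInv_src hT])

lemma betaIso_apply (p : Disc K v × (Fin (N.toNat * r) → K)) :
    betaIso hT e p = tgtInv v N e (src v T N e p) := rfl

lemma betaIso_symm_apply (p : Disc K v × (Fin ((-N).toNat * r) → K)) :
    (betaIso hT e).symm p = srcInv v T N e (tgt v N e p) := rfl

lemma tgt_betaIso (p : Disc K v × (Fin (N.toNat * r) → K)) :
    tgt v N e (betaIso hT e p) = src v T N e p := by
  rw [betaIso_apply, tgt_tgtInv, ← src_srcInv hT e, srcInv_src hT]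

lemma trunc_max_tgt (p : Disc K v × (Fin ((-N).toNat * r) → K)) :
    trunc K v (max 0 (-N)) (tgt v N e p) = tgt v N e p := by
  rw [← tgt_tgtInv e, tgtInv_tgt]

/-- A window of finitely many degrees is finite-dimensional. -/
lemma finiteRank_trunc_sub_trunc [FiniteDimensional K K'] (v : Module.Basis ι (LaurentSeries K') V)
    (A B : ℤ) : FiniteRank (trunc K v B - trunc K v A) := by
  have h : trunc K v B - trunc K v A = ∑ d ∈ Finset.Ico A B, inclVec K v d ∘ₗ coefVec K v d -
      ∑ d ∈ Finset.Ico B A, inclVec K v d ∘ₗ coefVec K v d := by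
    refine LinearMap.ext fun x => ext_coef v fun d i => ?_
    simp only [LinearMap.sub_apply, LinearMap.sum_apply, LinearMap.comp_apply, map_sub, map_sum,
      Finsupp.sub_apply, Finsupp.finsetSum_apply, HahnSeries.coeff_sub, HahnSeries.coeff_sum,
      coeff_trunc, coeff_inclVec, coefVec_apply, Finset.sum_ite_eq, Finset.mem_Ico]
    split_ifs <;> first | (exfalso; omega) | simp
  rw [h]
  exact (FiniteRank.sum fun d _ => (finiteRank_of_finite_right _).comp_left _).sub
    (FiniteRank.sum fun d _ => (finiteRank_of_finite_right _).comp_left _)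

/-- The frame of `β` at the basis `e`. -/
def betaFrame [FiniteDimensional K K'] {A : Module.End K V} (hA : T.toLinearMap = A) :
    DetFrame (asym v A) (N.toNat * r) ((-N).toNat * r) where
  iso := betaIso hT e
  lift := by
    subst hA
    have h : LinearMap.fst K (Disc K v) (Fin ((-N).toNat * r) → K) ∘ₗ
        (betaIso hT e).toLinearMap ∘ₗ LinearMap.inl K (Disc K v) (Fin (N.toNat * r) → K) -
        asym v T.toLinearMap = (proj K v ∘ₗ (trunc K v (-N) - trunc K v 0)) ∘ₗ T.toLinearMap ∘ₗ
          sec K v := by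
      refine LinearMap.ext fun x => ?_
      simp [betaIso_apply, src_apply, tgtInv_apply, asym]
    rw [h]
    exact ((finiteRank_trunc_sub_trunc v _ _).comp_left _).comp_right _

/-- The cocycle of `β`: the frames at two bases differ by the determinant of the change of basis in
`|N|` degrees. -/
lemma fdet_betaIso :
    fdet ((betaIso hT e).symm.toLinearMap ∘ₗ (betaIso hT e').toLinearMap) = e.det e' ^ N := by
  rcases le_total 0 N with hN | hN
  · have hemp : IsEmpty (Fin ((-N).toNat * r)) := by
      rw [show (-N).toNat = 0 by omega, zero_mul]
      infer_instance
    have htgt : ∀ y c, tgt v N e (y, c) = tgt v N e' (y, c) := by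
      intro y c
      rw [tgt_apply, tgt_apply, Subsingleton.elim c 0, map_zero, map_zero]
    rw [fdet_id_prodMap _ (winCoord v e (degNeg N) ∘ₗ win v e' (degNeg N)),
      det_winCoord_win degNeg_injective]
    · conv_rhs => rw [← Int.toNat_of_nonneg hN]
      rw [zpow_natCast]
    · intro x c
      simp only [LinearMap.comp_apply, LinearEquiv.coe_coe]
      rw [betaIso_symm_apply, htgt, tgt_betaIso, srcInv_src_apply hT]
  · have hemp : IsEmpty (Fin (N.toNat * r)) := by
      rw [show N.toNat = 0 by omega, zero_mul]
      infer_instance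
    have hsrc : ∀ p, src v T N e' p = src v T N e p := by
      rintro ⟨y, c⟩
      rw [src_apply, src_apply, Subsingleton.elim c 0, map_zero, map_zero]
    have h1 : (betaIso hT e).symm.toLinearMap ∘ₗ (betaIso hT e').toLinearMap =
        (betaIso hT e).symm.toLinearMap ∘ₗ ((betaIso hT e').toLinearMap ∘ₗ
          (betaIso hT e).symm.toLinearMap) ∘ₗ (betaIso hT e).symm.symm.toLinearMap := by
      refine LinearMap.ext fun x => ?_
      simp
    have h2 : ∀ x c, ((betaIso hT e').toLinearMap ∘ₗ (betaIso hT e).symm.toLinearMap) (x, c) =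
        (x, (winCoord v e' (degPos N) ∘ₗ win v e (degPos N)) c) := by
      intro x c
      simp only [LinearMap.comp_apply, LinearEquiv.coe_coe]
      rw [betaIso_symm_apply, betaIso_apply, hsrc, src_srcInv hT, trunc_max_tgt, tgtInv_tgt_apply]
    have h3 : FiniteRank ((betaIso hT e').toLinearMap ∘ₗ (betaIso hT e).symm.toLinearMap - 1) := by
      have : (betaIso hT e').toLinearMap ∘ₗ (betaIso hT e).symm.toLinearMap - 1 =
          LinearMap.inr K _ _ ∘ₗ (winCoord v e' (degPos N) ∘ₗ win v e (degPos N) - 1) ∘ₗ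
            LinearMap.snd K _ _ := by
        refine LinearMap.ext fun ⟨x, c⟩ => ?_
        rw [LinearMap.sub_apply, h2]
        simp
      rw [this]
      exact ((finiteRank_of_finite_left _).comp_right _).comp_left _
    rw [h1, fdet_conj h3, fdet_id_prodMap _ _ h2, det_winCoord_win degPos_injective]
    conv_rhs => rw [show N = -((-N).toNat : ℤ) by omega]
    have h4 : e.det e' * e'.det e = 1 := by
      rw [Module.Basis.det_apply, Module.Basis.det_apply, ← Matrix.det_mul,
        Module.Basis.toMatrix_mul_toMatrix_flip, Matrix.det_one]
    rw [zpow_neg, zpow_natCast, ← inv_pow, ← eq_inv_of_mul_eq_one_right h4]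

end BetaFrame

section Beta

variable {k K K' : Type*} [Field k] [Field K] [Field K'] [Algebra k K'] [Algebra K K']
  [FiniteDimensional K K']
variable {V : Type*} [AddCommGroup V] [Module (LaurentSeries K') V]
variable [Module K V] [IsScalarTower K (LaurentSeries K') V]
variable {ι : Type*} [Fintype ι]
variable {v : Module.Basis ι (LaurentSeries K') V} {T : V ≃ₗ[K] V} {N : ℤ}

variable {A : Module.End K V} (hT : ∀ x, T x ∈ lat K v (-N) ↔ x ∈ lat K v 0)
  (hA : T.toLinearMap = A)

/-- The isomorphism `β`, given on coordinates by evaluation at the frames `betaFrame`. -/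
def betaMap : DetLine (asym v A) →ₗ[K] DetPow (K := K) N (ι → K') where
  toFun s := ⟨fun e => s.1 _ _ (betaFrame hT e hA), fun e e' => by
    rw [← fdet_betaIso hT e e']
    exact s.2.1 _ _ (betaFrame hT e hA) (betaFrame hT e' hA)⟩
  map_add' _ _ := rfl
  map_smul' _ _ := rfl

lemma DetPow.eq_of_apply_eq {U : Type*} [AddCommGroup U] [Module K U]
    {s s' : DetPow (K := K) N U} (e : Module.Basis (Fin (Module.finrank K U)) K U)
    (h : s.1 e = s'.1 e) : s = s' :=
  Subtype.ext (funext fun e' => by rw [s.2 e' e, s'.2 e' e, h])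

lemma betaMap_bijective : Function.Bijective (betaMap hT hA) := by
  let e₀ := Module.finBasis K (ι → K')
  constructor
  · refine (injective_iff_map_eq_zero _).mpr fun s hs => ?_
    refine DetLine.eq_zero_of_apply_eq_zero (betaFrame hT e₀ hA) s ?_
    exact congrFun (congrArg Subtype.val hs) e₀
  · intro w
    refine ⟨w.1 e₀ • (betaFrame hT e₀ hA).gen, DetPow.eq_of_apply_eq e₀ ?_⟩
    change w.1 e₀ * (betaFrame hT e₀ hA).gen.1 _ _ (betaFrame hT e₀ hA) = w.1 e₀
    rw [DetFrame.gen_self, mul_one]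

/-- The isomorphism `β` as a linear equivalence. -/
def betaEquiv : DetLine (asym v A) ≃ₗ[K] DetPow (K := K) N (ι → K') :=
  LinearEquiv.ofBijective (betaMap hT hA) (betaMap_bijective hT hA)

lemma betaEquiv_apply (s : DetLine (asym v A))
    (e : Module.Basis (Fin (Module.finrank K (ι → K'))) K (ι → K')) :
    (betaEquiv hT hA s).1 e = s.1 _ _ (betaFrame hT e hA) := rfl

lemma win_eq_sum {r w : ℕ} (v : Module.Basis ι (LaurentSeries K') V)
    (e : Module.Basis (Fin r) K (ι → K')) (deg : Fin w → ℤ) (c : Fin (w * r) → K) :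
    win v e deg c =
      ∑ j, ∑ i, c (finProdFinEquiv (j, i)) • (tpow K' (deg j) • constVec v (e i)) := by
  simp only [win, LinearMap.sum_apply, LinearMap.smulRight_apply, LinearMap.proj_apply,
    tpow_smul_constVec (K := K)]

variable {C : AbsFlatConn k K' V} {m : ℕ} {ℓ : ℤ} {u : (PowerSeries K')ˣ} {f : LaurentSeries K'}

lemma tauE_mem_lat_iff (h : IsAdmissible K C v m) (hm : 2 ≤ m)
    (hf : f = ((u : PowerSeries K') : LaurentSeries K') * tpow K' ℓ) (x : V) :
    tauE h hm hf x ∈ lat K v (-(ℓ + m)) ↔ x ∈ lat K v 0 := by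
  have := h.tau_mem_lat_iff hm hf (A := 0) (x := x)
  rwa [zero_sub] at this

lemma tauE_toLinearMap (h : IsAdmissible K C v m) (hm : 2 ≤ m)
    (hf : f = ((u : PowerSeries K') : LaurentSeries K') * tpow K' ℓ) :
    (tauE h hm hf).toLinearMap = tau K C f := rfl

lemma isBetaFrame_iff (h : IsAdmissible K C v m) (hm : 2 ≤ m)
    (hf : f = ((u : PowerSeries K') : LaurentSeries K') * tpow K' ℓ) {r : ℕ}
    (e : Module.Basis (Fin r) K (ι → K'))
    (q : DetFrame (asym v (tau K C f)) ((ℓ + m).toNat * r) ((-(ℓ + m)).toNat * r)) :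
    IsBetaFrame C v f (ℓ + m) e q ↔
      ∀ p, tgt v (ℓ + m) e (q.iso p) = src v (tauE h hm hf) (ℓ + m) e p := by
  have h1 : ∀ x c, tgt v (ℓ + m) e (q.iso (x, c)) = sec K v (q.iso (x, c)).1 +
      ∑ j : Fin (-(ℓ + m)).toNat, ∑ i : Fin r, (q.iso (x, c)).2 (finProdFinEquiv (j, i)) •
        (tpow K' (j : ℤ) • constVec v (e i)) := by
    exact fun x c => congrArg (sec K v (q.iso (x, c)).1 + ·) (win_eq_sum v e (degPos (ℓ + m)) _)
  have h2 : ∀ x c, src v (tauE h hm hf) (ℓ + m) e (x, c) =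
      trunc K v (-(ℓ + m)) (tau K C f (sec K v x)) +
        ∑ j : Fin (ℓ + m).toNat, ∑ i : Fin r,
          c (finProdFinEquiv (j, i)) • (tpow K' (-(j : ℤ) - 1) • constVec v (e i)) := by
    exact fun x c => congrArg (trunc K v (-(ℓ + m)) (tau K C f (sec K v x)) + ·)
      (win_eq_sum v e (degNeg (ℓ + m)) c)
  constructor
  · rintro hq ⟨x, c⟩
    rw [h1, h2]
    exact hq x c
  · intro hq x c
    rw [← h1, ← h2]
    exact hq (x, c)

lemma isBeta_betaEquiv (h : IsAdmissible K C v m) (hm : 2 ≤ m)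
    (hf : f = ((u : PowerSeries K') : LaurentSeries K') * tpow K' ℓ) :
    IsBeta K C v f (ℓ + m) (betaEquiv (tauE_mem_lat_iff h hm hf) (tauE_toLinearMap h hm hf)) := by
  intro e
  refine ⟨⟨betaFrame (tauE_mem_lat_iff h hm hf) e (tauE_toLinearMap h hm hf), ?_⟩, fun q hq s => ?_⟩
  · rw [isBetaFrame_iff h hm hf]
    exact tgt_betaIso (tauE_mem_lat_iff h hm hf) e
  · rw [isBetaFrame_iff h hm hf] at hq
    have h1 : q.iso = betaIso (tauE_mem_lat_iff h hm hf) e := by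
      refine LinearEquiv.ext fun p => ?_
      rw [betaIso_apply, ← hq, tgtInv_tgt]
    have h2 : q = betaFrame (tauE_mem_lat_iff h hm hf) e (tauE_toLinearMap h hm hf) := by
      obtain ⟨q, hq'⟩ := q
      subst h1
      rfl
    rw [h2]
    rfl

end Beta

/-! ### Traces by degrees -/

section Trace

variable {K K' : Type*} [Field K] [Field K'] [Algebra K K'] [FiniteDimensional K K']
variable {V : Type*} [AddCommGroup V] [Module (LaurentSeries K') V]
variable [Module K V] [IsScalarTower K (LaurentSeries K') V]
variable {ι : Type*} [Fintype ι]
variable {v : Module.Basis ι (LaurentSeries K') V}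

lemma trunc_sub_trunc_eq_sum {A B : ℤ} (h : A ≤ B) :
    trunc K v B - trunc K v A = ∑ d ∈ Finset.Ico A B, ∑ i, incl K v d i ∘ₗ coef K v d i := by
  classical
  refine LinearMap.ext fun x => ext_coef v fun d j => ?_
  simp only [LinearMap.sub_apply, LinearMap.sum_apply, LinearMap.comp_apply, map_sub, map_sum,
    Finsupp.sub_apply, Finsupp.finsetSum_apply, HahnSeries.coeff_sub, HahnSeries.coeff_sum,
    coeff_trunc, coef_apply, repr_incl]
  have h1 : ∀ (e : ℤ) (i : ι), (if i = j then HahnSeries.single e ((v.repr x i).coeff e)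
      else (0 : LaurentSeries K')).coeff d =
      if i = j then (if d = e then (v.repr x i).coeff e else 0) else 0 := by
    intro e i
    split_ifs with h1 h2
    · rw [h2]; simp
    · exact HahnSeries.coeff_single_of_ne h2
    · rfl
  simp only [h1, Finset.sum_ite_eq', Finset.mem_univ, if_true, Finset.sum_ite_eq, Finset.mem_Ico]
  split_ifs <;> first | (exfalso; omega) | simp

/-- The trace of an operator cut off to a window of degrees is the sum of its diagonal entries. -/
lemma ftrace_comp_window (x : Module.End K V) {A B : ℤ} (h : A ≤ B) :
    ftrace (x ∘ₗ (trunc K v B - trunc K v A)) = ∑ d ∈ Finset.Ico A B, ∑ i,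
      LinearMap.trace K K' (coef K v d i ∘ₗ x ∘ₗ incl K v d i) := by
  have h1 : x ∘ₗ (trunc K v B - trunc K v A) =
      ∑ d ∈ Finset.Ico A B, ∑ i, x ∘ₗ incl K v d i ∘ₗ coef K v d i := by
    rw [trunc_sub_trunc_eq_sum h]
    refine LinearMap.ext fun y => ?_
    simp
  have hfin : ∀ d i, FiniteRank (x ∘ₗ incl K v d i ∘ₗ coef K v d i) := fun d i =>
    ((finiteRank_of_finite_left (incl K v d i)).comp_right _).comp_left _
  rw [h1, ftrace_sum fun d _ => FiniteRank.sum fun i _ => hfin d i]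
  refine Finset.sum_congr rfl fun d _ => ?_
  rw [ftrace_sum fun i _ => hfin d i]
  refine Finset.sum_congr rfl fun i _ => ?_
  rw [← LinearMap.comp_assoc, ftrace_comp_comm ((finiteRank_of_finite_left _).comp_left _),
    ftrace_eq_trace]

lemma trace_mul_eq (φ : K' →ₗ[K] K') (c : K') (h : ∀ y, φ y = c * y) :
    LinearMap.trace K K' φ = Algebra.trace K K' c := by
  rw [Algebra.trace_apply]
  congr 1
  exact LinearMap.ext h

/-- The trace of an operator composed with the projection on a window of degrees, when its diagonal
coefficients are `K'`-linear. -/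
lemma ftrace_comp_window_eq (x : Module.End K V) {A B : ℤ} (h : A ≤ B) (c : ℤ → ι → K')
    (hc : ∀ d, A ≤ d → d < B → ∀ i y, (v.repr (x (incl K v d i y)) i).coeff d = c d i * y) :
    ftrace (x ∘ₗ (trunc K v B - trunc K v A)) =
      Algebra.trace K K' (∑ d ∈ Finset.Ico A B, ∑ i, c d i) := by
  rw [ftrace_comp_window x h, map_sum]
  refine Finset.sum_congr rfl fun d hd => ?_
  rw [map_sum]
  rw [Finset.mem_Ico] at hd
  exact Finset.sum_congr rfl fun i _ => trace_mul_eq _ _ (hc d hd.1 hd.2 i)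

/-- The trace of an operator with image in a window of degrees, whose diagonal entries are
multiplications by elements of `K'`. -/
lemma ftrace_of_window {x : Module.End K V} {A B : ℤ} (h : A ≤ B)
    (hx : ∀ y, (trunc K v B - trunc K v A) (x y) = x y) (c : ℤ → ι → K')
    (hc : ∀ d, A ≤ d → d < B → ∀ i y, (v.repr (x (incl K v d i y)) i).coeff d = c d i * y) :
    FiniteRank x ∧ ftrace x = Algebra.trace K K' (∑ d ∈ Finset.Ico A B, ∑ i, c d i) := by
  have h1 : x = (trunc K v B - trunc K v A) ∘ₗ x := LinearMap.ext fun y => (hx y).symm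
  have hfin := finiteRank_trunc_sub_trunc (K := K) v A B
  refine ⟨h1 ▸ hfin.comp_right _, ?_⟩
  conv_lhs => rw [h1]
  rw [ftrace_comp_comm hfin]
  exact ftrace_comp_window_eq x h c hc

/-- The number of degrees `< D` in a window. -/
lemma sum_window_lt {A B D : ℤ} (hA : A ≤ D) (hB : D ≤ B) (y : K') :
    ∑ d ∈ Finset.Ico A B, (if d < D then y else 0) = ((D - A : ℤ) : K') * y := by
  rw [← Finset.sum_filter]
  have : (Finset.Ico A B).filter (· < D) = Finset.Ico A D := by
    ext d; simp only [Finset.mem_filter, Finset.mem_Ico]; omega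
  rw [this, Finset.sum_const, Int.card_Ico, nsmul_eq_mul]
  congr 1
  rw [← Int.cast_natCast, Int.toNat_of_nonneg (by omega)]

end Trace

/-! ### Traces of truncated multiplication operators -/

section TruncatedTraces

variable {K K' : Type*} [Field K] [Field K'] [Algebra K K'] [FiniteDimensional K K']
variable {V : Type*} [AddCommGroup V] [Module (LaurentSeries K') V]
variable [Module K V] [IsScalarTower K (LaurentSeries K') V]
variable {ι : Type*} [Fintype ι]
variable {v : Module.Basis ι (LaurentSeries K') V}

lemma trunc_mem_lat {A B : ℤ} {x : V} (hx : x ∈ lat K v B) : trunc K v A x ∈ lat K v B := by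
  rw [mem_lat] at *
  intro i d hd
  rw [coeff_trunc, hx i d hd, ite_self]

lemma trunc_sub_trunc_mem_lat (A B : ℤ) (x : V) :
    trunc K v A x - trunc K v B x ∈ lat K v (min A B) := by
  rw [mem_lat]
  intro i d hd
  rw [map_sub, Finsupp.sub_apply, HahnSeries.coeff_sub, coeff_trunc, coeff_trunc,
    if_pos (by omega), if_pos (by omega), sub_self]

lemma trunc_incl (A d : ℤ) (i : ι) (y : K') :
    trunc K v A (incl K v d i y) = if d < A then incl K v d i y else 0 := by
  classical
  refine ext_coef v fun e j => ?_
  rw [coeff_trunc]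
  have h : ∀ j, (v.repr (incl K v d i y) j).coeff e = if i = j ∧ e = d then y else 0 := by
    intro j
    rw [repr_incl]
    by_cases h1 : i = j
    · simp only [h1, if_true, true_and]; exact coeff_single_eq _ _ _
    · simp [h1]
  split_ifs with h1 h2 h2
  · rfl
  · rw [h, if_neg (by omega)]; simp
  · rw [h, if_neg (by omega)]
  · simp

lemma repr_mulMat_incl (X : Matrix ι ι (LaurentSeries K')) (d : ℤ) (i j : ι) (y : K') :
    v.repr (mulMat K v X (incl K v d i y)) j =
      (HahnSeries.C y : LaurentSeries K') * (tpow K' d * X j i) := by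
  classical
  have h : (HahnSeries.single d y : LaurentSeries K') = HahnSeries.C y * tpow K' d := by
    ext e
    rw [coeff_C_mul, tpow, coeff_single_eq, coeff_single_eq]
    split_ifs <;> simp
  simp only [repr_mulMat, repr_incl, mul_ite, mul_zero, Finset.sum_ite_eq, Finset.mem_univ, if_true,
    h]
  ring

/-- The trace of `p X p - p' X p'`, where `p` and `p'` are the truncations below `0` and `-N`. -/
lemma ftrace_trunc_mulMat_sub {X : Matrix ι ι (LaurentSeries K')} {M : ℕ}
    (hX : MatOrdGE (-(M : ℤ)) X) (N : ℤ) :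
    FiniteRank (trunc K v 0 ∘ₗ mulMat K v X ∘ₗ trunc K v 0 -
      trunc K v (-N) ∘ₗ mulMat K v X ∘ₗ trunc K v (-N)) ∧
    ftrace (trunc K v 0 ∘ₗ mulMat K v X ∘ₗ trunc K v 0 -
      trunc K v (-N) ∘ₗ mulMat K v X ∘ₗ trunc K v (-N)) =
      Algebra.trace K K' (N * X.trace.coeff 0) := by
  set Y := trunc K v 0 ∘ₗ mulMat K v X ∘ₗ trunc K v 0 -
      trunc K v (-N) ∘ₗ mulMat K v X ∘ₗ trunc K v (-N) with hY
  have hlo : min 0 (-N) - M ≤ max 0 (-N) := by omega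
  have hmem : ∀ x, Y x ∈ lat K v (min 0 (-N) - M) := by
    intro x
    have h1 : Y x = (trunc K v 0 (mulMat K v X (trunc K v 0 x)) -
        trunc K v (-N) (mulMat K v X (trunc K v 0 x))) +
        trunc K v (-N) (mulMat K v X (trunc K v 0 x - trunc K v (-N) x)) := by
      simp [hY]
    rw [h1]
    exact Submodule.add_mem _ (lat_le (by omega) (trunc_sub_trunc_mem_lat _ _ _))
      (trunc_mem_lat (mulMat_mem_lat hX (trunc_sub_trunc_mem_lat _ _ _) (by omega)))
  have hwin : ∀ x, (trunc K v (max 0 (-N)) - trunc K v (min 0 (-N) - M)) (Y x) = Y x := by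
    intro x
    rw [LinearMap.sub_apply, trunc_eq_zero (hmem x), sub_zero]
    simp only [hY, LinearMap.sub_apply, LinearMap.comp_apply, map_sub, trunc_trunc]
    rw [min_eq_right (le_max_left _ _), min_eq_right (le_max_right _ _)]
  have hdiag : ∀ d, min 0 (-N) - M ≤ d → d < max 0 (-N) → ∀ i y,
      (v.repr (Y (incl K v d i y)) i).coeff d = ((if d < 0 then (X i i).coeff 0 else 0) -
        (if d < -N then (X i i).coeff 0 else 0)) * y := by
    intro d _ _ i y
    have h3 : ∀ A : ℤ, (v.repr (trunc K v A (mulMat K v X (trunc K v A (incl K v d i y)))) i).coeff d =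
        (if d < A then (X i i).coeff 0 else 0) * y := by
      intro A
      rw [trunc_incl]
      split_ifs with h4
      · rw [coeff_trunc, if_pos h4, repr_mulMat_incl, coeff_C_mul, coeff_tpow_mul, sub_self,
          mul_comm]
      · simp
    simp only [hY, LinearMap.sub_apply, LinearMap.comp_apply, map_sub, Finsupp.sub_apply,
      HahnSeries.coeff_sub, h3]
    ring
  obtain ⟨h1, h2⟩ := ftrace_of_window hlo hwin _ hdiag
  refine ⟨h1, ?_⟩
  rw [h2, Finset.sum_comm]
  simp only [Finset.sum_sub_distrib]
  congr 1
  rw [coeff_trace, Matrix.trace, Finset.mul_sum, ← Finset.sum_sub_distrib]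
  refine Finset.sum_congr rfl fun i _ => ?_
  rw [sum_window_lt (by omega) (by omega), sum_window_lt (by omega) (by omega), ← sub_mul]
  simp only [matCoeff, Matrix.diag_apply, Matrix.map_apply]
  push_cast
  ring

/-- The discrete form of the residue formula `tr (p x (1 - p) g p) = Res (x dg)`. -/
lemma sum_coeff_mul_sub_trunc {x g : LaurentSeries K'} {m : ℕ} (hx : OrdGE (1 - (m : ℤ)) x)
    (hg : OrdGE 0 g) :
    ∑ d ∈ Finset.Ico (1 - (m : ℤ)) 0, (x * (g - HahnSeries.truncLT (-d) g)).coeff 0 =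
      res (x * ddt g) := by
  rw [← HahnSeries.coeff_sum, ← Finset.mul_sum]
  have h1 : OrdGE m (∑ d ∈ Finset.Ico (1 - (m : ℤ)) 0, (g - HahnSeries.truncLT (-d) g) -
      tpow K' 1 * ddt g) := by
    intro e he
    rw [HahnSeries.coeff_sub, coeff_tpow_mul, coeff_ddt, HahnSeries.coeff_sum]
    rcases lt_or_ge e 0 with h0 | h0
    · rw [show e - 1 + 1 = e by ring, hg e h0, mul_zero, sub_zero]
      refine Finset.sum_eq_zero fun d hd => ?_
      rw [HahnSeries.coeff_sub, HahnSeries.coeff_truncLT, hg e h0, ite_self, sub_self]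
    · have h2 : ∀ d ∈ Finset.Ico (1 - (m : ℤ)) 0, (g - HahnSeries.truncLT (-d) g).coeff e =
          g.coeff e - if d < -e then g.coeff e else 0 := by
        intro d _
        rw [HahnSeries.coeff_sub, HahnSeries.coeff_truncLT]
        congr 1
        simp only [lt_neg]
      rw [Finset.sum_congr rfl h2, Finset.sum_sub_distrib, Finset.sum_const, Int.card_Ico,
        sum_window_lt (by omega) (by omega), nsmul_eq_mul, ← Int.cast_natCast,
        Int.toNat_of_nonneg (by omega)]
      push_cast
      ring_nf
  have h3 : (x * (∑ d ∈ Finset.Ico (1 - (m : ℤ)) 0, (g - HahnSeries.truncLT (-d) g) -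
      tpow K' 1 * ddt g)).coeff 0 = 0 := hx.mul h1 0 (by omega)
  rw [mul_sub, HahnSeries.coeff_sub, sub_eq_zero] at h3
  rw [h3, mul_left_comm, coeff_tpow_mul]
  rfl

/-- The operator `p X (1 - p)` with `X` of pole order less than `m` has values in the window of
degrees `1 - m, …, -1`. -/
lemma trunc_mulMat_window {X : Matrix ι ι (LaurentSeries K')} {m : ℕ} (hX : MatOrdGE (1 - (m : ℤ)) X)
    (x : V) : (trunc K v 0 - trunc K v (1 - (m : ℤ)))
      (trunc K v 0 (mulMat K v X (x - trunc K v 0 x))) =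
      trunc K v 0 (mulMat K v X (x - trunc K v 0 x)) := by
  rw [LinearMap.sub_apply, trunc_trunc, min_self, trunc_eq_zero (trunc_mem_lat
    (mulMat_mem_lat hX (sub_trunc_mem_lat v 0 x) (by omega))), sub_zero]

/-- `tr (p X (1 - p) G p) = tr_{K'/K} Res Tr (X dG)`. -/
lemma ftrace_trunc_mulMat_mulMat {X G : Matrix ι ι (LaurentSeries K')} {m : ℕ} (hm : 1 ≤ m)
    (hX : MatOrdGE (1 - (m : ℤ)) X) (hG : MatOrdGE 0 G) :
    FiniteRank (trunc K v 0 ∘ₗ mulMat K v X ∘ₗ (1 - trunc K v 0) ∘ₗ mulMat K v G ∘ₗ trunc K v 0) ∧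
    ftrace (trunc K v 0 ∘ₗ mulMat K v X ∘ₗ (1 - trunc K v 0) ∘ₗ mulMat K v G ∘ₗ trunc K v 0) =
      Algebra.trace K K' (res (X * G.map ddt).trace) := by
  set Y := trunc K v 0 ∘ₗ mulMat K v X ∘ₗ (1 - trunc K v 0) ∘ₗ mulMat K v G ∘ₗ trunc K v 0 with hY
  have hYx : ∀ x, Y x = trunc K v 0 (mulMat K v X (mulMat K v G (trunc K v 0 x) -
      trunc K v 0 (mulMat K v G (trunc K v 0 x)))) := fun x => by
    simp only [hY, LinearMap.comp_apply, LinearMap.sub_apply, Module.End.one_apply]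
  have hwin : ∀ x, (trunc K v 0 - trunc K v (1 - (m : ℤ))) (Y x) = Y x := fun x => by
    rw [hYx, trunc_mulMat_window hX]
  have hdiag : ∀ d, 1 - (m : ℤ) ≤ d → d < 0 → ∀ i y, (v.repr (Y (incl K v d i y)) i).coeff d =
      (∑ j, (X i j * (G j i - HahnSeries.truncLT (-d) (G j i))).coeff 0) * y := by
    intro d _ hd i y
    have h3 : ∀ j, v.repr (mulMat K v G (incl K v d i y) -
        trunc K v 0 (mulMat K v G (incl K v d i y))) j = (HahnSeries.C y : LaurentSeries K') *
          (tpow K' d * (G j i - HahnSeries.truncLT (-d) (G j i))) := by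
      intro j
      rw [map_sub, Finsupp.sub_apply, repr_trunc, repr_mulMat_incl]
      ext e
      rw [HahnSeries.coeff_sub, HahnSeries.coeff_truncLT, coeff_C_mul, coeff_C_mul,
        coeff_tpow_mul, coeff_tpow_mul, HahnSeries.coeff_sub, HahnSeries.coeff_truncLT]
      split_ifs <;> first | (exfalso; omega) | ring
    rw [hYx, trunc_incl, if_pos hd, coeff_trunc, if_pos hd, repr_mulMat, HahnSeries.coeff_sum,
      Finset.sum_mul]
    refine Finset.sum_congr rfl fun j _ => ?_
    rw [h3, mul_left_comm, mul_left_comm (X i j), coeff_C_mul, coeff_tpow_mul, sub_self, mul_comm]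
  obtain ⟨h1, h2⟩ := ftrace_of_window (by omega) hwin _ hdiag
  refine ⟨h1, ?_⟩
  rw [h2]
  congr 1
  rw [Finset.sum_comm, Matrix.trace, res, HahnSeries.coeff_sum]
  refine Finset.sum_congr rfl fun i _ => ?_
  rw [Finset.sum_comm, Matrix.diag_apply, Matrix.mul_apply, HahnSeries.coeff_sum]
  exact Finset.sum_congr rfl fun j _ => sum_coeff_mul_sub_trunc (hX i j) (hG j i)

lemma sum_Ico_neg (m : ℕ) (hm : 1 ≤ m) :
    2 * ∑ d ∈ Finset.Ico (1 - (m : ℤ)) 0, (d : K') = -((m : K') * (m - 1)) := by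
  induction m, hm using Nat.le_induction with
  | base => simp
  | succ n hn ih =>
    have h : Finset.Ico (1 - ((n + 1 : ℕ) : ℤ)) 0 =
        insert (-(n : ℤ)) (Finset.Ico (1 - (n : ℤ)) 0) := by
      ext d; simp only [Finset.mem_insert, Finset.mem_Ico]; omega
    rw [h, Finset.sum_insert (by simp), mul_add, ih]
    push_cast
    ring

/-- The trace of `p X (1 - p) w t^m ∂_t p`. -/
lemma ftrace_trunc_mulMat_derOp [CharZero K'] {X : Matrix ι ι (LaurentSeries K')} {m : ℕ}
    (hm : 1 ≤ m) (hX : MatOrdGE (1 - (m : ℤ)) X) {w : LaurentSeries K'} (hw : OrdGE 0 w) :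
    FiniteRank (trunc K v 0 ∘ₗ mulMat K v X ∘ₗ (1 - trunc K v 0) ∘ₗ
      mulOp K V (w * tpow K' m) ∘ₗ derOp K v ∘ₗ trunc K v 0) ∧
    ftrace (trunc K v 0 ∘ₗ mulMat K v X ∘ₗ (1 - trunc K v 0) ∘ₗ
      mulOp K V (w * tpow K' m) ∘ₗ derOp K v ∘ₗ trunc K v 0) =
      Algebra.trace K K' (-((m : K') * (m - 1) / 2) * (w • X).trace.coeff (1 - (m : ℤ))) := by
  classical
  set Y := trunc K v 0 ∘ₗ mulMat K v X ∘ₗ (1 - trunc K v 0) ∘ₗ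
      mulOp K V (w * tpow K' m) ∘ₗ derOp K v ∘ₗ trunc K v 0 with hY
  have hYx : ∀ x, Y x = trunc K v 0 (mulMat K v X ((w * tpow K' m) • derOp K v (trunc K v 0 x) -
      trunc K v 0 ((w * tpow K' m) • derOp K v (trunc K v 0 x)))) := fun x => by
    simp only [hY, LinearMap.comp_apply, LinearMap.sub_apply, Module.End.one_apply, mulOp_apply]
  have hwin : ∀ x, (trunc K v 0 - trunc K v (1 - (m : ℤ))) (Y x) = Y x := fun x => by
    rw [hYx, trunc_mulMat_window hX]
  have hdiag : ∀ d, 1 - (m : ℤ) ≤ d → d < 0 → ∀ i y, (v.repr (Y (incl K v d i y)) i).coeff d =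
      ((d : K') * (w * X i i).coeff (1 - (m : ℤ))) * y := by
    intro d _ hd i y
    have h3 : ∀ j, v.repr ((w * tpow K' m) • derOp K v (incl K v d i y)) j =
        if i = j then (HahnSeries.C ((d : K') * y) : LaurentSeries K') *
          (tpow K' (d + m - 1) * w) else 0 := by
      intro j
      rw [map_smul, Finsupp.smul_apply, smul_eq_mul, repr_derOp, repr_incl]
      split_ifs with h
      · have h4 : ddt (HahnSeries.single d y : LaurentSeries K') =
            HahnSeries.C ((d : K') * y) * tpow K' (d - 1) := by
          ext e
          rw [coeff_ddt, coeff_C_mul, tpow, coeff_single_eq, coeff_single_eq]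
          split_ifs <;> first | (exfalso; omega) | (subst_vars; push_cast; ring)
        have h5 : tpow K' (d + m - 1) = tpow K' m * tpow K' (d - 1) := by
          rw [← tpow_add]; congr 1; ring
        rw [h4, h5]
        ring
      · have : ddt (0 : LaurentSeries K') = 0 := map_zero _
        rw [this, mul_zero]
    have h4 : (w * tpow K' m) • derOp K v (incl K v d i y) ∈ lat K v 0 := by
      rw [mem_lat]
      intro j
      rw [h3]
      split_ifs
      · intro e he
        rw [coeff_C_mul, coeff_tpow_mul, hw _ (by omega), mul_zero]
      · exact ordGE_zero 0
    rw [hYx, trunc_incl, if_pos hd, coeff_trunc, if_pos hd, trunc_eq_zero h4, sub_zero,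
      repr_mulMat]
    simp only [h3, mul_ite, mul_zero, Finset.sum_ite_eq, Finset.mem_univ, if_true]
    rw [mul_left_comm, mul_left_comm (X i i), coeff_C_mul, coeff_tpow_mul, mul_comm (X i i),
      show d - (d + m - 1) = 1 - (m : ℤ) by ring]
    ring
  obtain ⟨h1, h2⟩ := ftrace_of_window (by omega) hwin _ hdiag
  refine ⟨h1, ?_⟩
  rw [h2]
  congr 1
  simp only [← Finset.mul_sum]
  rw [← Finset.sum_mul]
  have h3 : ∑ d ∈ Finset.Ico (1 - (m : ℤ)) 0, (d : K') = -((m : K') * (m - 1) / 2) := by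
    have := sum_Ico_neg (K' := K') m hm
    linear_combination this / 2
  rw [h3, Matrix.trace, HahnSeries.coeff_sum]
  simp

end TruncatedTraces

/-! ### The trace of the derivative of the frames of `β` -/

section Commutation

variable {k K K' : Type*} [Field k] [Field K] [Field K'] [Algebra k K'] [Algebra K K']
variable {V : Type*} [AddCommGroup V] [Module (LaurentSeries K') V]
variable [Module K V] [IsScalarTower K (LaurentSeries K') V]
variable {ι : Type*} [Fintype ι]
variable {C : AbsFlatConn k K' V} {v : Module.Basis ι (LaurentSeries K') V} {m : ℕ}
variable {ℓ : ℤ} {u : (PowerSeries K')ˣ} {f : LaurentSeries K'}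

lemma ne_zero_of_eq_mul_tpow
    (hf : f = ((u : PowerSeries K') : LaurentSeries K') * tpow K' ℓ) : f ≠ 0 :=
  hf ▸ mul_ne_zero (coe_unit_ne_zero u) (tpow_ne_zero ℓ)

/-- The logarithmic derivatives of `u t^ℓ` and `u` along a horizontal field agree. -/
lemma horDer_mul_inv (θ : Derivation k K' K')
    (hf : f = ((u : PowerSeries K') : LaurentSeries K') * tpow K' ℓ) :
    horDer θ f * f⁻¹ = horDer θ ((u : PowerSeries K') : LaurentSeries K') *
      ((u : PowerSeries K') : LaurentSeries K')⁻¹ := by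
  have h := tpow_ne_zero (K' := K') ℓ
  rw [hf, mul_comm _ (tpow K' ℓ), horDer_tpow_mul, mul_inv]
  field_simp

lemma ordGE_horDer_mul_inv (θ : Derivation k K' K')
    (hf : f = ((u : PowerSeries K') : LaurentSeries K') * tpow K' ℓ) :
    OrdGE 0 (horDer θ f * f⁻¹) := by
  rw [horDer_mul_inv θ hf]
  exact ((ordGE_coe _).horDer θ).mul' (ordGE_coe_unit_inv u) (by simp)

lemma coeff_horDer_mul_inv (θ : Derivation k K' K')
    (hf : f = ((u : PowerSeries K') : LaurentSeries K') * tpow K' ℓ) :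
    (horDer θ f * f⁻¹).coeff 0 = θ (PowerSeries.constantCoeff (u : PowerSeries K')) /
      PowerSeries.constantCoeff (u : PowerSeries K') := by
  rw [horDer_mul_inv θ hf, ((ordGE_coe _).horDer θ).coeff_mul' (ordGE_coe_unit_inv u) (by simp),
    coeff_horDer, coeff_coe_zero, coeff_coe_unit_inv, div_eq_mul_inv]

/-- The relation `[∇(θ), ∇(τ_ν)] = -a ∇(τ_ν)` with `a = θ(f) / f`. -/
lemma tau_hor (C : AbsFlatConn k K' V) (θ : Derivation k K' K') (hf : f ≠ 0) (x : V) :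
    tau K C f (C.hor θ x) = C.hor θ (tau K C f x) + (horDer θ f * f⁻¹) • tau K C f x := by
  rw [tau_apply (K := K), tau_apply (K := K), C.hor_leibniz, C.flat_vert, horDer_inv θ hf, neg_smul, smul_smul]
  abel

lemma IsAdmissible.hor_mem_lat (h : IsAdmissible K C v m) (hm : 1 ≤ m) (θ : Derivation k K' K')
    {x : V} (hx : x ∈ lat K v 0) : C.hor θ x ∈ lat K v (1 - (m : ℤ)) := by
  rw [hor_eq (K := K) C v]
  exact Submodule.add_mem _ (lat_le (by omega) (horOp_mem_lat θ hx))
    (mulMat_mem_lat (h.ordGE_connForm θ) hx (by omega))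

lemma trunc_hor_sub_trunc (C : AbsFlatConn k K' V) (θ : Derivation k K' K') (x : V) :
    trunc K v 0 (C.hor θ (x - trunc K v 0 x)) =
      trunc K v 0 (mulMat K v ((connForm C v).x θ) (x - trunc K v 0 x)) := by
  rw [hor_eq (K := K) C v, map_add, trunc_eq_zero (horOp_mem_lat θ (sub_trunc_mem_lat v 0 x)), zero_add]

end Commutation

section FrameTrace

variable {k K K' : Type*} [Field k] [Field K] [Field K'] [Algebra k K] [Algebra k K']
  [Algebra K K'] [FiniteDimensional K K']
variable {V : Type*} [AddCommGroup V] [Module (LaurentSeries K') V]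
variable [Module K V] [IsScalarTower K (LaurentSeries K') V]
variable {ι : Type*} [Fintype ι]
variable {C : AbsFlatConn k K' V} {v : Module.Basis ι (LaurentSeries K') V} {m : ℕ}
variable {ℓ : ℤ} {u : (PowerSeries K')ˣ} {f : LaurentSeries K'}

variable (K) in
/-- The operator `p a p` on `V`, where `p` is the projector with kernel `V_O`. -/
def compress (v : Module.Basis ι (LaurentSeries K') V) (a : LaurentSeries K') : Module.End K V :=
  trunc K v 0 ∘ₗ mulOp K V a ∘ₗ trunc K v 0

lemma asymHor_proj (C : AbsFlatConn k K' V) (v : Module.Basis ι (LaurentSeries K') V)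
    (θ : HorField k K K') (x : V) :
    (asymHor C v θ).toFun (proj K v x) = proj K v (C.hor θ.ext (trunc K v 0 x)) := rfl

lemma asym_proj (v : Module.Basis ι (LaurentSeries K') V) (A : Module.End K V) (x : V) :
    asym v A (proj K v x) = proj K v (A (trunc K v 0 x)) := rfl

/-- The infinitesimal symmetry `∇(θ)` followed by the lift of `a` preserves `∇(τ_ν)` up to operators
of finite rank. -/
lemma IsAdmissible.finiteRank_comm (h : IsAdmissible K C v m) (hm : 2 ≤ m)
    (hf : f = ((u : PowerSeries K') : LaurentSeries K') * tpow K' ℓ) (θ : HorField k K K') :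
    FiniteRank ((asymHor C v θ).comm (asymHor C v θ) (asym v (tau K C f)) +
      asym v (compress K v (horDer θ.ext f * f⁻¹)) ∘ₗ asym v (tau K C f)) := by
  set B : ℤ := min (1 - (m : ℤ)) (-(ℓ + m)) with hB
  have hfin : FiniteRank (proj K v ∘ₗ (trunc K v 0 - trunc K v B)) :=
    (finiteRank_trunc_sub_trunc v _ _).comp_left _
  have : Module.Finite K (LinearMap.range (proj K v ∘ₗ (trunc K v 0 - trunc K v B))) := hfin
  refine finiteRank_of_forall_mem (LinearMap.range (proj K v ∘ₗ (trunc K v 0 - trunc K v B)))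
    fun s => ?_
  have hmem : ∀ z ∈ lat K v B,
      proj K v z ∈ LinearMap.range (proj K v ∘ₗ (trunc K v 0 - trunc K v B)) := fun z hz =>
    ⟨z, by simp [trunc_eq_zero hz]⟩
  obtain ⟨x, rfl⟩ := proj_surjective v s
  set α := horDer θ.ext f * f⁻¹ with hα
  set y := trunc K v 0 x with hy
  have h1 : ((asymHor C v θ).comm (asymHor C v θ) (asym v (tau K C f)) +
      asym v (compress K v α) ∘ₗ asym v (tau K C f)) (proj K v x) =
      proj K v (tau K C f (C.hor θ.ext y - trunc K v 0 (C.hor θ.ext y)) -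
        C.hor θ.ext (tau K C f y - trunc K v 0 (tau K C f y)) -
        α • (tau K C f y - trunc K v 0 (tau K C f y))) := by
    simp only [LinearMap.add_apply, LinearMap.comp_apply, ConnAlong.comm_apply, asym_proj,
      asymHor_proj, compress, mulOp_apply, proj_trunc, trunc_trunc, min_self, ← map_sub,
      ← map_add, ← hy]
    congr 1
    rw [map_sub (tau K C f), tau_hor C θ.ext (ne_zero_of_eq_mul_tpow hf), map_sub (C.hor θ.ext),
      smul_sub, ← hα]
    abel
  rw [h1]
  refine hmem _ (Submodule.sub_mem _ (Submodule.sub_mem _ ?_ ?_) ?_)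
  · have := (h.tau_mem_lat_iff hm hf (A := 0)).mpr (sub_trunc_mem_lat v 0 (C.hor θ.ext y))
    exact lat_le (by omega) this
  · exact lat_le (by omega) (h.hor_mem_lat (by omega) θ.ext (sub_trunc_mem_lat v 0 _))
  · exact smul_mem_lat (ordGE_horDer_mul_inv θ.ext hf) (sub_trunc_mem_lat v 0 _) (by omega)

/-- The difference of `constConn` and of the connection which kills the basis `e`. -/
def connDiff {r : ℕ} (θ : HorField k K K') (e : Module.Basis (Fin r) K (ι → K')) :
    Module.End K (ι → K') where
  toFun y := (constConn ι θ).toFun y - ∑ i, θ.base (e.repr y i) • e i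
  map_add' x y := by
    simp only [map_add, Finsupp.add_apply, add_smul, Finset.sum_add_distrib]
    abel
  map_smul' c x := by
    simp only [(constConn ι θ).leibniz, map_smul, Finsupp.smul_apply, smul_eq_mul,
      Derivation.leibniz, add_smul, Finset.sum_add_distrib, mul_smul, RingHom.id_apply, smul_sub,
      Finset.smul_sum]
    have h : ∑ i, e.repr x i • θ.base c • e i = θ.base c • x := by
      conv_rhs => rw [← e.sum_repr x, Finset.smul_sum]
      exact Finset.sum_congr rfl fun i _ => smul_comm _ _ _
    rw [h]
    abel

lemma trace_connDiff {r : ℕ} (θ : HorField k K K') (e : Module.Basis (Fin r) K (ι → K')) :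
    LinearMap.trace K (ι → K') (connDiff θ e) =
      ∑ i, e.repr ((constConn ι θ).toFun (e i)) i := by
  rw [LinearMap.trace_eq_matrix_trace K e, Matrix.trace]
  refine Finset.sum_congr rfl fun i _ => ?_
  have h : ∑ j, θ.base (e.repr (e i) j) • e j = 0 := by
    refine Finset.sum_eq_zero fun j _ => ?_
    rw [e.repr_self, Finsupp.single_apply]
    split_ifs <;> simp
  rw [Matrix.diag_apply, LinearMap.toMatrix_apply]
  change e.repr ((constConn ι θ).toFun (e i) - ∑ j, θ.base (e.repr (e i) j) • e j) i = _
  rw [h, sub_zero]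

lemma horOp_inclVec (v : Module.Basis ι (LaurentSeries K') V) (θ : HorField k K K') (d : ℤ)
    (y : ι → K') :
    horOp v θ.ext (inclVec K v d y) = inclVec K v d ((constConn ι θ).toFun y) := by
  refine ext_coef v fun e i => ?_
  rw [repr_horOp, coeff_horDer, coeff_inclVec, coeff_inclVec]
  split_ifs
  · rfl
  · exact map_zero _

lemma win_map_winCoord {r w : ℕ} (v : Module.Basis ι (LaurentSeries K') V) (θ : HorField k K K')
    (e : Module.Basis (Fin r) K (ι → K')) (deg : Fin w → ℤ) (x : V) :
    win v e deg (fun i => θ.base (winCoord v e deg x i)) =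
      horOp v θ.ext (∑ j, inclVec K v (deg j) (coefVec K v (deg j) x)) -
        ∑ j, inclVec K v (deg j) (connDiff θ e (coefVec K v (deg j) x)) := by
  rw [win_apply, map_sum, ← Finset.sum_sub_distrib]
  refine Finset.sum_congr rfl fun j _ => ?_
  rw [horOp_inclVec, ← map_sub]
  congr 1
  simp only [winCoord_apply]
  exact (sub_sub_cancel _ _).symm

variable {N : ℤ} {T : V ≃ₗ[K] V} {A : Module.End K V}

/-- The operator on `V` which corresponds to the derivative of the frame of `β`: the three summands
account for the connection form on the two sides of `T`, for the change of the basis of the window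
between the two lattices, and for the truncated multiplications. -/
lemma tgt_frameDeriv (hT : ∀ x, T x ∈ lat K v (-N) ↔ x ∈ lat K v 0)
    (hA : T.toLinearMap = A) {r : ℕ} (e : Module.Basis (Fin r) K (ι → K')) (θ : HorField k K K')
    {α : LaurentSeries K'} (hcomm : ∀ x, T (C.hor θ.ext x) = C.hor θ.ext (T x) + α • T x) (x : V) :
    tgt v N e (frameDeriv (asymHor C v θ) (asym v (compress K v α)) (betaFrame hT e hA)
        (srcInv v T N e x)) =
      trunc K v (-N) (T (trunc K v 0 (mulMat K v ((connForm C v).x θ.ext)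
        (T.symm (trunc K v (-N) x) - trunc K v 0 (T.symm (trunc K v (-N) x)))))) +
      ((∑ j, inclVec K v (degNeg N j) (connDiff θ e (coefVec K v (degNeg N j) x))) -
        ∑ j, inclVec K v (degPos N j) (connDiff θ e (coefVec K v (degPos N j) x))) +
      ((trunc K v 0 (mulMat K v ((connForm C v).x θ.ext) (trunc K v 0 x)) +
          trunc K v 0 (α • trunc K v 0 x)) -
        (trunc K v (-N) (mulMat K v ((connForm C v).x θ.ext) (trunc K v (-N) x)) +
          trunc K v (-N) (α • trunc K v (-N) x))) := by
  have hq : (betaFrame hT e hA).iso (srcInv v T N e x) = tgtInv v N e x := by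
    change betaIso hT e _ = _
    rw [betaIso_apply, src_srcInv hT, ← tgt_tgtInv e, tgtInv_tgt]
  have hq' : ∀ p, tgt v N e ((betaFrame hT e hA).iso p) = src v T N e p := tgt_betaIso hT e
  have h1 : tgt v N e (((asymHor C v θ).extend _).toFun (tgtInv v N e x)) =
      trunc K v 0 (C.hor θ.ext (trunc K v 0 x)) +
        win v e (degPos N) (fun i => θ.base (winCoord v e (degPos N) x i)) := rfl
  have h2 : tgt v N e ((asym v (compress K v α)).prodMap
      (0 : (Fin ((-N).toNat * r) → K) →ₗ[K] (Fin ((-N).toNat * r) → K)) (tgtInv v N e x)) =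
      trunc K v 0 (α • trunc K v 0 x) := by
    rw [tgtInv_apply, LinearMap.prodMap_apply, tgt_apply, LinearMap.zero_apply, map_zero, add_zero,
      asym_proj, sec_proj]
    simp [compress, trunc_trunc]
  have h3 : src v T N e (((asymHor C v θ).extend _).toFun (srcInv v T N e x)) =
      trunc K v (-N) (T (C.hor θ.ext (trunc K v 0 (T.symm (trunc K v (-N) x))))) +
        win v e (degNeg N) (fun i => θ.base (winCoord v e (degNeg N) x i)) := by
    rw [← trunc_map_trunc hT]
    rfl
  -- `T ∇ T⁻¹ = ∇ + α`, and dropping the truncation inside produces the first summand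
  have h4 : trunc K v (-N) (T (C.hor θ.ext (trunc K v 0 (T.symm (trunc K v (-N) x))))) =
      trunc K v (-N) (C.hor θ.ext (trunc K v (-N) x)) +
        trunc K v (-N) (α • trunc K v (-N) x) -
      trunc K v (-N) (T (trunc K v 0 (mulMat K v ((connForm C v).x θ.ext)
        (T.symm (trunc K v (-N) x) - trunc K v 0 (T.symm (trunc K v (-N) x)))))) := by
    rw [← trunc_hor_sub_trunc, trunc_map_trunc hT, map_sub (C.hor θ.ext), map_sub T,
      hcomm (T.symm _), T.apply_symm_apply, map_sub, map_add]
    abel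
  -- both sides are the truncation of `x` below degree `max 0 (-N)`
  have h5 : trunc K v 0 x + ∑ j, inclVec K v (degPos N j) (coefVec K v (degPos N j) x) =
      trunc K v (-N) x + ∑ j, inclVec K v (degNeg N j) (coefVec K v (degNeg N j) x) := by
    rw [sum_window_degNeg, ← tgt_tgtInv e, tgtInv_apply, tgt_apply, sec_proj, win_winCoord]
  have h6 := congrArg (horOp v θ.ext) h5
  rw [map_add, map_add] at h6
  have h7 : ∀ B, trunc K v B (C.hor θ.ext (trunc K v B x)) = horOp v θ.ext (trunc K v B x) +
      trunc K v B (mulMat K v ((connForm C v).x θ.ext) (trunc K v B x)) := by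
    intro B
    rw [hor_eq (K := K) C v, map_add, ← horOp_trunc, trunc_trunc, min_self]
  rw [frameDeriv, LinearMap.add_apply, LinearMap.comp_apply, LinearEquiv.coe_coe,
    ConnAlong.comm_apply, LinearEquiv.coe_coe, hq, map_add, map_sub, hq', h1, h2, h3, h4,
    win_map_winCoord, win_map_winCoord, h7, h7]
  rw [← sub_eq_zero] at h6 ⊢
  refine Eq.trans ?_ h6
  abel

end FrameTrace

/-! ### The contribution of the connection form -/

section Flatness

variable {k K K' : Type*} [Field k] [Field K] [Field K'] [Algebra k K'] [Algebra K K']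
variable {V : Type*} [AddCommGroup V] [Module (LaurentSeries K') V]
variable [Module K V] [IsScalarTower K (LaurentSeries K') V]
variable {ι : Type*} [Fintype ι] [DecidableEq ι]
variable {C : AbsFlatConn k K' V} {v : Module.Basis ι (LaurentSeries K') V} {m : ℕ}
variable {ℓ : ℤ} {u : (PowerSeries K')ˣ} {f : LaurentSeries K'}

/-- The matrix form `θ(g) + 𝒜_θ g = t^m ∂_t 𝒜_θ + g 𝒜_θ` of flatness. -/
lemma gMat_flat (C : AbsFlatConn k K' V) (v : Module.Basis ι (LaurentSeries K') V) (m : ℕ)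
    (θ : Derivation k K' K') :
    (gMat C v m).map (horDer θ) + (connForm C v).x θ * gMat C v m =
      tpow K' m • ((connForm C v).x θ).map ddt + gMat C v m * (connForm C v).x θ := by
  have h0 : ∀ i j, (connForm C v).t i j = v.repr (C.vert (v j)) i := fun _ _ => rfl
  have h0' : ∀ i j, (connForm C v).x θ i j = v.repr (C.hor θ (v j)) i := fun _ _ => rfl
  ext1 i j
  have h := congrArg (fun x => v.repr x i) (C.flat_vert θ (v j))
  simp only [repr_hor, repr_vert, ← h0, ← h0'] at h
  simp only [gMat, Matrix.add_apply, Matrix.map_apply, Matrix.smul_apply, smul_eq_mul,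
    horDer_tpow_mul, Matrix.mul_smul, Matrix.smul_mul, Matrix.mul_apply, ← mul_add, h]

lemma IsAdmissible.gMat_inv (h : IsAdmissible K C v m) (hm : 2 ≤ m) :
    IsUnit (gMat C v m).det ∧ MatOrdGE 0 (gMat C v m)⁻¹ :=
  h.ordGE_gMat.inv (h.isUnit_det hm).ne_zero

lemma IsAdmissible.ordGE_mul_gMat_inv (h : IsAdmissible K C v m) (hm : 2 ≤ m)
    (θ : Derivation k K' K') : MatOrdGE (1 - (m : ℤ)) ((connForm C v).x θ * (gMat C v m)⁻¹) := by
  have := (h.ordGE_connForm θ).mul (h.gMat_inv hm).2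
  rwa [add_zero] at this

/-- The polar part of order `m - 1` of `𝒜_θ` is determined by `g₀`: the constant term of the trace
of `g⁻¹` times the flatness equation. -/
lemma IsAdmissible.coeff_trace_mul_gMat_inv (h : IsAdmissible K C v m) (hm : 2 ≤ m)
    (θ : Derivation k K' K') :
    ((m : K') - 1) * ((connForm C v).x θ * (gMat C v m)⁻¹).trace.coeff (1 - (m : ℤ)) =
      -(θ (gMatZero C v m).det / (gMatZero C v m).det) := by
  have hdet := (h.isUnit_det hm).ne_zero
  have hinv : matCoeff 0 (gMat C v m) * matCoeff 0 (gMat C v m)⁻¹ = 1 :=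
    matCoeff_inv h.ordGE_gMat hdet
  have hord : MatOrdGE (-(m : ℤ)) (((connForm C v).x θ).map ddt) := fun i j => by
    have := (h.ordGE_connForm θ i j).ddt
    rwa [show 1 - (m : ℤ) - 1 = -m by ring] at this
  have hord' : MatOrdGE 0 ((gMat C v m).map (horDer θ)) := fun i j => (h.ordGE_gMat i j).horDer θ
  have h1 := congrArg (fun X => ((gMat C v m)⁻¹ * X).trace) (gMat_flat C v m θ)
  simp only [mul_add, Matrix.trace_add] at h1
  rw [← mul_assoc, Matrix.trace_mul_cycle, Matrix.mul_nonsing_inv _ (h.gMat_inv hm).1, one_mul,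
    ← mul_assoc, Matrix.nonsing_inv_mul _ (h.gMat_inv hm).1, one_mul, add_left_inj,
    Matrix.mul_smul, Matrix.trace_smul, smul_eq_mul] at h1
  have h2 := congrArg (fun x => x.coeff 0) h1
  simp only [coeff_tpow_mul, coeff_trace] at h2
  have h3 := (h.gMat_inv hm).2.matCoeff_mul hord'
  have h4 := (h.gMat_inv hm).2.matCoeff_mul hord
  rw [add_zero] at h3
  rw [zero_add] at h4
  have h5 : matCoeff (-(m : ℤ)) (((connForm C v).x θ).map ddt) =
      (1 - (m : K')) • matCoeff (1 - (m : ℤ)) ((connForm C v).x θ) := by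
    ext i j
    simp only [matCoeff, Matrix.map_apply, coeff_ddt, Matrix.smul_apply, smul_eq_mul]
    rw [show -(m : ℤ) + 1 = 1 - m by ring]
    push_cast
    ring
  have h6 : matCoeff 0 ((gMat C v m).map (horDer θ)) = (gMatZero C v m).map θ := rfl
  have h7 := (h.ordGE_connForm θ).matCoeff_mul (h.gMat_inv hm).2
  rw [add_zero] at h7
  rw [h3, zero_sub, h4, h5, h6, Matrix.mul_smul, Matrix.trace_smul, smul_eq_mul] at h2
  rw [coeff_trace, h7, Matrix.trace_mul_comm,
    show (gMatZero C v m).det = (matCoeff 0 (gMat C v m)).det from rfl, derivation_det θ hinv,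
    mul_div_cancel_left₀ _ (show (matCoeff 0 (gMat C v m)).det ≠ 0 from hdet), show (matCoeff 0 (gMat C v m)).map θ = (gMatZero C v m).map θ from rfl,
    h2]
  ring

end Flatness

section MainTrace

variable {k K K' : Type*} [Field k] [Field K] [Field K'] [Algebra k K] [Algebra k K']
  [Algebra K K'] [FiniteDimensional K K']
variable {V : Type*} [AddCommGroup V] [Module (LaurentSeries K') V]
variable [Module K V] [IsScalarTower K (LaurentSeries K') V]
variable {ι : Type*} [Fintype ι] [DecidableEq ι]
variable {C : AbsFlatConn k K' V} {v : Module.Basis ι (LaurentSeries K') V} {m : ℕ}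
variable {ℓ : ℤ} {u : (PowerSeries K')ˣ} {f : LaurentSeries K'}

lemma mulMat_smul (v : Module.Basis ι (LaurentSeries K') V) (a : LaurentSeries K')
    (X : Matrix ι ι (LaurentSeries K')) (x : V) :
    mulMat K v (a • X) x = a • mulMat K v X x := by
  refine v.ext_elem fun i => ?_
  rw [repr_mulMat, map_smul, Finsupp.smul_apply, repr_mulMat, smul_eq_mul, Finset.mul_sum]
  exact Finset.sum_congr rfl fun j _ => by rw [Matrix.smul_apply, smul_eq_mul, mul_assoc]

lemma mulMat_add (v : Module.Basis ι (LaurentSeries K') V)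
    (X Y : Matrix ι ι (LaurentSeries K')) (x : V) :
    mulMat K v (X + Y) x = mulMat K v X x + mulMat K v Y x := by
  refine v.ext_elem fun i => ?_
  simp only [map_add, Finsupp.add_apply, repr_mulMat, Matrix.add_apply, add_mul,
    Finset.sum_add_distrib]

/-- `t^N ∇(τ_ν) = u⁻¹ (g + t^m ∂_t)`, where `N = ℓ + m`. -/
lemma tpow_smul_tau (C : AbsFlatConn k K' V) (v : Module.Basis ι (LaurentSeries K') V) (m : ℕ)
    (hf : f = ((u : PowerSeries K') : LaurentSeries K') * tpow K' ℓ) (x : V) :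
    tpow K' (ℓ + m) • tau K C f x =
      mulMat K v (((u : PowerSeries K') : LaurentSeries K')⁻¹ • gMat C v m) x +
        (((u : PowerSeries K') : LaurentSeries K')⁻¹ * tpow K' m) • derOp K v x := by
  have h : tpow K' (ℓ + m) * (((u : PowerSeries K') : LaurentSeries K')⁻¹ * tpow K' (-(ℓ + m))) =
      ((u : PowerSeries K') : LaurentSeries K')⁻¹ := by
    rw [mul_left_comm, ← tpow_add, add_neg_cancel, tpow_zero, mul_one]
  rw [tau_eq C m hf, smul_smul, h]
  refine v.ext_elem fun i => ?_
  rw [mulMat_smul, mul_smul, ← smul_add]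
  simp only [map_smul, map_add, Finsupp.smul_apply, Finsupp.add_apply, repr_mulMat, repr_derOp,
    smul_eq_mul]
  have := repr_tpow_smul_vert C v m x i
  rw [map_smul, Finsupp.smul_apply, smul_eq_mul] at this
  rw [this]
  ring

/-- On `t^(-N) V_O` the inverse of `∇(τ_ν)` agrees with `u g⁻¹ t^N` modulo `t^m V_O`. -/
lemma tauE_symm_sub_mem_lat (h : IsAdmissible K C v m) (hm : 2 ≤ m)
    (hf : f = ((u : PowerSeries K') : LaurentSeries K') * tpow K' ℓ) {w : V}
    (hw : w ∈ lat K v (-(ℓ + m))) :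
    (tauE h hm hf).symm w - mulMat K v (((u : PowerSeries K') : LaurentSeries K') • (gMat C v m)⁻¹)
      (tpow K' (ℓ + m) • w) ∈ lat K v m := by
  obtain ⟨z, rfl⟩ := (tauE h hm hf).surjective w
  have hz : z ∈ lat K v 0 := (tauE_mem_lat_iff h hm hf z).mp hw
  have hu := coe_unit_ne_zero u
  have h1 : mulMat K v (((u : PowerSeries K') : LaurentSeries K') • (gMat C v m)⁻¹)
      (mulMat K v (((u : PowerSeries K') : LaurentSeries K')⁻¹ • gMat C v m) z) = z := by
    rw [← mulMat_mul, Matrix.smul_mul, Matrix.mul_smul, smul_smul, mul_inv_cancel₀ hu, one_smul,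
      Matrix.nonsing_inv_mul _ (h.gMat_inv hm).1, mulMat_one]
  rw [LinearEquiv.symm_apply_apply, tauE_apply, tpow_smul_tau C v m hf, map_add, h1,
    sub_add_cancel_left]
  refine Submodule.neg_mem _ (mulMat_mem_lat (A := 0) (B := m) (fun i j => ?_) ?_ (by simp))
  · exact (ordGE_coe _).mul' ((h.gMat_inv hm).2 i j) (by simp)
  · refine smul_mem_lat (A := m) (B := 0) ((ordGE_coe_unit_inv u).mul' (ordGE_tpow _) (by simp))
      ?_ (by simp)
    exact mem_lat.mpr fun i => by rw [repr_derOp]; exact (mem_lat.mp hz i).ddt_of_zero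

/-- The trace of the summand of `tgt_frameDeriv` that involves `T`. -/
lemma ftrace_conj_connForm [CharZero K'] (h : IsAdmissible K C v m) (hm : 2 ≤ m)
    (hf : f = ((u : PowerSeries K') : LaurentSeries K') * tpow K' ℓ) (θ : Derivation k K' K')
    {Y : Module.End K V}
    (hY : ∀ x, Y x = trunc K v (-(ℓ + m)) (tauE h hm hf (trunc K v 0 (mulMat K v ((connForm C v).x θ)
        ((tauE h hm hf).symm (trunc K v (-(ℓ + m)) x) -
          trunc K v 0 ((tauE h hm hf).symm (trunc K v (-(ℓ + m)) x))))))) :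
    FiniteRank Y ∧ ftrace Y = Algebra.trace K K'
      (-res ((connForm C v).x θ * (gMat C v m)⁻¹ * (gMat C v m).map ddt).trace +
        res (ddt ((u : PowerSeries K') : LaurentSeries K') *
          ((u : PowerSeries K') : LaurentSeries K')⁻¹ * ((connForm C v).x θ).trace) -
        (m : K') / 2 * (θ (gMatZero C v m).det / (gMatZero C v m).det)) := by
  set U : LaurentSeries K' := ((u : PowerSeries K') : LaurentSeries K') with hU
  have hU0 : U ≠ 0 := coe_unit_ne_zero u
  set A := (connForm C v).x θ with hA
  set g := gMat C v m with hg
  set T := tauE h hm hf with hT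
  set N : ℤ := ℓ + m with hN
  set X : Matrix ι ι (LaurentSeries K') := U • (A * g⁻¹) with hX
  have hXo : MatOrdGE (1 - (m : ℤ)) X := fun i j =>
    (ordGE_coe _).mul' (h.ordGE_mul_gMat_inv hm θ i j) (by simp)
  have hGo : MatOrdGE 0 (U⁻¹ • g) := fun i j =>
    (ordGE_coe_unit_inv u).mul' (h.ordGE_gMat i j) (by simp)
  let F : Module.End K V := trunc K v 0 ∘ₗ mulMat K v A ∘ₗ (1 - trunc K v 0)
  have hFp : ∀ x, trunc K v 0 (F x) = F x := fun x => by
    simp only [F, LinearMap.comp_apply, trunc_trunc, min_self]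
  have hF : FiniteRank F := by
    have : F = (trunc K v 0 - trunc K v (1 - (m : ℤ))) ∘ₗ F := LinearMap.ext fun x =>
      (trunc_mulMat_window (h.ordGE_connForm θ) x).symm
    rw [this]
    exact (finiteRank_trunc_sub_trunc v _ _).comp_right _
  have hYF : Y = (trunc K v (-N) ∘ₗ T.toLinearMap) ∘ₗ F ∘ₗ T.symm.toLinearMap ∘ₗ trunc K v (-N) :=
    LinearMap.ext fun x => by rw [hY]; rfl
  have hFF : F = trunc K v 0 ∘ₗ F := LinearMap.ext fun x => (hFp x).symm
  have hp2 : trunc K v (-N) ∘ₗ trunc K v (-N) = trunc K v (-N) := LinearMap.ext fun x => by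
    rw [LinearMap.comp_apply, trunc_trunc, min_self]
  -- By cyclicity the trace is that of `F T⁻¹ p_N T p`, where `p_N` may be replaced by `p_N - 1` as
  -- `F p = 0`; then `T⁻¹` is only applied to `t^(-N) V_O`, where it is known up to the kernel of `F`.
  have h1 : ftrace Y = ftrace (F ∘ₗ T.symm.toLinearMap ∘ₗ trunc K v (-N) ∘ₗ T.toLinearMap ∘ₗ
      trunc K v 0) := by
    rw [hYF, ftrace_comp_comm' (hF.comp_right _)]
    have : (F ∘ₗ T.symm.toLinearMap ∘ₗ trunc K v (-N)) ∘ₗ trunc K v (-N) ∘ₗ T.toLinearMap =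
        trunc K v 0 ∘ₗ F ∘ₗ T.symm.toLinearMap ∘ₗ trunc K v (-N) ∘ₗ T.toLinearMap := by
      conv_lhs => rw [hFF]
      conv_rhs => rw [← hp2]
      rfl
    rw [this, ftrace_comp_comm' (hF.comp_right _)]
    rfl
  have h2 : F ∘ₗ T.symm.toLinearMap ∘ₗ trunc K v (-N) ∘ₗ T.toLinearMap ∘ₗ trunc K v 0 =
      -(trunc K v 0 ∘ₗ mulMat K v X ∘ₗ (1 - trunc K v 0) ∘ₗ mulMat K v (U⁻¹ • g) ∘ₗ trunc K v 0 +
        trunc K v 0 ∘ₗ mulMat K v X ∘ₗ (1 - trunc K v 0) ∘ₗ mulOp K V (U⁻¹ * tpow K' m) ∘ₗ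
          derOp K v ∘ₗ trunc K v 0) := by
    refine LinearMap.ext fun x => ?_
    simp only [LinearMap.comp_apply, LinearMap.neg_apply, LinearMap.add_apply,
      LinearMap.sub_apply, Module.End.one_apply, LinearEquiv.coe_coe, mulOp_apply, F]
    set y := trunc K v 0 x with hy
    have hpy : trunc K v 0 y = y := by rw [hy, trunc_trunc, min_self]
    set w := T y - trunc K v (-N) (T y) with hw
    have hwl : w ∈ lat K v (-N) := sub_trunc_mem_lat _ _ _
    have hz : T.symm (trunc K v (-N) (T y)) = y - T.symm w := by
      rw [hw, map_sub, T.symm_apply_apply, sub_sub_cancel]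
    have hwz : T.symm w ∈ lat K v 0 := by
      rw [← tauE_mem_lat_iff h hm hf, ← hT, T.apply_symm_apply]; exact hwl
    have hr := tauE_symm_sub_mem_lat h hm hf hwl
    have hkill : trunc K v 0 (mulMat K v A (T.symm w - mulMat K v (U • g⁻¹) (tpow K' N • w))) = 0 :=
      trunc_eq_zero (mulMat_mem_lat (h.ordGE_connForm θ) hr (by omega))
    have htw : tpow K' N • w = (mulMat K v (U⁻¹ • g) y + (U⁻¹ * tpow K' m) • derOp K v y) -
        trunc K v 0 (mulMat K v (U⁻¹ • g) y + (U⁻¹ * tpow K' m) • derOp K v y) := by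
      rw [← tpow_smul_tau C v m hf, trunc_tpow_smul, ← smul_sub, zero_sub]
      rfl
    have hXA : X = A * (U • g⁻¹) := by rw [hX, Matrix.mul_smul]
    rw [hz, map_sub (trunc K v 0) y, trunc_eq_zero hwz, hpy, sub_zero, sub_sub_cancel_left,
      map_neg, map_neg]
    rw [map_sub, map_sub, sub_eq_zero, ← mulMat_mul, ← hXA, htw] at hkill
    rw [hkill, ← map_add, ← map_add]
    congr 3
    rw [map_add (trunc K v 0)]
    abel
  obtain ⟨h3, h4⟩ := ftrace_trunc_mulMat_mulMat (K := K) (v := v) (by omega) hXo hGo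
  obtain ⟨h5, h6⟩ := ftrace_trunc_mulMat_derOp (K := K) (v := v) (by omega) hXo
    (ordGE_coe_unit_inv u)
  refine ⟨?_, ?_⟩
  · rw [hYF]
    exact (hF.comp_right _).comp_left _
  rw [h1, h2, ftrace_neg (h3.add h5), ftrace_add h3 h5, h4, h6, ← map_add, ← map_neg]
  congr 1
  have h7 : U⁻¹ • X = A * g⁻¹ := by rw [hX, smul_smul, inv_mul_cancel₀ hU0, one_smul]
  have h8 : (U⁻¹ • g).map ddt = -(ddt U * U⁻¹ * U⁻¹) • g + U⁻¹ • g.map ddt := by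
    ext1 i j
    simp only [Matrix.map_apply, Matrix.smul_apply, Matrix.add_apply, smul_eq_mul, ddt_mul,
      ddt_inv hU0]
  have h9 : (X * (U⁻¹ • g).map ddt).trace =
      -(ddt U * U⁻¹ * A.trace) + (A * g⁻¹ * g.map ddt).trace := by
    rw [h8, mul_add, Matrix.mul_smul, Matrix.mul_smul, ← Matrix.smul_mul U⁻¹, h7, hX,
      Matrix.smul_mul, smul_smul, mul_assoc A, Matrix.nonsing_inv_mul _ (h.gMat_inv hm).1, mul_one,
      Matrix.trace_add, Matrix.trace_smul, smul_eq_mul]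
    congr 1
    field_simp
  have h10 := h.coeff_trace_mul_gMat_inv hm θ
  rw [h7, h9]
  simp only [res, HahnSeries.coeff_add, HahnSeries.coeff_neg]
  linear_combination (m : K') / 2 * h10

/-- An operator acting by `E` in each of `w` degrees has trace `w tr E`. -/
lemma ftrace_sum_inclVec {w : ℕ} (deg : Fin w → ℤ) (E : Module.End K (ι → K')) :
    FiniteRank (∑ j, inclVec K v (deg j) ∘ₗ E ∘ₗ coefVec K v (deg j)) ∧
    ftrace (∑ j, inclVec K v (deg j) ∘ₗ E ∘ₗ coefVec K v (deg j)) =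
      w * LinearMap.trace K (ι → K') E := by
  have hfin : ∀ j ∈ Finset.univ, FiniteRank (inclVec K v (deg j) ∘ₗ E ∘ₗ coefVec K v (deg j)) :=
    fun j _ => (finiteRank_of_finite_right (E ∘ₗ coefVec K v (deg j))).comp_left _
  refine ⟨FiniteRank.sum hfin, ?_⟩
  rw [ftrace_sum hfin]
  have : ∀ j, ftrace (inclVec K v (deg j) ∘ₗ E ∘ₗ coefVec K v (deg j)) =
      LinearMap.trace K (ι → K') E := by
    intro j
    rw [ftrace_comp_comm' (finiteRank_of_finite_right _), ← ftrace_eq_trace]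
    congr 1
    refine LinearMap.ext fun y => ?_
    simp only [LinearMap.comp_apply, coefVec_inclVec, if_true]
  simp [this]

/-- The trace of the logarithmic derivative of the frame of `β` at `e`, for an operator `T` with the
commutation relation of `∇(τ_ν)`. -/
lemma ftrace_frameDeriv_of_comm {T : V ≃ₗ[K] V} {N : ℤ} {E : Module.End K V}
    (hT : ∀ x, T x ∈ lat K v (-N) ↔ x ∈ lat K v 0) (hE : T.toLinearMap = E)
    {r : ℕ} (e : Module.Basis (Fin r) K (ι → K')) (θ : HorField k K K') {α : LaurentSeries K'}
    (hcomm : ∀ x, T (C.hor θ.ext x) = C.hor θ.ext (T x) + α • T x)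
    (hfin : FiniteRank ((asymHor C v θ).comm (asymHor C v θ) (asym v E) +
      asym v (compress K v α) ∘ₗ asym v E))
    (hα : OrdGE 0 α) (hA : MatOrdGE (-(m : ℤ)) ((connForm C v).x θ.ext)) {Y : Module.End K V}
    (hY : ∀ x, Y x = trunc K v (-N) (T (trunc K v 0 (mulMat K v ((connForm C v).x θ.ext)
        (T.symm (trunc K v (-N) x) - trunc K v 0 (T.symm (trunc K v (-N) x)))))))
    (hYfin : FiniteRank Y) :
    ftrace ((betaFrame hT e hE).iso.symm.toLinearMap ∘ₗ
        frameDeriv (asymHor C v θ) (asym v (compress K v α)) (betaFrame hT e hE)) =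
      (N : K) * (∑ i, e.repr ((constConn ι θ).toFun (e i)) i) +
      (ftrace Y + Algebra.trace K K' ((N : K') * (((connForm C v).x θ.ext).trace.coeff 0 +
          Fintype.card ι * α.coeff 0))) := by
  have hZfin := finiteRank_frameDeriv hfin (betaFrame hT e hE)
  let P2 : Module.End K V :=
    ∑ j, inclVec K v (degNeg N j) ∘ₗ connDiff θ e ∘ₗ coefVec K v (degNeg N j)
  let P3 : Module.End K V :=
    ∑ j, inclVec K v (degPos N j) ∘ₗ connDiff θ e ∘ₗ coefVec K v (degPos N j)
  let Y4 : Module.End K V :=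
    trunc K v 0 ∘ₗ mulMat K v ((connForm C v).x θ.ext + α • 1) ∘ₗ trunc K v 0 -
      trunc K v (-N) ∘ₗ mulMat K v ((connForm C v).x θ.ext + α • 1) ∘ₗ trunc K v (-N)
  have hsum : tgt v N e ∘ₗ frameDeriv (asymHor C v θ) (asym v (compress K v α)) (betaFrame hT e hE) ∘ₗ
      srcInv v T N e = Y + (P2 - P3) + Y4 := by
    refine LinearMap.ext fun x => ?_
    simp only [LinearMap.comp_apply]
    rw [tgt_frameDeriv hT hE e θ hcomm x, ← hY]
    simp only [P2, P3, Y4, LinearMap.add_apply, LinearMap.sub_apply, LinearMap.sum_apply,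
      LinearMap.comp_apply, mulMat_add, mulMat_smul, mulMat_one, map_add]
  have h1 : ftrace ((betaFrame hT e hE).iso.symm.toLinearMap ∘ₗ
        frameDeriv (asymHor C v θ) (asym v (compress K v α)) (betaFrame hT e hE)) =
      ftrace (Y + (P2 - P3) + Y4) := by
    rw [← hsum]
    have : (betaFrame hT e hE).iso.symm.toLinearMap = srcInv v T N e ∘ₗ tgt v N e :=
      LinearMap.ext fun p => betaIso_symm_apply hT e p
    rw [this, LinearMap.comp_assoc, ftrace_comp_comm' (hZfin.comp_left _)]
    rfl
  obtain ⟨hP2, hP2'⟩ := ftrace_sum_inclVec (v := v) (degNeg N) (connDiff θ e)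
  obtain ⟨hP3, hP3'⟩ := ftrace_sum_inclVec (v := v) (degPos N) (connDiff θ e)
  have hXo : MatOrdGE (-(m : ℤ)) ((connForm C v).x θ.ext + α • 1) := fun i j => by
    refine OrdGE.add (hA i j) ?_
    rw [Matrix.smul_apply, Matrix.one_apply]
    split_ifs
    · rw [smul_eq_mul, mul_one]
      exact hα.mono (by omega)
    · rw [smul_zero]; exact ordGE_zero _
  obtain ⟨hY4, hY4'⟩ := ftrace_trunc_mulMat_sub (K := K) (v := v) hXo N
  have hc : ((N.toNat : K) - ((-N).toNat : K)) = ((N : ℤ) : K) := by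
    have : ((N.toNat : ℤ) - ((-N).toNat : ℤ)) = N := by omega
    conv_rhs => rw [← this]
    push_cast
    rfl
  rw [h1, ftrace_add (hYfin.add (hP2.sub hP3)) hY4, ftrace_add hYfin (hP2.sub hP3),
    ftrace_sub hP2 hP3, hP2', hP3', hY4', ← sub_mul, hc, trace_connDiff, add_comm (ftrace Y),
    add_assoc]
  congr 4
  rw [Matrix.trace_add, Matrix.trace_smul, Matrix.trace_one, HahnSeries.coeff_add, smul_eq_mul,
    mul_comm α, ← map_natCast HahnSeries.C, coeff_C_mul]

/-- The trace of the logarithmic derivative of the frame of `β` at `e`. -/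
lemma IsAdmissible.ftrace_frameDeriv [CharZero K'] (h : IsAdmissible K C v m) (hm : 2 ≤ m)
    (hf : f = ((u : PowerSeries K') : LaurentSeries K') * tpow K' ℓ) (θ : HorField k K K') {r : ℕ}
    (e : Module.Basis (Fin r) K (ι → K')) :
    ftrace ((betaFrame (tauE_mem_lat_iff h hm hf) e (tauE_toLinearMap h hm hf)).iso.symm.toLinearMap ∘ₗ
        frameDeriv (asymHor C v θ) (asym v (compress K v (horDer θ.ext f * f⁻¹)))
          (betaFrame (tauE_mem_lat_iff h hm hf) e (tauE_toLinearMap h hm hf))) =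
      ((ℓ + m : ℤ) : K) * (∑ i, e.repr ((constConn ι θ).toFun (e i)) i) +
      Algebra.trace K K'
      (-res ((connForm C v).x θ.ext * (gMat C v m)⁻¹ * (gMat C v m).map ddt).trace +
        res (ddt ((u : PowerSeries K') : LaurentSeries K') *
          ((u : PowerSeries K') : LaurentSeries K')⁻¹ * ((connForm C v).x θ.ext).trace) -
        (m : K') / 2 * (θ.ext (gMatZero C v m).det / (gMatZero C v m).det) +
        ((ℓ + m : ℤ) : K') * (((connForm C v).x θ.ext).trace.coeff 0 +
          Fintype.card ι * (horDer θ.ext f * f⁻¹).coeff 0)) := by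
  set Y : Module.End K V := trunc K v (-(ℓ + m)) ∘ₗ (tauE h hm hf).toLinearMap ∘ₗ trunc K v 0 ∘ₗ
      mulMat K v ((connForm C v).x θ.ext) ∘ₗ (1 - trunc K v 0) ∘ₗ
      (tauE h hm hf).symm.toLinearMap ∘ₗ trunc K v (-(ℓ + m)) with hYdef
  have hY : ∀ x, Y x = trunc K v (-(ℓ + m)) (tauE h hm hf (trunc K v 0
      (mulMat K v ((connForm C v).x θ.ext) ((tauE h hm hf).symm (trunc K v (-(ℓ + m)) x) -
        trunc K v 0 ((tauE h hm hf).symm (trunc K v (-(ℓ + m)) x)))))) := fun x => by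
    simp only [hYdef, LinearMap.comp_apply, LinearMap.sub_apply, Module.End.one_apply,
      LinearEquiv.coe_coe]
  obtain ⟨h1, h2⟩ := ftrace_conj_connForm h hm hf θ.ext hY
  have hcomm : ∀ x, tauE h hm hf (C.hor θ.ext x) =
      C.hor θ.ext (tauE h hm hf x) + (horDer θ.ext f * f⁻¹) • tauE h hm hf x := fun x => by
    simp only [tauE_apply]
    exact tau_hor C θ.ext (ne_zero_of_eq_mul_tpow hf) x
  have key := ftrace_frameDeriv_of_comm (m := m) (tauE_mem_lat_iff h hm hf)
    (tauE_toLinearMap h hm hf) e θ hcomm (h.finiteRank_comm hm hf θ)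
    (ordGE_horDer_mul_inv θ.ext hf)
    (fun i j => (h.ordGE_connForm θ.ext i j).mono (by omega)) hY h1
  rw [h2, ← map_add] at key
  exact key

end MainTrace

/-! ### The scalar of the canonical lift -/

section ResidueDuality

variable {K K' : Type*} [Field K] [Field K'] [Algebra K K']
variable {V : Type*} [AddCommGroup V] [Module (LaurentSeries K') V]
variable [Module K V] [IsScalarTower K (LaurentSeries K') V]
variable {ι : Type*} [Fintype ι]
variable {v : Module.Basis ι (LaurentSeries K') V}
variable {ℓ : ℤ} {u : (PowerSeries K')ˣ} {f : LaurentSeries K'}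

lemma ordGE_sub_truncLT (A : ℤ) (a : LaurentSeries K') : OrdGE A (a - HahnSeries.truncLT A a) :=
  fun d hd => by rw [HahnSeries.coeff_sub, HahnSeries.coeff_truncLT, if_pos hd, sub_self]

/-- Power series and polynomials in `t⁻¹` without constant term are isotropic for the residue
pairing. -/
lemma res_sub_truncLT_mul (a b : LaurentSeries K') :
    res ((a - HahnSeries.truncLT 0 a) * b) = res (a * HahnSeries.truncLT 0 b) := by
  have h1 : res ((a - HahnSeries.truncLT 0 a) * (b - HahnSeries.truncLT 0 b)) = 0 :=
    (ordGE_sub_truncLT 0 a).mul' (D := 0) (ordGE_sub_truncLT 0 b) (by simp) (-1) (by norm_num)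
  have h2 : res (HahnSeries.truncLT 0 a * HahnSeries.truncLT 0 b) = 0 := by
    rw [res, HahnSeries.coeff_mul]
    refine Finset.sum_eq_zero fun ij hij => ?_
    have hij' : ij.1 + ij.2 = -1 := (Finset.mem_antidiagonal.mp hij).2.2
    rw [HahnSeries.coeff_truncLT, HahnSeries.coeff_truncLT]
    split_ifs <;> first | (exfalso; omega) | simp
  have h3 : (a - HahnSeries.truncLT 0 a) * b = (a - HahnSeries.truncLT 0 a) *
      (b - HahnSeries.truncLT 0 b) + a * HahnSeries.truncLT 0 b -
        HahnSeries.truncLT 0 a * HahnSeries.truncLT 0 b := by ring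
  rw [h3, res, HahnSeries.coeff_sub, HahnSeries.coeff_add]
  simp only [res] at h1 h2
  rw [h1, h2, zero_add, sub_zero, res]

/-- The residue pairing is nondegenerate. -/
lemma eq_of_forall_resForm_eq [FiniteDimensional K K'] [CharZero K] (hf : f ≠ 0) {y z : V}
    (h : ∀ x, resForm K v f x y = resForm K v f x z) : y = z := by
  classical
  refine ext_coef v fun d i => ?_
  rw [← sub_eq_zero]
  refine (traceForm_nondegenerate K K').1 _ fun c => ?_
  have hx : ∀ w : V, resForm K v f (f⁻¹ • incl K v (-1 - d) i c) w =
      Algebra.trace K K' (c * (v.repr w i).coeff d) := by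
    intro w
    have h1 : ∀ j, v.repr (f⁻¹ • incl K v (-1 - d) i c) j * v.repr w j =
        if i = j then f⁻¹ * (HahnSeries.C c * tpow K' (-1 - d)) * v.repr w j else 0 := by
      intro j
      rw [map_smul, Finsupp.smul_apply, smul_eq_mul, repr_incl]
      split_ifs
      · congr 2
        ext e
        rw [coeff_C_mul, tpow, coeff_single_eq, coeff_single_eq]
        split_ifs <;> simp
      · simp
    simp only [resForm, h1, Finset.sum_ite_eq, Finset.mem_univ, if_true]
    have h2 : f * (f⁻¹ * (HahnSeries.C c * tpow K' (-1 - d)) * v.repr w i) =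
        HahnSeries.C c * (tpow K' (-1 - d) * v.repr w i) := by
      field_simp
    rw [h2, res, coeff_C_mul, coeff_tpow_mul, sub_sub_cancel]
  have h3 := h (f⁻¹ • incl K v (-1 - d) i c)
  rw [hx, hx, ← sub_eq_zero, ← map_sub, ← mul_sub, mul_comm] at h3
  exact h3

/-- By nondegeneracy of `resForm`, any operator with the defining property of the transpose is the
chosen one. -/
lemma adj_eq [FiniteDimensional K K'] [CharZero K] (hf : f ≠ 0) {A A' : Module.End K V}
    (h : ∀ x y, resForm K v f (A x) y = resForm K v f x (A' y)) : adj v f A = A' := by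
  have hex : ∃ A' : Module.End K V, ∀ x y, resForm K v f (A x) y = resForm K v f x (A' y) :=
    ⟨A', h⟩
  have hadj : adj v f A = hex.choose := dif_pos hex
  rw [hadj]
  refine LinearMap.ext fun y =>
    eq_of_forall_resForm_eq (K := K) (v := v) hf fun x => ?_
  rw [← hex.choose_spec, h]

lemma trunc_smul_trunc {α : LaurentSeries K'} (hα : OrdGE 0 α) (x : V) :
    trunc K v 0 (α • trunc K v 0 x) = trunc K v 0 (α • x) := by
  rw [eq_comm, ← sub_eq_zero, ← map_sub, ← smul_sub]
  exact trunc_eq_zero (smul_mem_lat hα (sub_trunc_mem_lat v 0 x) (by simp))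

/-- For `a ∈ O`, the transpose of `a - p a p = (1 - p) a` is `a f⁻¹ p f`. -/
lemma adj_mulOp_sub_compress [FiniteDimensional K K'] [CharZero K] (hf : f ≠ 0)
    {α : LaurentSeries K'} (hα : OrdGE 0 α) :
    adj v f (mulOp K V α - compress K v α) =
      mulOp K V (α * f⁻¹) ∘ₗ trunc K v 0 ∘ₗ mulOp K V f := by
  refine adj_eq hf fun x y => ?_
  simp only [resForm, LinearMap.sub_apply, compress, LinearMap.comp_apply, mulOp_apply,
    trunc_smul_trunc hα, Finset.mul_sum, map_sub, Finsupp.sub_apply, repr_trunc, map_smul,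
    Finsupp.smul_apply, smul_eq_mul]
  congr 1
  simp only [res, HahnSeries.coeff_sum]
  refine Finset.sum_congr rfl fun i _ => ?_
  have h := res_sub_truncLT_mul (α * v.repr x i) (f * v.repr y i)
  simp only [res] at h
  rw [mul_left_comm, h]
  congr 1
  field_simp

lemma ordGE_of_eq_mul_tpow (hf : f = ((u : PowerSeries K') : LaurentSeries K') * tpow K' ℓ) :
    OrdGE ℓ f := by
  rw [hf]; exact (ordGE_coe _).mul' (ordGE_tpow ℓ) (by simp)

lemma ordGE_inv_of_eq_mul_tpow (hf : f = ((u : PowerSeries K') : LaurentSeries K') * tpow K' ℓ) :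
    OrdGE (-ℓ) f⁻¹ := by
  rw [hf, mul_inv, tpow_inv]; exact (ordGE_coe_unit_inv u).mul' (ordGE_tpow _) (by simp)

/-- The scalar of the canonical lift of `a ∈ O`: the projectors `p` and `f⁻¹ p f` have kernels `V_O`
and `t^(-ℓ) V_O`, so the scalar is half the trace of `a` on the virtual quotient `V_O / t^(-ℓ) V_O`,
and this trace is `-ℓ n a₀`. -/
lemma canonicalLift_z [FiniteDimensional K K'] [CharZero K]
    (hf : f = ((u : PowerSeries K') : LaurentSeries K') * tpow K' ℓ) {α : LaurentSeries K'}
    (hα : OrdGE 0 α) :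
    (canonicalLift K v f α).z =
      1 / 2 * Algebra.trace K K' (-((ℓ : K') * (Fintype.card ι * α.coeff 0))) := by
  have hf0 : f ≠ 0 := hf ▸ mul_ne_zero (coe_unit_ne_zero u) (tpow_ne_zero ℓ)
  change 1 / 2 * ftrace (adj v f (mulOp K V α - compress K v α) - compress K v α) = _
  rw [adj_mulOp_sub_compress hf0 hα]
  congr 1
  set x := mulOp K V (α * f⁻¹) ∘ₗ trunc K v 0 ∘ₗ mulOp K V f - compress K v α with hx
  have hxy : ∀ y, x y = (α * f⁻¹) • trunc K v 0 (f • y) - trunc K v 0 (α • y) := fun y => by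
    simp only [hx, LinearMap.sub_apply, compress, LinearMap.comp_apply, mulOp_apply,
      trunc_smul_trunc hα]
  have hαf : OrdGE (-ℓ) (α * f⁻¹) := hα.mul' (ordGE_inv_of_eq_mul_tpow hf) (by simp)
  have hkill : ∀ y ∈ lat K v (max 0 (-ℓ)), x y = 0 := fun y hy => by
    rw [hxy, trunc_eq_zero (smul_mem_lat (ordGE_of_eq_mul_tpow hf) hy (by omega)),
      trunc_eq_zero (smul_mem_lat hα hy (by omega)), smul_zero, sub_zero]
  have himg : ∀ y, x y ∈ lat K v (min 0 (-ℓ)) := fun y => by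
    have : x y = (α • y - trunc K v 0 (α • y)) -
        (α * f⁻¹) • (f • y - trunc K v 0 (f • y)) := by
      rw [hxy, smul_sub, smul_smul, inv_mul_cancel_right₀ hf0]
      abel
    rw [this]
    exact Submodule.sub_mem _ (lat_le (by omega) (sub_trunc_mem_lat v 0 _))
      (smul_mem_lat hαf (sub_trunc_mem_lat v 0 _) (by omega))
  have hle : min 0 (-ℓ) ≤ max 0 (-ℓ) := by omega
  have hxx : x ∘ₗ x = x ∘ₗ (trunc K v (max 0 (-ℓ)) - trunc K v (min 0 (-ℓ))) ∘ₗ x := by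
    refine LinearMap.ext fun y => ?_
    have he : (trunc K v (max 0 (-ℓ)) - trunc K v (min 0 (-ℓ))) (x y) =
        trunc K v (max 0 (-ℓ)) (x y) := by
      rw [LinearMap.sub_apply, trunc_eq_zero (himg y), sub_zero]
    rw [LinearMap.comp_apply, LinearMap.comp_apply, LinearMap.comp_apply, he, ← sub_eq_zero,
      ← map_sub]
    exact hkill _ (sub_trunc_mem_lat v _ _)
  have hdiag : ∀ d, min 0 (-ℓ) ≤ d → d < max 0 (-ℓ) → ∀ i y,
      (v.repr (x (incl K v d i y)) i).coeff d =
        ((if d < -ℓ then α.coeff 0 else 0) - (if d < 0 then α.coeff 0 else 0)) * y := by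
    classical
    intro d _ _ i y
    have h1 : ∀ b : LaurentSeries K', v.repr (b • incl K v d i y) i =
        HahnSeries.C y * (tpow K' d * b) := by
      intro b
      rw [map_smul, Finsupp.smul_apply, repr_incl, if_pos rfl, smul_eq_mul, mul_comm, ← mul_assoc]
      congr 1
      ext e
      rw [coeff_C_mul, tpow, coeff_single_eq, coeff_single_eq]
      split_ifs <;> simp
    have h2 : f.coeff ℓ * f⁻¹.coeff (-ℓ) = 1 := by
      rw [← (ordGE_of_eq_mul_tpow hf).coeff_mul' (ordGE_inv_of_eq_mul_tpow hf)
        (add_neg_cancel ℓ).symm, mul_inv_cancel₀ hf0, HahnSeries.coeff_one, if_pos rfl]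
    have h3 : ((α * f⁻¹) * HahnSeries.truncLT 0 (HahnSeries.C y * (tpow K' d * f))).coeff d =
        (if d < -ℓ then α.coeff 0 else 0) * y := by
      have h4 : OrdGE (d + ℓ) (HahnSeries.truncLT 0 (HahnSeries.C y * (tpow K' d * f))) :=
        fun e he => by
          rw [HahnSeries.coeff_truncLT, coeff_C_mul, coeff_tpow_mul,
            ordGE_of_eq_mul_tpow hf _ (by omega), mul_zero, ite_self]
      rw [hαf.coeff_mul' h4 (by omega), hα.coeff_mul' (ordGE_inv_of_eq_mul_tpow hf)
        (zero_add _).symm, HahnSeries.coeff_truncLT, coeff_C_mul, coeff_tpow_mul,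
        add_sub_cancel_left]
      split_ifs
      · linear_combination α.coeff 0 * y * h2
      · omega
      · omega
      · simp
    rw [hxy, map_sub, Finsupp.sub_apply, HahnSeries.coeff_sub, map_smul, Finsupp.smul_apply,
      repr_trunc, h1, smul_eq_mul, h3, coeff_trunc, h1, coeff_C_mul, coeff_tpow_mul, sub_self]
    split_ifs <;> ring
  rw [ftrace_eq_ftrace_comp (finiteRank_trunc_sub_trunc v _ _) hxx,
    ftrace_comp_window_eq x hle _ hdiag]
  congr 1
  simp only [Finset.sum_const, Finset.card_univ, nsmul_eq_mul]
  rw [← Finset.mul_sum, Finset.sum_sub_distrib, sum_window_lt (by omega) (by omega),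
    sum_window_lt (by omega) (by omega), ← sub_mul]
  push_cast
  ring

end ResidueDuality

/-! ### The comparison of the two connections -/

section Comparison

variable {k K K' : Type*} [Field k] [Field K] [Field K'] [Algebra k K] [Algebra k K']
  [Algebra K K']
variable {V : Type*} [AddCommGroup V] [Module (LaurentSeries K') V]
variable {ι : Type*} [Fintype ι] [DecidableEq ι]

lemma phi1_eq (C : AbsFlatConn k K' V) (v : Module.Basis ι (LaurentSeries K') V) (m : ℕ)
    (θ : Derivation k K' K') :
    phi1 C v m θ = -res ((connForm C v).x θ * (gMat C v m)⁻¹ * (gMat C v m).map ddt).trace -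
      (m : K') / 2 * (θ (gMatZero C v m).det / (gMatZero C v m).det) := by
  simp only [phi1, OneForm.wedge, OneForm.horPart, matDlog, mul_zero, zero_sub, Matrix.trace_neg]
  rw [Matrix.trace_mul_comm ((gMat C v m)⁻¹ * _), ← mul_assoc]
  simp [res]

lemma phi2_eq (C : AbsFlatConn k K' V) (v : Module.Basis ι (LaurentSeries K') V) (m : ℕ) (ℓ : ℤ)
    (θ : Derivation k K' K') :
    phi2 C v m ℓ θ = ((ℓ : K') + m) * ((connForm C v).x θ).trace.coeff 0 := by
  simp only [phi2, OneForm.wedge, OneForm.horPart, OneForm.trace, dtOverT, mul_zero, sub_zero]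
  rw [mul_comm _ (tpow K' (-1)), res, coeff_tpow_mul, sub_self]

lemma phi3_eq (C : AbsFlatConn k K' V) (v : Module.Basis ι (LaurentSeries K') V) (m : ℕ) (ℓ : ℤ)
    (u : PowerSeries K') (θ : Derivation k K' K') :
    phi3 C v m ℓ u θ = (Fintype.card ι : K') * ((ℓ : K') / 2 + m) *
      (θ (PowerSeries.constantCoeff u) / PowerSeries.constantCoeff u) -
      (res (horDer θ (u : LaurentSeries K') * (u : LaurentSeries K')⁻¹ * (connForm C v).trace.t) -
        res (ddt (u : LaurentSeries K') * (u : LaurentSeries K')⁻¹ *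
          ((connForm C v).x θ).trace)) := by
  simp only [phi3, OneForm.wedge, dlog, res, HahnSeries.coeff_sub]
  rfl

variable [FiniteDimensional K K'] [Module K V] [IsScalarTower K (LaurentSeries K') V]
variable {C : AbsFlatConn k K' V} {v : Module.Basis ι (LaurentSeries K') V} {m : ℕ}
variable {ℓ : ℤ} {u : (PowerSeries K')ˣ} {f : LaurentSeries K'}

/-- The value of the `ε`-connection on the frame of `β` at `e`, compared with the constant
connection. -/
lemma epsDeriv_betaFrame [CharZero K] (h : IsAdmissible K C v m) (hm : 2 ≤ m)
    (hf : f = ((u : PowerSeries K') : LaurentSeries K') * tpow K' ℓ) (θ : HorField k K K')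
    (s : epsLine K C v f) {r : ℕ} (e : Module.Basis (Fin r) K (ι → K')) :
    epsDeriv C v f θ s _ _ (betaFrame (tauE_mem_lat_iff h hm hf) e (tauE_toLinearMap h hm hf)) =
      θ.base (s.1 _ _ (betaFrame (tauE_mem_lat_iff h hm hf) e (tauE_toLinearMap h hm hf))) +
      s.1 _ _ (betaFrame (tauE_mem_lat_iff h hm hf) e (tauE_toLinearMap h hm hf)) *
        (((ℓ + m : ℤ) : K) * (∑ i, e.repr ((constConn ι θ).toFun (e i)) i) +
          Algebra.trace K K' (phi1 C v m θ.ext + phi2 C v m ℓ θ.ext + phi3 C v m ℓ u θ.ext)) := by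
  have : CharZero K' := charZero_of_injective_algebraMap (algebraMap K K').injective
  have h1 : epsDeriv C v f θ s _ _
      (betaFrame (tauE_mem_lat_iff h hm hf) e (tauE_toLinearMap h hm hf)) =
      θ.base (s.1 _ _ (betaFrame (tauE_mem_lat_iff h hm hf) e (tauE_toLinearMap h hm hf))) +
      s.1 _ _ (betaFrame (tauE_mem_lat_iff h hm hf) e (tauE_toLinearMap h hm hf)) *
      (ftrace ((betaFrame (tauE_mem_lat_iff h hm hf) e
          (tauE_toLinearMap h hm hf)).iso.symm.toLinearMap ∘ₗ
        frameDeriv (asymHor C v θ) (asym v (compress K v (horDer θ.ext f * f⁻¹)))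
          (betaFrame (tauE_mem_lat_iff h hm hf) e (tauE_toLinearMap h hm hf))) +
      ((canonicalLift K v f (horDer θ.ext f * f⁻¹)).z -
        Algebra.trace K K' (res (horDer θ.ext f * f⁻¹ * (connForm C v).trace.t)))) := rfl
  have h2 : ∀ y : K', 1 / 2 * Algebra.trace K K' y = Algebra.trace K K' (1 / 2 * y) := by
    intro y
    have : (1 / 2 : K') * y = (1 / 2 : K) • y := by
      rw [Algebra.smul_def, map_div₀, map_one, map_ofNat]
    rw [this, map_smul, smul_eq_mul]
  rw [h1, h.ftrace_frameDeriv hm hf θ e, canonicalLift_z hf (ordGE_horDer_mul_inv θ.ext hf), h2,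
    ← map_sub, add_assoc, ← map_add]
  congr 4
  rw [phi1_eq, phi2_eq, phi3_eq, ← coeff_horDer_mul_inv θ.ext hf, ← horDer_mul_inv θ.ext hf]
  push_cast
  ring

end Comparison

end EpsLine

end

theorem theorem5p6 {k K K' : Type*} [Field k] [CharZero k] [Field K] [Field K']
    [Algebra k K] [Algebra k K'] [Algebra K K'] [IsScalarTower k K K'] [FiniteDimensional K K']
    {V : Type*} [AddCommGroup V] [Module (LaurentSeries K') V]
    [Module K V] [IsScalarTower K (LaurentSeries K') V]
    {ι : Type*} [Fintype ι] [DecidableEq ι]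
    (C : EpsLine.AbsFlatConn k K' V) (v : Module.Basis ι (LaurentSeries K') V)
    (m : ℕ) (hm : 2 ≤ m) (hadm : EpsLine.IsAdmissible K C v m)
    (ℓ : ℤ) (u : (PowerSeries K')ˣ)
    (f : LaurentSeries K') (hf : f = ((u : PowerSeries K') : LaurentSeries K') * EpsLine.tpow K' ℓ) :
    ∃ β : EpsLine.epsLine K C v f ≃ₗ[K] EpsLine.DetPow (K := K) (ℓ + m) (ι → K'),
      EpsLine.IsBeta K C v f (ℓ + m) β ∧
      ∀ θ : EpsLine.HorField k K K',
        ∃ nablaEps : EpsLine.epsLine K C v f → EpsLine.epsLine K C v f,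
          (∀ s a b q, (nablaEps s).1 a b q = EpsLine.epsDeriv C v f θ s a b q) ∧
        ∃ nablaZero : EpsLine.DetPow (K := K) (ℓ + m) (ι → K') →
            EpsLine.DetPow (K := K) (ℓ + m) (ι → K'),
          (∀ s e, (nablaZero s).1 e =
            EpsLine.detPowDeriv (ℓ + m) (EpsLine.constConn ι θ) s e) ∧
        ∀ s : EpsLine.epsLine K C v f,
          nablaEps s - β.symm (nablaZero (β s)) =
            Algebra.trace K K' (EpsLine.phi1 C v m θ.ext + EpsLine.phi2 C v m ℓ θ.ext +
              EpsLine.phi3 C v m ℓ u θ.ext) • s := by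
  have : CharZero K := charZero_of_injective_algebraMap (algebraMap k K).injective
  refine ⟨EpsLine.betaEquiv (EpsLine.tauE_mem_lat_iff hadm hm hf)
    (EpsLine.tauE_toLinearMap hadm hm hf), EpsLine.isBeta_betaEquiv hadm hm hf, fun θ => ?_⟩
  refine ⟨fun s => ⟨fun a b q => EpsLine.epsDeriv C v f θ s a b q,
    EpsLine.detLineDeriv_mem (hadm.finiteRank_comm hm hf θ) _ s⟩, fun _ _ _ _ => rfl, ?_⟩
  refine ⟨fun s => ⟨fun e => EpsLine.detPowDeriv (ℓ + m) (EpsLine.constConn ι θ) s e,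
    EpsLine.detPowDeriv_mem _ _ s⟩, fun _ _ => rfl, fun s => ?_⟩
  refine (EpsLine.betaEquiv (EpsLine.tauE_mem_lat_iff hadm hm hf)
    (EpsLine.tauE_toLinearMap hadm hm hf)).injective ?_
  rw [map_sub, LinearEquiv.apply_symm_apply, map_smul]
  -- both sides are compared at one frame of `β`
  let e := Module.finBasis K (ι → K')
  refine EpsLine.DetPow.eq_of_apply_eq e ?_
  change EpsLine.epsDeriv C v f θ s _ _ (EpsLine.betaFrame (EpsLine.tauE_mem_lat_iff hadm hm hf) e
      (EpsLine.tauE_toLinearMap hadm hm hf)) -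
    EpsLine.detPowDeriv (ℓ + m) (EpsLine.constConn ι θ) _ e = _ * _
  rw [EpsLine.epsDeriv_betaFrame hadm hm hf, EpsLine.detPowDeriv, EpsLine.betaEquiv_apply]
  ring
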